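/- **Theorem 4.1.** Let $S$ be a real analytic manifold of dimension $d$ (in the application $d=2$ and $S=S_0=C_0\cap\underline C_0\cong S^2$) with a real analytic atlas of coordinates $\omega^a$, and let $\mathbf V$, $\mathbf W$ denote sections of real analytic vector bundles over $S$ depending on two real parameters $\lambda,\nu$; in each coordinate chart they are given by their component vectors, $\mathbf V$ valued in $\mathbb R^m$ and $\mathbf W$ valued in $\mathbb R^n$ (in the application $m=18$, $n=10$). Write $\partial\!\!\!/$ for the collection of partial derivatives of the components with respect to $\omega^a$. Consider the first-order characteristic system $$\frac{\partial \mathbf V}{\partial\lambda}=\mathbf F(\mathbf V,\mathbf W,\partial\!\!\!/\,\mathbf V,\partial\!\!\!/\,\mathbf W),\qquad \frac{\partial \mathbf W}{\partial\nu}=\mathbf G(\mathbf V,\mathbf W,\partial\!\!\!/\,\mathbf V),$$ where $\mathbf F$ and $\mathbf G$ are real analytic on open sets $D_F$, $D_G$ of values of their arguments, and where the system has the same form in all charts of the atlas (that is, $D_F,D_G$ are preserved, and $\mathbf F,\mathbf G$ transform like $\mathbf V,\mathbf W$, when components and partial derivatives are transformed from one chart to another; this is no condition if there is only one chart). Let $\lambda_1,\nu_1>0$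 and let real analytic data $\mathbf V_0=\mathbf V_0(\nu,\omega)$ on $C_0=\{\lambda=0,\ 0\le\nu\le\nu_1,\ \omega\in S\}$ and $\mathbf W_0=\mathbf W_0(\lambda,\omega)$ on $\underline C_0=\{\nu=0,\ 0\le\lambda\le\lambda_1,\ \omega\in S\}$ be given such that, at every point of $\{\lambda=\nu=0\}\cong S$, the values $(\mathbf V_0,\mathbf W_0,\partial\!\!\!/\,\mathbf V_0,\partial\!\!\!/\,\mathbf W_0)$ lie in $D_F$ and $(\mathbf V_0,\mathbf W_0,\partial\!\!\!/\,\mathbf V_0)$ lie in $D_G$. Let $K\subseteq S$ be compact ($K=S$ is allowed if $S$ is compact). Then there are $\overline\lambda\in(0,\lambda_1]$ and $\overline\nu\in(0,\nu_1]$, determined by the system, the data and $K$, and an open neighbourhood $N$ of $K$ in $S$ (so $N=S$ if $K=S$), such that the system has a real analytic solution $(\mathbf V,\mathbf W)$ on $$(\lambda,\nu,\omega)\in[0,\overline\lambda]\times[0,\overline\nu]\times N$$ with $\mathbf V=\mathbf V_0$ at $\lambda=0$ and $\mathbf W=\mathbf W_0$ at $\nu=0$. This solution is unique: for all $0<a'\le\overline\lambda$,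 $0<b'\le\overline\nu$ and every open $N'\subseteq N$, every real analytic solution on $[0,a']\times[0,b']\times N'$ with the same data coincides there with $(\mathbf V,\mathbf W)$. (Real analytic on a region with boundary means real analytic at every point of it, boundary points included, i.e. in a neighbourhood of that point; a solution takes its values, with their derivatives, in $D_F$ and $D_G$.) -/

import Mathlib

open scoped Manifold ContDiff
open Set

/-- The space of (local) angular coordinates `x = (x¹, …, x^d)`; for a surface, `d = 2`. -/
abbrev Ang (d : ℕ) : Type := EuclideanSpace ℝ (Fin d)

/-- A bundle of rank `k` over `S` given by its component vectors in `ℝ^k` with respect to every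
coordinate chart of the atlas of `S`, and by the linear laws with which the components transform
under a change of chart. (Tensor fields, and tensor fields together with the first partial
derivatives of their components, are of this kind.) -/
abbrev ComponentBundle (d k : ℕ) (S : Type*) [TopologicalSpace S] [ChartedSpace (Ang d) S] :
    Type _ :=
  VectorBundleCore ℝ S (Fin k → ℝ) (atlas (Ang d) S)

namespace ComponentBundle

variable {d k : ℕ} {S : Type*} [TopologicalSpace S] [ChartedSpace (Ang d) S]

/-- Components are available on the whole domain of each chart, and the transformation laws are
real analytic in the coordinates. -/
structure IsAnalytic (Z : ComponentBundle d k S) : Prop where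
  baseSet_eq : ∀ i : atlas (Ang d) S, Z.baseSet i = i.1.source
  coordChange_analytic : ∀ i j : atlas (Ang d) S,
    AnalyticOnNhd ℝ (fun x : Ang d => Z.coordChange i j (i.1.symm x))
      (i.1 '' (i.1.source ∩ j.1.source))

/-- The `ℝ^k`-valued function of the coordinates `x` of the chart `i` formed by the components of
the section `s`. -/
noncomputable def inChart (Z : ComponentBundle d k S) (i : atlas (Ang d) S) (s : ∀ p : S, Z.Fiber p)
    (x : Ang d) : Fin k → ℝ :=
  Z.coordChange (Z.indexAt (i.1.symm x)) i (i.1.symm x) (s (i.1.symm x))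

/-- The angular derivative of the section `s` at the point with coordinates `x` in the chart `i`:
the collection of the partial derivatives of all components. -/
noncomputable def angDeriv (Z : ComponentBundle d k S) (i : atlas (Ang d) S)
    (s : ∀ p : S, Z.Fiber p) (x : Ang d) : Ang d →L[ℝ] (Fin k → ℝ) :=
  fderiv ℝ (Z.inChart i s) x

/-- How partial derivatives transform: if a section has components `v` and partial derivatives `P`
at the point `p` in the chart `i`, these are its partial derivatives at `p` in the chart `j`. -/
noncomputable def derivChange (Z : ComponentBundle d k S) (i j : atlas (Ang d) S) (p : S)
    (v : Fin k → ℝ) (P : Ang d →L[ℝ] (Fin k → ℝ)) : Ang d →L[ℝ] (Fin k → ℝ) :=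
  fderiv ℝ (fun y : Ang d =>
    Z.coordChange i j (j.1.symm y) (v + P (i.1 (j.1.symm y) - i.1 p))) (j.1 p)

/-- A one-parameter family of sections, real analytic on `[0, a] × N` (jointly in the parameter and
the coordinates, up to and including the end points of `[0, a]`). -/
def AnalyticFamily₁ (Z : ComponentBundle d k S) (a : ℝ) (N : Set S)
    (s : ℝ → ∀ p : S, Z.Fiber p) : Prop :=
  ∀ i : atlas (Ang d) S,
    AnalyticOnNhd ℝ (fun q : ℝ × Ang d => Z.inChart i (s q.1) q.2)
      (Icc 0 a ×ˢ (i.1 '' (N ∩ i.1.source)))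

/-- A two-parameter family of sections, real analytic on `[0, a] × [0, b] × N` (up to and including
the boundary of the rectangle). -/
def AnalyticFamily₂ (Z : ComponentBundle d k S) (a b : ℝ) (N : Set S)
    (s : ℝ → ℝ → ∀ p : S, Z.Fiber p) : Prop :=
  ∀ i : atlas (Ang d) S,
    AnalyticOnNhd ℝ (fun q : ℝ × ℝ × Ang d => Z.inChart i (s q.1 q.2.1) q.2.2)
      (Icc 0 a ×ˢ Icc 0 b ×ˢ (i.1 '' (N ∩ i.1.source)))

end ComponentBundle

/-- The right-hand sides of a real analytic first order characteristic system
`∂V/∂λ = F(V, W, ∂̸V, ∂̸W)`, `∂W/∂ν = G(V, W, ∂̸V)` for `V` valued in `ℝ^m` and `W` valued in `ℝ^n`.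
`F` and `G` are real analytic on open sets (such as the one where a metric among the unknowns is
nondegenerate); the dependence on the derivatives may be nonlinear. -/
structure CharSystem (d m n : ℕ) where
  /-- domain of `F` -/
  domF : Set ((Fin m → ℝ) × (Fin n → ℝ) ×
    (Ang d →L[ℝ] (Fin m → ℝ)) × (Ang d →L[ℝ] (Fin n → ℝ)))
  /-- domain of `G` -/
  domG : Set ((Fin m → ℝ) × (Fin n → ℝ) × (Ang d →L[ℝ] (Fin m → ℝ)))
  /-- right-hand side of the `λ`-equation -/
  F : (Fin m → ℝ) × (Fin n → ℝ) ×
    (Ang d →L[ℝ] (Fin m → ℝ)) × (Ang d →L[ℝ] (Fin n → ℝ)) → (Fin m → ℝ)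
  /-- right-hand side of the `ν`-equation -/
  G : (Fin m → ℝ) × (Fin n → ℝ) × (Ang d →L[ℝ] (Fin m → ℝ)) → (Fin n → ℝ)
  isOpen_domF : IsOpen domF
  isOpen_domG : IsOpen domG
  analytic_F : AnalyticOnNhd ℝ F domF
  analytic_G : AnalyticOnNhd ℝ G domG

namespace CharSystem

variable {d m n : ℕ} {S : Type*} [TopologicalSpace S] [ChartedSpace (Ang d) S]

/-- The system is a system for sections of the bundles `ZV`, `ZW` over `S`: written in components,
it is the same system in all charts. (If `S` has a single chart this is no condition.) -/
structure IsCovariant (Φ : CharSystem d m n) (ZV : ComponentBundle d m S)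
    (ZW : ComponentBundle d n S) : Prop where
  covariant_F : ∀ (i j : atlas (Ang d) S) (p : S), p ∈ i.1.source ∩ j.1.source →
    ∀ v w P Q, (v, w, P, Q) ∈ Φ.domF →
      (ZV.coordChange i j p v, ZW.coordChange i j p w,
        ZV.derivChange i j p v P, ZW.derivChange i j p w Q) ∈ Φ.domF ∧
      Φ.F (ZV.coordChange i j p v, ZW.coordChange i j p w,
        ZV.derivChange i j p v P, ZW.derivChange i j p w Q) =
        ZV.coordChange i j p (Φ.F (v, w, P, Q))
  covariant_G : ∀ (i j : atlas (Ang d) S) (p : S), p ∈ i.1.source ∩ j.1.source →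
    ∀ v w P, (v, w, P) ∈ Φ.domG →
      (ZV.coordChange i j p v, ZW.coordChange i j p w, ZV.derivChange i j p v P) ∈ Φ.domG ∧
      Φ.G (ZV.coordChange i j p v, ZW.coordChange i j p w, ZV.derivChange i j p v P) =
        ZW.coordChange i j p (Φ.G (v, w, P))

/-- The argument `(V, W, ∂̸V, ∂̸W)` of `F` at the point with coordinates `x` in the chart `i`. -/
noncomputable def argF (ZV : ComponentBundle d m S) (ZW : ComponentBundle d n S)
    (i : atlas (Ang d) S) (V : ∀ p : S, ZV.Fiber p) (W : ∀ p : S, ZW.Fiber p) (x : Ang d) :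
    (Fin m → ℝ) × (Fin n → ℝ) × (Ang d →L[ℝ] (Fin m → ℝ)) × (Ang d →L[ℝ] (Fin n → ℝ)) :=
  (ZV.inChart i V x, ZW.inChart i W x, ZV.angDeriv i V x, ZW.angDeriv i W x)

/-- The argument `(V, W, ∂̸V)` of `G` at the point with coordinates `x` in the chart `i`. -/
noncomputable def argG (ZV : ComponentBundle d m S) (ZW : ComponentBundle d n S)
    (i : atlas (Ang d) S) (V : ∀ p : S, ZV.Fiber p) (W : ∀ p : S, ZW.Fiber p) (x : Ang d) :
    (Fin m → ℝ) × (Fin n → ℝ) × (Ang d →L[ℝ] (Fin m → ℝ)) :=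
  (ZV.inChart i V x, ZW.inChart i W x, ZV.angDeriv i V x)

/-- `(V, W)` is a real analytic solution on `[0, a] × [0, b] × N` (variables `λ`, `ν`, and the point
of `S`) of the characteristic problem with data `V₀ = V₀(ν, ·)` on `C₀ = {λ = 0}` and
`W₀ = W₀(λ, ·)` on `C̲₀ = {ν = 0}`. -/
structure IsSolution (Φ : CharSystem d m n) (ZV : ComponentBundle d m S)
    (ZW : ComponentBundle d n S)
    (V₀ : ℝ → ∀ p : S, ZV.Fiber p) (W₀ : ℝ → ∀ p : S, ZW.Fiber p) (a b : ℝ) (N : Set S)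
    (V : ℝ → ℝ → ∀ p : S, ZV.Fiber p) (W : ℝ → ℝ → ∀ p : S, ZW.Fiber p) : Prop where
  analytic_V : ZV.AnalyticFamily₂ a b N V
  analytic_W : ZW.AnalyticFamily₂ a b N W
  mem_domF : ∀ l ∈ Icc 0 a, ∀ u ∈ Icc 0 b, ∀ i : atlas (Ang d) S, ∀ p ∈ N ∩ i.1.source,
    argF ZV ZW i (V l u) (W l u) (i.1 p) ∈ Φ.domF
  mem_domG : ∀ l ∈ Icc 0 a, ∀ u ∈ Icc 0 b, ∀ i : atlas (Ang d) S, ∀ p ∈ N ∩ i.1.source,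
    argG ZV ZW i (V l u) (W l u) (i.1 p) ∈ Φ.domG
  eq_V : ∀ l ∈ Icc 0 a, ∀ u ∈ Icc 0 b, ∀ i : atlas (Ang d) S, ∀ p ∈ N ∩ i.1.source,
    HasDerivAt (fun t : ℝ => ZV.inChart i (V t u) (i.1 p))
      (Φ.F (argF ZV ZW i (V l u) (W l u) (i.1 p))) l
  eq_W : ∀ l ∈ Icc 0 a, ∀ u ∈ Icc 0 b, ∀ i : atlas (Ang d) S, ∀ p ∈ N ∩ i.1.source,
    HasDerivAt (fun t : ℝ => ZW.inChart i (W l t) (i.1 p))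
      (Φ.G (argG ZV ZW i (V l u) (W l u) (i.1 p))) u
  init_V : ∀ u ∈ Icc 0 b, ∀ p ∈ N, V 0 u p = V₀ u p
  init_W : ∀ l ∈ Icc 0 a, ∀ p ∈ N, W l 0 p = W₀ l p

end CharSystem

/-! The heart is a Cauchy–Kovalevskaya theorem with several times: analytic unknowns `u_j`, each
with its own time `t_j`, satisfy `∂u_j/∂t_j = H_j(z, u, ∂_x u)` and vanish where `t_j = 0`. The
characteristic problem has this form once the data are subtracted: `V` has time `λ`, `W` has time
`ν`.

Power series are given the norm `∑ |u_γ| γ!/|γ|!`, which makes them a Banach algebra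
(`multiWeight_add_le`). In this norm integration `I_s` in a variable is bounded by 1, and so is `∂_i
I_s` for `i ≠ s`: the factor lost by differentiating is exactly balanced by the one gained by
integrating (`multiWeight_shift`, `norm_dinteg_coeff_le`). Thus no scale of shrinking domains is
needed. Take as unknowns the time derivatives `f_j`. After scaling times by `ε₁ε₂` and space by
`ε₁`, the problem reads `f = H(scaled z, ε₁ε₂ I f, ε₂ ∂I f)`, an analytic equation in the Banach
algebra by `exists_functionalCalculus`. At `ε = 0` it says `f = H(0)`, so the implicit function
theorem yields a solution for small `ε`, unique near the constants (`exists_seriesSolution`).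

Uniqueness uses the same equation. The rescaled time derivatives of any analytic solution tend to
the constants `H(0)` as `ε → 0`, and so must coincide with the implicit function. Solutions obey the
equations for nonnegative times only, but an analytic identity on positive times extends to a full
neighbourhood (`eventually_eq_zero_of_positive`).

Over `S`, a local solution is built in one chart and carried to the others by covariance. Two
solutions agree near the corner `λ = ν = 0` by local uniqueness, hence along the whole parameter
rectangle over each point by the identity theorem (`eqOn_of_eventuallyEq_at_corner`). The local
solutions over a finite cover of `K` therefore fit together. -/

/-! ### The weight `γ!/|γ|!` -/

open Finset in
-- Choosing `a i` elements from each of several disjoint blocks is one way of choosing `∑ a i` from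
-- their union; in the induction this is one term of Vandermonde's identity.
theorem prod_choose_le_choose_sum {ι : Type*} (s : Finset ι) (a b : ι → ℕ) :
    ∏ i ∈ s, (a i + b i).choose (a i) ≤ (∑ i ∈ s, (a i + b i)).choose (∑ i ∈ s, a i) := by
  classical
  induction s using Finset.induction_on with
  | empty => simp
  | insert i s hi ih =>
    rw [Finset.prod_insert hi, Finset.sum_insert hi, Finset.sum_insert hi,
      Nat.add_choose_eq (a i + b i)]
    exact (Nat.mul_le_mul_left _ ih).trans
      (Finset.single_le_sum (f := fun ij : ℕ × ℕ => (a i + b i).choose ij.1 *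
        (∑ i ∈ s, (a i + b i)).choose ij.2) (fun _ _ => Nat.zero_le _)
        (a := (a i, ∑ i ∈ s, a i)) (by simp))

/-- The weight `γ! / |γ|!` of a multi-index, the inverse of the multinomial coefficient. -/
noncomputable def multiWeight {σ : Type*} [Fintype σ] (γ : σ →₀ ℕ) : ℝ :=
  (∏ s, ((γ s).factorial : ℝ)) / ((∑ s, γ s).factorial : ℝ)

section multiWeight

variable {σ : Type*} [Fintype σ]

theorem multiWeight_pos (γ : σ →₀ ℕ) : 0 < multiWeight γ := by
  unfold multiWeight; positivity

@[simp] theorem multiWeight_zero : multiWeight (0 : σ →₀ ℕ) = 1 := by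
  simp [multiWeight]

/-- With the weight written as an inverse multinomial coefficient, this is
`prod_choose_le_choose_sum`. It makes the weighted `ℓ¹` norm submultiplicative. -/
theorem multiWeight_add_le (α β : σ →₀ ℕ) :
    multiWeight (α + β) ≤ multiWeight α * multiWeight β := by
  have h := prod_choose_le_choose_sum Finset.univ (fun s => α s) (fun s => β s)
  have h' : (∏ s, ((α s + β s).choose (α s) : ℝ)) ≤
      ((∑ s, (α s + β s)).choose (∑ s, α s) : ℝ) := by exact_mod_cast h
  have e1 : ∀ s, ((α s + β s).choose (α s) : ℝ) =
      ((α s + β s).factorial : ℝ) / ((α s).factorial * (β s).factorial) := fun s =>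
    Nat.cast_add_choose ℝ
  have e2 : ((∑ s, (α s + β s)).choose (∑ s, α s) : ℝ) =
      ((∑ s, (α s + β s)).factorial : ℝ) /
        ((∑ s, α s).factorial * (∑ s, β s).factorial) := by
    rw [Finset.sum_add_distrib, Nat.cast_add_choose]
  simp_rw [e1] at h'
  rw [e2, Finset.prod_div_distrib, Finset.prod_mul_distrib, div_le_div_iff₀ (by positivity) (by positivity)] at h'
  simp only [multiWeight, Finsupp.add_apply]
  rw [div_mul_div_comm, div_le_div_iff₀ (by positivity) (by positivity)]
  linarith

theorem multiWeight_add_single (γ : σ →₀ ℕ) (s : σ) :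
    multiWeight (γ + Finsupp.single s 1) * ((∑ t, γ t : ℕ) + 1 : ℝ) =
      multiWeight γ * (γ s + 1 : ℝ) := by
  classical
  have h1 : ∑ t, (γ + Finsupp.single s 1 : σ →₀ ℕ) t = (∑ t, γ t) + 1 := by
    simp [Finset.sum_add_distrib, Finsupp.single_apply]
  have h2 : (∏ t, (((γ + Finsupp.single s 1 : σ →₀ ℕ) t).factorial : ℝ)) =
      (γ s + 1) * ∏ t, ((γ t).factorial : ℝ) := by
    rw [← Finset.mul_prod_erase _ _ (Finset.mem_univ s),
      ← Finset.mul_prod_erase _ (fun t => ((γ t).factorial : ℝ)) (Finset.mem_univ s)]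
    have : ∀ t ∈ Finset.univ.erase s, (((γ + Finsupp.single s 1 : σ →₀ ℕ) t).factorial : ℝ) =
        ((γ t).factorial : ℝ) := fun t ht => by
      simp [(Finset.ne_of_mem_erase ht).symm]
    rw [Finset.prod_congr rfl this]
    simp [Nat.factorial_succ]; ring
  unfold multiWeight
  rw [h1, h2, Nat.factorial_succ]
  push_cast
  field_simp

/-- The left side equals `multiWeight γ / (|γ| + 1)`. This bounds integration in the variable `s` by
1. -/
theorem multiWeight_add_single_div_le (γ : σ →₀ ℕ) (s : σ) :
    multiWeight (γ + Finsupp.single s 1) / (γ s + 1 : ℝ) ≤ multiWeight γ := by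
  have h := multiWeight_add_single γ s
  rw [div_le_iff₀ (by positivity), ← h]
  have := (multiWeight_pos (γ + Finsupp.single s 1)).le
  have h2 : (0 : ℝ) ≤ (∑ t, γ t : ℕ) := by positivity
  nlinarith

/-- Both sides equal `multiWeight β * (β i + 1) / (|β| + 1)`. This exact balance makes `∂_i I_s`
bounded, and is the reason for this choice of weight. -/
theorem multiWeight_shift (β : σ →₀ ℕ) (s i : σ) :
    multiWeight (β + Finsupp.single s 1) * (β i + 1 : ℝ) / (β s + 1) =
      multiWeight (β + Finsupp.single i 1) := by
  have h := multiWeight_add_single β s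
  have h' := multiWeight_add_single β i
  have h2 : (0 : ℝ) < (∑ t, β t : ℕ) + 1 := by positivity
  rw [div_eq_iff (by positivity)]
  apply mul_right_cancel₀ h2.ne'
  linear_combination (β i + 1 : ℝ) * h - (β s + 1 : ℝ) * h'

/-- The multinomial coefficient times `y^γ` is one term in the expansion of `(∑ y_s)^|γ| ≤ 1`. It
ensures convergence of weighted series on a fixed polydisc. -/
theorem prod_pow_le_multiWeight {y : σ → ℝ} (hy0 : ∀ s, 0 ≤ y s) (hy : ∑ s, y s ≤ 1)
    (γ : σ →₀ ℕ) : ∏ s, y s ^ γ s ≤ multiWeight γ := by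
  classical
  have h := Finset.sum_pow_eq_sum_piAntidiag (Finset.univ : Finset σ) y (∑ s, γ s)
  have h3 : ((Nat.multinomial Finset.univ γ : ℕ) : ℝ) * ∏ s, y s ^ γ s ≤ 1 := by
    refine le_trans ?_ (pow_le_one₀ (n := ∑ s, γ s) (Finset.sum_nonneg fun s _ => hy0 s) hy)
    rw [h]
    exact Finset.single_le_sum (f := fun k : σ → ℕ => ((Nat.multinomial Finset.univ k : ℕ) : ℝ) *
      ∏ s, y s ^ k s) (fun k _ => mul_nonneg (Nat.cast_nonneg _)
        (Finset.prod_nonneg fun s _ => pow_nonneg (hy0 s) _)) (a := (γ : σ → ℕ)) (by simp)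
  have h4 : ((Nat.multinomial Finset.univ γ : ℕ) : ℝ) * multiWeight γ = 1 := by
    have := Nat.multinomial_spec Finset.univ (γ : σ → ℕ)
    have h5 : (∏ s, ((γ s).factorial : ℝ)) * (Nat.multinomial Finset.univ γ : ℕ) =
      ((∑ s, γ s).factorial : ℝ) := by exact_mod_cast this
    unfold multiWeight
    rw [mul_div_assoc', div_eq_one_iff_eq (by positivity), ← h5, mul_comm]
  have h6 : (0 : ℝ) < (Nat.multinomial Finset.univ γ : ℕ) := by
    rcases (Nat.cast_nonneg (α := ℝ) (Nat.multinomial Finset.univ (γ : σ → ℕ))).lt_or_eq with h | h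
    · exact h
    · rw [← h] at h4; simp at h4
  exact le_of_mul_le_mul_left (h3.trans h4.ge) h6

end multiWeight

/-! ### The Banach algebra of weighted power series -/

section convolution

variable {σ : Type*} [Fintype σ] [DecidableEq σ] {f g : (σ →₀ ℕ) → ℝ}

theorem summable_antidiagonal_multiWeight (hf : Summable fun γ => ‖f γ * multiWeight γ‖)
    (hg : Summable fun γ => ‖g γ * multiWeight γ‖) :
    Summable fun γ => ∑ p ∈ Finset.HasAntidiagonal.antidiagonal γ,
      ‖f p.1 * multiWeight p.1‖ * ‖g p.2 * multiWeight p.2‖ :=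
  summable_sum_mul_antidiagonal_of_summable_mul
    (f := fun γ => ‖f γ * multiWeight γ‖) (g := fun γ => ‖g γ * multiWeight γ‖)
    (hf.mul_of_nonneg hg (fun _ => norm_nonneg _) fun _ => norm_nonneg _)

theorem norm_antidiagonal_multiWeight_le (γ : σ →₀ ℕ) :
    ‖(∑ p ∈ Finset.HasAntidiagonal.antidiagonal γ, f p.1 * g p.2) * multiWeight γ‖ ≤
      ∑ p ∈ Finset.HasAntidiagonal.antidiagonal γ,
        ‖f p.1 * multiWeight p.1‖ * ‖g p.2 * multiWeight p.2‖ := by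
  rw [Finset.sum_mul]
  refine (norm_sum_le _ _).trans (Finset.sum_le_sum fun p hp => ?_)
  rw [← Finset.HasAntidiagonal.mem_antidiagonal.1 hp, ← norm_mul, mul_mul_mul_comm, norm_mul,
    norm_mul (f p.1 * g p.2)]
  refine mul_le_mul_of_nonneg_left ?_ (norm_nonneg _)
  rw [Real.norm_of_nonneg (multiWeight_pos _).le, Real.norm_of_nonneg
    (mul_pos (multiWeight_pos _) (multiWeight_pos _)).le]
  exact multiWeight_add_le p.1 p.2

theorem summable_norm_antidiagonal_multiWeight (hf : Summable fun γ => ‖f γ * multiWeight γ‖)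
    (hg : Summable fun γ => ‖g γ * multiWeight γ‖) :
    Summable fun γ => ‖(∑ p ∈ Finset.HasAntidiagonal.antidiagonal γ, f p.1 * g p.2) *
      multiWeight γ‖ :=
  Summable.of_nonneg_of_le (fun _ => norm_nonneg _) norm_antidiagonal_multiWeight_le
    (summable_antidiagonal_multiWeight hf hg)

theorem tsum_norm_antidiagonal_multiWeight_le (hf : Summable fun γ => ‖f γ * multiWeight γ‖)
    (hg : Summable fun γ => ‖g γ * multiWeight γ‖) :
    ∑' γ, ‖(∑ p ∈ Finset.HasAntidiagonal.antidiagonal γ, f p.1 * g p.2) * multiWeight γ‖ ≤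
      (∑' γ, ‖f γ * multiWeight γ‖) * ∑' γ, ‖g γ * multiWeight γ‖ := by
  rw [Summable.tsum_mul_tsum_eq_tsum_sum_antidiagonal hf hg
    (hf.mul_of_nonneg hg (fun _ => norm_nonneg _) fun _ => norm_nonneg _)]
  exact Summable.tsum_le_tsum norm_antidiagonal_multiWeight_le
    (summable_norm_antidiagonal_multiWeight hf hg) (summable_antidiagonal_multiWeight hf hg)

end convolution

/-- The power series `∑ u_γ z^γ` with `∑ |u_γ| γ! / |γ|! < ∞`. -/
noncomputable def weightedSubalgebra (σ : Type*) [Fintype σ] : Subalgebra ℝ (MvPowerSeries σ ℝ) where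
  carrier := {u | Summable fun γ => ‖MvPowerSeries.coeff γ u * multiWeight γ‖}
  mul_mem' := by
    classical
    intro u v hu hv
    change Summable fun γ => ‖MvPowerSeries.coeff γ (u * v) * multiWeight γ‖
    simp only [MvPowerSeries.coeff_mul]
    exact summable_norm_antidiagonal_multiWeight (f := fun γ => MvPowerSeries.coeff γ u)
      (g := fun γ => MvPowerSeries.coeff γ v) hu hv
  add_mem' := by
    intro u v hu hv
    refine Summable.of_nonneg_of_le (fun _ => norm_nonneg _) (fun γ => ?_) (hu.add hv)
    rw [map_add, add_mul]
    exact norm_add_le _ _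
  algebraMap_mem' := by
    classical
    intro r
    refine summable_of_ne_finset_zero (s := {0}) fun γ hγ => ?_
    rw [MvPowerSeries.algebraMap_apply, MvPowerSeries.coeff_C]
    simp at hγ
    simp [hγ]

/-- The Banach algebra of power series `∑ u_γ z^γ` with norm `∑ |u_γ| γ! / |γ|!`. -/
def WeightedSeries (σ : Type*) [Fintype σ] : Type _ := weightedSubalgebra σ

namespace WeightedSeries

variable {σ : Type*} [Fintype σ]

noncomputable instance : CommRing (WeightedSeries σ) :=
  inferInstanceAs (CommRing (weightedSubalgebra σ))

noncomputable instance : Algebra ℝ (WeightedSeries σ) :=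
  inferInstanceAs (Algebra ℝ (weightedSubalgebra σ))

/-- The inclusion into formal power series. -/
noncomputable def toSeries : WeightedSeries σ →ₐ[ℝ] MvPowerSeries σ ℝ := (weightedSubalgebra σ).val

/-- The coefficients of a series. -/
noncomputable def coeff (γ : σ →₀ ℕ) : WeightedSeries σ →ₗ[ℝ] ℝ :=
  (MvPowerSeries.coeff γ).comp toSeries.toLinearMap

theorem coeff_ext {u v : WeightedSeries σ} (h : ∀ γ, coeff γ u = coeff γ v) : u = v :=
  Subtype.ext (MvPowerSeries.ext h)

theorem summable_coeff (u : WeightedSeries σ) : Summable fun γ => ‖coeff γ u * multiWeight γ‖ :=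
  u.2

theorem coeff_mul [DecidableEq σ] (γ : σ →₀ ℕ) (u v : WeightedSeries σ) :
    coeff γ (u * v) = ∑ p ∈ Finset.HasAntidiagonal.antidiagonal γ, coeff p.1 u * coeff p.2 v := by
  have := MvPowerSeries.coeff_mul γ (toSeries u) (toSeries v)
  rwa [← map_mul] at this

theorem coeff_one [DecidableEq σ] (γ : σ →₀ ℕ) :
    coeff γ (1 : WeightedSeries σ) = if γ = 0 then 1 else 0 := by
  have := MvPowerSeries.coeff_one (R := ℝ) (σ := σ) (n := γ)
  rwa [← map_one toSeries] at this

/-- The weighted coefficients, as an element of `ℓ¹`. -/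
noncomputable def toLp : WeightedSeries σ →ₗ[ℝ] lp (fun _ : σ →₀ ℕ => ℝ) 1 where
  toFun u := ⟨fun γ => coeff γ u * multiWeight γ, memℓp_gen (by simpa using u.summable_coeff)⟩
  map_add' u v := by
    ext γ
    change coeff γ (u + v) * multiWeight γ = coeff γ u * multiWeight γ + coeff γ v * multiWeight γ
    rw [map_add, add_mul]
  map_smul' r u := by ext γ; simp [mul_assoc]

theorem toLp_apply (u : WeightedSeries σ) (γ : σ →₀ ℕ) :
    toLp u γ = coeff γ u * multiWeight γ := rfl

theorem toLp_injective : Function.Injective (toLp (σ := σ)) := fun u v h =>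
  coeff_ext fun γ => mul_right_cancel₀ (multiWeight_pos γ).ne' <| by
    rw [← toLp_apply, ← toLp_apply, h]

/-- Together with `norm_toLp` this identifies the space isometrically with `ℓ¹`, from which
completeness is inherited. -/
theorem toLp_surjective : Function.Surjective (toLp (σ := σ)) := by
  intro f
  have hf : Summable fun γ => ‖f γ‖ := by
    have := (memℓp_gen_iff (by simp)).1 f.2
    simpa using this
  have e : ∀ γ, f γ / multiWeight γ * multiWeight γ = f γ := fun γ =>
    div_mul_cancel₀ _ (multiWeight_pos γ).ne'
  let g : MvPowerSeries σ ℝ := fun γ => f γ / multiWeight γ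
  have hg : ∀ γ, MvPowerSeries.coeff γ g = f γ / multiWeight γ := fun γ => rfl
  refine ⟨⟨g, ?_⟩, ?_⟩
  · change Summable _
    simpa only [hg, e] using hf
  · ext γ
    exact e γ

noncomputable instance : NormedAddCommGroup (WeightedSeries σ) :=
  NormedAddCommGroup.induced _ _ (toLp (σ := σ)) toLp_injective

theorem norm_toLp (u : WeightedSeries σ) : ‖toLp u‖ = ‖u‖ := rfl

theorem norm_def (u : WeightedSeries σ) : ‖u‖ = ∑' γ, ‖coeff γ u * multiWeight γ‖ := by
  rw [← norm_toLp, lp.norm_eq_tsum_rpow (by simp)]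
  simp [toLp_apply]

noncomputable instance : NormedCommRing (WeightedSeries σ) where
  __ := (inferInstance : CommRing (WeightedSeries σ))
  __ := (inferInstance : NormedAddCommGroup (WeightedSeries σ))
  norm_mul_le u v := by
    classical
    rw [norm_def, norm_def, norm_def]
    simp only [coeff_mul]
    exact tsum_norm_antidiagonal_multiWeight_le u.summable_coeff v.summable_coeff

noncomputable instance : NormedAlgebra ℝ (WeightedSeries σ) where
  norm_smul_le r u := by
    rw [← norm_toLp, map_smul, norm_smul, norm_toLp]

instance : NormOneClass (WeightedSeries σ) where
  norm_one := by
    classical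
    rw [norm_def, tsum_eq_single 0]
    · simp [coeff_one]
    · intro γ hγ; simp [coeff_one, hγ]

instance : CompleteSpace (WeightedSeries σ) := by
  have hi : Isometry (toLp (σ := σ)) := AddMonoidHomClass.isometry_of_norm _ norm_toLp
  refine (hi.isUniformInducing).completeSpace ?_
  rw [toLp_surjective.range_eq]
  exact (completeSpace_iff_isComplete_univ).1 inferInstance

/-- The monomial `z^γ`. -/
noncomputable def mono (γ : σ →₀ ℕ) : WeightedSeries σ :=
  ⟨MvPowerSeries.monomial γ 1, by
    classical
    refine summable_of_ne_finset_zero (s := {γ}) fun δ hδ => ?_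
    rw [MvPowerSeries.coeff_monomial]
    simp at hδ
    simp [hδ]⟩

theorem coeff_mono [DecidableEq σ] (γ δ : σ →₀ ℕ) :
    coeff δ (mono γ) = if δ = γ then 1 else 0 :=
  MvPowerSeries.coeff_monomial δ γ 1

theorem norm_mono (γ : σ →₀ ℕ) : ‖mono γ‖ = multiWeight γ := by
  classical
  rw [norm_def, tsum_eq_single γ]
  · simp [coeff_mono, abs_of_pos (multiWeight_pos γ)]
  · intro δ hδ; simp [coeff_mono, hδ]

section lift

variable {B : Type*} [NormedAddCommGroup B] [NormedSpace ℝ B]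

theorem summable_norm_smul {a : (σ →₀ ℕ) → B} (ha : ∀ γ, ‖a γ‖ ≤ multiWeight γ)
    (u : WeightedSeries σ) : Summable fun γ => ‖coeff γ u • a γ‖ := by
  refine Summable.of_nonneg_of_le (fun _ => norm_nonneg _) (fun γ => ?_) u.summable_coeff
  rw [norm_smul, norm_mul, Real.norm_of_nonneg (multiWeight_pos _).le]
  exact mul_le_mul_of_nonneg_left (ha γ) (norm_nonneg _)

variable [CompleteSpace B]

/-- The continuous linear map with prescribed values on the monomials. -/
noncomputable def lift (a : (σ →₀ ℕ) → B) (ha : ∀ γ, ‖a γ‖ ≤ multiWeight γ) :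
    WeightedSeries σ →L[ℝ] B :=
  LinearMap.mkContinuous
    { toFun := fun u => ∑' γ, coeff γ u • a γ
      map_add' := fun u v => by
        rw [← (summable_norm_smul ha u).of_norm.tsum_add (summable_norm_smul ha v).of_norm]
        simp [add_smul]
      map_smul' := fun r u => by
        rw [RingHom.id_apply, ← tsum_const_smul'']
        simp [mul_smul] } 1 fun u => by
    rw [one_mul, norm_def]
    refine (norm_tsum_le_tsum_norm (summable_norm_smul ha u)).trans ?_
    refine Summable.tsum_le_tsum (fun γ => ?_) (summable_norm_smul ha u) u.summable_coeff
    rw [norm_smul, norm_mul, Real.norm_of_nonneg (multiWeight_pos _).le]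
    exact mul_le_mul_of_nonneg_left (ha γ) (norm_nonneg _)

variable (a : (σ →₀ ℕ) → B) (ha : ∀ γ, ‖a γ‖ ≤ multiWeight γ)

theorem hasSum_lift (u : WeightedSeries σ) : HasSum (fun γ => coeff γ u • a γ) (lift a ha u) :=
  (summable_norm_smul ha u).of_norm.hasSum

theorem norm_lift_apply_le (u : WeightedSeries σ) : ‖lift a ha u‖ ≤ ‖u‖ := by
  refine (ContinuousLinearMap.le_of_opNorm_le _ (LinearMap.mkContinuous_norm_le _ zero_le_one _)
    u).trans_eq (one_mul _)

theorem lift_mono (γ : σ →₀ ℕ) : lift a ha (mono γ) = a γ := by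
  classical
  refine (hasSum_lift a ha _).unique ?_
  convert hasSum_single γ ?_ using 1
  · simp [coeff_mono]
  · intro δ hδ; simp [coeff_mono, hδ]

end lift

/-- The `lift` of the monomials is the identity, as one sees on each coordinate of `ℓ¹`.
Consequently statements about bounded operators need checking on monomials only. -/
theorem hasSum_mono (u : WeightedSeries σ) : HasSum (fun γ => coeff γ u • mono γ) u := by
  classical
  have h := hasSum_lift mono (fun γ => (norm_mono γ).le) u
  suffices e : lift mono (fun γ => (norm_mono γ).le) u = u by rwa [e] at h
  refine toLp_injective ?_
  let L : WeightedSeries σ →L[ℝ] lp (fun _ : σ →₀ ℕ => ℝ) 1 :=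
    LinearMap.mkContinuous toLp 1 fun u => by rw [one_mul, norm_toLp]
  have h2 := h.mapL L
  ext δ
  have h3 := h2.mapL (lp.evalCLM ℝ (fun _ : σ →₀ ℕ => ℝ) 1 δ)
  refine h3.unique ?_
  convert hasSum_single δ ?_ using 1
  · change toLp u δ = toLp (coeff δ u • mono δ) δ
    simp [toLp_apply, coeff_mono]
  · intro γ hγ
    change toLp (coeff γ u • mono γ) δ = 0
    simp [toLp_apply, coeff_mono, hγ.symm]

end WeightedSeries

/-! ### Evaluation, integration and differentiation of weighted series -/

section monomials

variable {σ : Type*} [Fintype σ]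

theorem prod_pow_add_single (z : σ → ℝ) (β : σ →₀ ℕ) (s : σ) :
    ∏ t, z t ^ (β + Finsupp.single s 1 : σ →₀ ℕ) t = z s * ∏ t, z t ^ β t := by
  classical
  rw [← Finset.mul_prod_erase _ _ (Finset.mem_univ s),
    ← Finset.mul_prod_erase _ (fun t => z t ^ β t) (Finset.mem_univ s)]
  have : ∀ t ∈ Finset.univ.erase s, z t ^ (β + Finsupp.single s 1 : σ →₀ ℕ) t = z t ^ β t :=
    fun t ht => by simp [(Finset.ne_of_mem_erase ht).symm]
  rw [Finset.prod_congr rfl this]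
  simp [pow_succ]; ring

theorem hasLineDerivAt_prod_pow [DecidableEq σ] (γ : σ →₀ ℕ) (z : σ → ℝ) (s : σ) :
    HasLineDerivAt ℝ (fun z : σ → ℝ => ∏ t, z t ^ γ t)
      (γ s * ∏ t, z t ^ (γ - Finsupp.single s 1 : σ →₀ ℕ) t) z (Pi.single s 1) := by
  unfold HasLineDerivAt
  have e : (fun r : ℝ => ∏ t, (z + r • Pi.single (M := fun _ => ℝ) s 1) t ^ γ t) =
      fun r => (z s + r) ^ γ s * ∏ t ∈ Finset.univ.erase s, z t ^ γ t := by
    funext r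
    rw [← Finset.mul_prod_erase _ _ (Finset.mem_univ s)]
    congr 1
    · simp
    · exact Finset.prod_congr rfl fun t ht => by simp [Finset.ne_of_mem_erase ht]
  rw [e]
  have h1 : HasDerivAt (fun r : ℝ => (z s + r) ^ γ s) (γ s * (z s + 0) ^ (γ s - 1) * 1) 0 :=
    ((hasDerivAt_id (0 : ℝ)).const_add (z s)).pow (γ s)
  refine (h1.mul_const _).congr_deriv ?_
  rw [← Finset.mul_prod_erase _ _ (Finset.mem_univ s)]
  have : ∀ t ∈ Finset.univ.erase s, z t ^ (γ - Finsupp.single s 1 : σ →₀ ℕ) t = z t ^ γ t :=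
    fun t ht => by simp [(Finset.ne_of_mem_erase ht).symm]
  rw [Finset.prod_congr rfl this]
  simp; ring

/-- List the variables with their multiplicities in `γ` and multiply the corresponding coordinates
of the `n` vectors. -/
theorem exists_multilinear_prod_pow (γ : σ →₀ ℕ) {n : ℕ} (h : ∑ s, γ s = n) :
    ∃ M : ContinuousMultilinearMap ℝ (fun _ : Fin n => σ → ℝ) ℝ,
      ‖M‖ ≤ 1 ∧ ∀ z : σ → ℝ, M (fun _ => z) = ∏ s, z s ^ γ s := by
  have hl : γ.toMultiset.toList.length = n := by
    rw [Multiset.length_toList, Finsupp.card_toMultiset, Finsupp.sum_fintype _ _ (by simp), ← h]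
    rfl
  subst hl
  refine ⟨(ContinuousMultilinearMap.mkPiAlgebra ℝ (Fin _) ℝ).compContinuousLinearMap
    fun k => ContinuousLinearMap.proj (γ.toMultiset.toList.get k), ?_, fun z => ?_⟩
  · refine ContinuousMultilinearMap.opNorm_le_bound zero_le_one fun m => ?_
    simp only [ContinuousMultilinearMap.compContinuousLinearMap_apply,
      ContinuousMultilinearMap.mkPiAlgebra_apply, ContinuousLinearMap.proj_apply, one_mul, norm_prod]
    exact Finset.prod_le_prod (fun _ _ => norm_nonneg _) fun k _ => norm_le_pi_norm _ _
  · simp only [ContinuousMultilinearMap.compContinuousLinearMap_apply,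
      ContinuousMultilinearMap.mkPiAlgebra_apply, ContinuousLinearMap.proj_apply]
    have h1 : ∏ k : Fin γ.toMultiset.toList.length, z (γ.toMultiset.toList.get k) =
        (γ.toMultiset.toList.map z).prod := by
      rw [← List.prod_ofFn]
      congr 1
      exact (List.map_ofFn (f := γ.toMultiset.toList.get) (g := z)).symm.trans (by rw [List.ofFn_get])
    rw [h1, ← Multiset.prod_coe, ← Multiset.map_coe, Multiset.coe_toList, Finsupp.toMultiset_map,
      Finsupp.prod_toMultiset, Finsupp.prod_mapDomain_index (by simp) (by simp [pow_add]),
      Finsupp.prod_fintype _ _ (by simp)]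

/-- A polyradius inside the domain of convergence of all `WeightedSeries`. -/
noncomputable def evalRadius (σ : Type*) [Fintype σ] : ℝ := 1 / (Fintype.card σ + 1)

theorem evalRadius_pos (σ : Type*) [Fintype σ] : 0 < evalRadius σ := by
  unfold evalRadius; positivity

/-- The radius `1 / (card σ + 1)` keeps `∑ |z_s|` at most 1, so evaluation at `z` is a contraction
on the algebra. -/
theorem norm_prod_pow_le {z : σ → ℝ} (hz : ‖z‖ ≤ evalRadius σ) (γ : σ →₀ ℕ) :
    ‖∏ s, z s ^ γ s‖ ≤ multiWeight γ := by
  rw [norm_prod]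
  simp only [norm_pow]
  refine prod_pow_le_multiWeight (fun s => norm_nonneg (z s)) ?_ γ
  refine (Finset.sum_le_sum fun s _ => (norm_le_pi_norm z s).trans hz).trans ?_
  rw [Finset.sum_const, Finset.card_univ, nsmul_eq_mul, evalRadius, mul_one_div,
    div_le_one (by positivity)]
  linarith

end monomials

namespace WeightedSeries

variable {σ : Type*} [Fintype σ]

/-- The value of a series at a point. -/
noncomputable def eval (u : WeightedSeries σ) (z : σ → ℝ) : ℝ :=
  ∑' γ, coeff γ u * ∏ s, z s ^ γ s

theorem eval_mono (γ : σ →₀ ℕ) (z : σ → ℝ) : eval (mono γ) z = ∏ s, z s ^ γ s := by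
  classical
  rw [eval, tsum_eq_single γ]
  · simp [coeff_mono]
  · intro δ hδ; simp [coeff_mono, hδ]

/-- Evaluation at a point as a continuous linear map. -/
noncomputable def evalCLM {z : σ → ℝ} (hz : ‖z‖ ≤ evalRadius σ) : WeightedSeries σ →L[ℝ] ℝ :=
  lift _ (norm_prod_pow_le hz)

theorem evalCLM_apply {z : σ → ℝ} (hz : ‖z‖ ≤ evalRadius σ) (u : WeightedSeries σ) :
    evalCLM hz u = eval u z :=
  rfl

theorem hasSum_eval {z : σ → ℝ} (hz : ‖z‖ ≤ evalRadius σ) (u : WeightedSeries σ) :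
    HasSum (fun γ => coeff γ u * ∏ s, z s ^ γ s) (eval u z) :=
  hasSum_lift _ (norm_prod_pow_le hz) u

theorem eval_mul {z : σ → ℝ} (hz : ‖z‖ ≤ evalRadius σ) (u v : WeightedSeries σ) :
    eval (u * v) z = eval u z * eval v z := by
  classical
  have hu : Summable fun γ => ‖coeff γ u * ∏ s, z s ^ γ s‖ :=
    summable_norm_smul (norm_prod_pow_le hz) u
  have hv : Summable fun γ => ‖coeff γ v * ∏ s, z s ^ γ s‖ :=
    summable_norm_smul (norm_prod_pow_le hz) v
  have h : (∑' γ, coeff γ u * ∏ s, z s ^ γ s) * (∑' γ, coeff γ v * ∏ s, z s ^ γ s) = _ :=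
    Summable.tsum_mul_tsum_eq_tsum_sum_antidiagonal hu.of_norm hv.of_norm
      (summable_mul_of_summable_norm hu hv)
  rw [eval, eval, eval, h]
  congr 1; funext γ
  rw [coeff_mul, Finset.sum_mul]
  refine Finset.sum_congr rfl fun p hp => ?_
  rw [← Finset.HasAntidiagonal.mem_antidiagonal.1 hp]
  simp only [Finsupp.add_apply, pow_add, Finset.prod_mul_distrib]
  ring

theorem eval_one (z : σ → ℝ) : eval (1 : WeightedSeries σ) z = 1 := by
  classical
  rw [eval, tsum_eq_single 0]
  · simp [coeff_one]
  · intro γ hγ; simp [coeff_one, hγ]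

/-- Evaluation at a point as an algebra homomorphism. -/
noncomputable def evalHom {z : σ → ℝ} (hz : ‖z‖ ≤ evalRadius σ) : WeightedSeries σ →ₐ[ℝ] ℝ :=
  AlgHom.ofLinearMap (evalCLM hz : WeightedSeries σ →ₗ[ℝ] ℝ) (eval_one z) (eval_mul hz)

theorem evalHom_apply {z : σ → ℝ} (hz : ‖z‖ ≤ evalRadius σ) (u : WeightedSeries σ) :
    evalHom hz u = eval u z :=
  rfl

theorem eval_zero_of_apply_eq_zero {T : WeightedSeries σ →L[ℝ] WeightedSeries σ} {z : σ → ℝ}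
    (hz : ‖z‖ ≤ evalRadius σ) (hT : ∀ γ, eval (T (mono γ)) z = 0) (u : WeightedSeries σ) :
    eval (T u) z = 0 := by
  have h := (u.hasSum_mono.mapL T).mapL (evalCLM hz)
  refine h.unique ?_
  convert hasSum_zero with γ
  simp [evalCLM_apply, hT]

/-- Termwise differentiation along the line: the differentiated series is dominated by `‖coeff γ u *
multiWeight γ‖`. Allowing an arbitrary pair `T`, `T'` covers derivatives of `integ s` both in `s`
and in the other variables. -/
theorem hasLineDerivAt_eval {T T' : WeightedSeries σ →L[ℝ] WeightedSeries σ} {v : σ → ℝ}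
    (h : ∀ γ z, HasLineDerivAt ℝ (eval (T (mono γ))) (eval (T' (mono γ)) z) z v)
    (hT' : ∀ γ, ‖T' (mono γ)‖ ≤ multiWeight γ) (u : WeightedSeries σ) {z : σ → ℝ}
    (hz : ‖z‖ < evalRadius σ) :
    HasLineDerivAt ℝ (eval (T u)) (eval (T' u) z) z v := by
  obtain ⟨r, hr, hzr⟩ : ∃ r > 0, ∀ t ∈ Metric.ball (0 : ℝ) r, ‖z + t • v‖ ≤ evalRadius σ := by
    have : ContinuousAt (fun t : ℝ => ‖z + t • v‖) 0 := by fun_prop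
    have h2 := this.eventually_lt (continuousAt_const (y := evalRadius σ)) (by simpa using hz)
    obtain ⟨r, hr, h3⟩ := Metric.eventually_nhds_iff_ball.1 h2
    exact ⟨r, hr, fun t ht => (h3 t ht).le⟩
  have key : ∀ (S : WeightedSeries σ →L[ℝ] WeightedSeries σ), ∀ t ∈ Metric.ball (0 : ℝ) r,
      HasSum (fun γ => coeff γ u * eval (S (mono γ)) (z + t • v)) (eval (S u) (z + t • v)) := by
    intro S t ht
    have := (u.hasSum_mono.mapL S).mapL (evalCLM (hzr t ht))
    simpa [evalCLM_apply] using this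
  have hb : ∀ γ, ∀ t ∈ Metric.ball (0 : ℝ) r,
      ‖coeff γ u * eval (T' (mono γ)) (z + t • v)‖ ≤ ‖coeff γ u * multiWeight γ‖ := by
    intro γ t ht
    rw [norm_mul, norm_mul, Real.norm_of_nonneg (multiWeight_pos _).le]
    refine mul_le_mul_of_nonneg_left (le_trans ?_ (hT' γ)) (norm_nonneg _)
    exact norm_lift_apply_le _ (norm_prod_pow_le (hzr t ht)) _
  have hd := hasDerivAt_tsum_of_isPreconnected (𝕜 := ℝ) u.summable_coeff Metric.isOpen_ball
    (convex_ball (0 : ℝ) r).isPreconnected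
    (g := fun γ t => coeff γ u * eval (T (mono γ)) (z + t • v))
    (g' := fun γ t => coeff γ u * eval (T' (mono γ)) (z + t • v)) (y₀ := 0) (y := 0)
    (fun γ t ht => by
      refine HasDerivAt.const_mul _ ?_
      have h1 := h γ (z + t • v)
      unfold HasLineDerivAt at h1
      have h3 : HasDerivAt (fun τ : ℝ => eval (T (mono γ)) (z + t • v + τ • v))
        (eval (T' (mono γ)) (z + t • v)) (t - t) := by simpa using h1
      have h4 := h3.comp_sub_const t t
      have e : ∀ τ : ℝ, z + t • v + (τ - t) • v = z + τ • v := fun τ => by module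
      simpa only [e] using h4)
    hb (by simpa using hr) (key T 0 (by simpa using hr)).summable (by simpa using hr)
  unfold HasLineDerivAt
  rw [(key T' 0 (by simpa using hr)).tsum_eq] at hd
  simp only [zero_smul, add_zero] at hd
  refine hd.congr_of_eventuallyEq ?_
  filter_upwards [Metric.ball_mem_nhds (0 : ℝ) hr] with t ht
  exact (key T t ht).tsum_eq.symm

/-- Integration of a series with respect to the variable `s`, from `z_s = 0`. -/
noncomputable def integ (s : σ) : WeightedSeries σ →L[ℝ] WeightedSeries σ :=
  lift (fun γ => ((γ s : ℝ) + 1)⁻¹ • mono (γ + Finsupp.single s 1)) fun γ => by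
    rw [norm_smul, norm_mono, Real.norm_of_nonneg (by positivity), ← div_eq_inv_mul]
    exact multiWeight_add_single_div_le γ s

theorem integ_mono (s : σ) (γ : σ →₀ ℕ) :
    integ s (mono γ) = ((γ s : ℝ) + 1)⁻¹ • mono (γ + Finsupp.single s 1) :=
  lift_mono _ _ _

/-- The key estimate. With `γ = β + e_i` it is an equality, namely `multiWeight_shift`; if `γ i = 0`
the coefficient vanishes and the truncated subtraction is harmless. -/
theorem norm_dinteg_coeff_le {i s : σ} (h : i ≠ s) (γ : σ →₀ ℕ) :
    ‖((γ i : ℝ) * ((γ s : ℝ) + 1)⁻¹) • mono (γ - Finsupp.single i 1 + Finsupp.single s 1)‖ ≤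
      multiWeight γ := by
  classical
  rw [norm_smul, norm_mono, Real.norm_of_nonneg (by positivity)]
  by_cases h0 : γ i = 0
  · simpa [h0] using (multiWeight_pos γ).le
  · obtain ⟨β, rfl⟩ : ∃ β, γ = β + Finsupp.single i 1 := by
      refine ⟨γ - Finsupp.single i 1, ?_⟩
      rw [tsub_add_cancel_of_le]
      simpa using Nat.one_le_iff_ne_zero.2 h0
    rw [← multiWeight_shift β s i]
    simp [h]
    apply le_of_eq
    ring

/-- Integration with respect to `s` followed by differentiation with respect to `i`. -/
noncomputable def dinteg {i s : σ} (h : i ≠ s) : WeightedSeries σ →L[ℝ] WeightedSeries σ :=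
  lift _ (norm_dinteg_coeff_le h)

theorem dinteg_mono {i s : σ} (h : i ≠ s) (γ : σ →₀ ℕ) :
    dinteg h (mono γ) =
      ((γ i : ℝ) * ((γ s : ℝ) + 1)⁻¹) • mono (γ - Finsupp.single i 1 + Finsupp.single s 1) :=
  lift_mono _ _ _

theorem eval_smul_mono (r : ℝ) (γ : σ →₀ ℕ) (z : σ → ℝ) :
    eval (r • mono γ) z = r * ∏ s, z s ^ γ s := by
  rw [← eval_mono, eval, eval, ← tsum_mul_left]
  simp [mul_assoc]

theorem hasLineDerivAt_integ [DecidableEq σ] (s : σ) (u : WeightedSeries σ) {z : σ → ℝ}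
    (hz : ‖z‖ < evalRadius σ) :
    HasLineDerivAt ℝ (eval (integ s u)) (eval u z) z (Pi.single s 1) := by
  refine hasLineDerivAt_eval (T' := ContinuousLinearMap.id ℝ _) (fun γ z => ?_)
    (fun γ => (norm_mono γ).le) u hz
  have h := hasLineDerivAt_prod_pow (γ + Finsupp.single s 1) z s
  have h2 := HasDerivAt.const_mul ((γ s : ℝ) + 1)⁻¹ h
  have e : eval (integ s (mono γ)) = fun z => ((γ s : ℝ) + 1)⁻¹ *
      ∏ t, z t ^ (γ + Finsupp.single s 1 : σ →₀ ℕ) t := by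
    funext z; rw [integ_mono, eval_smul_mono]
  rw [e]
  unfold HasLineDerivAt
  refine h2.congr_deriv ?_
  rw [ContinuousLinearMap.id_apply, eval_mono]
  simp
  field_simp

theorem hasLineDerivAt_dinteg [DecidableEq σ] {i s : σ} (his : i ≠ s) (u : WeightedSeries σ)
    {z : σ → ℝ} (hz : ‖z‖ < evalRadius σ) :
    HasLineDerivAt ℝ (eval (integ s u)) (eval (dinteg his u) z) z (Pi.single i 1) := by
  refine hasLineDerivAt_eval (fun γ z => ?_)
    (fun γ => by rw [dinteg_mono]; exact norm_dinteg_coeff_le his γ) u hz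
  have h := hasLineDerivAt_prod_pow (γ + Finsupp.single s 1) z i
  have h2 := HasDerivAt.const_mul ((γ s : ℝ) + 1)⁻¹ h
  have e : eval (integ s (mono γ)) = fun z => ((γ s : ℝ) + 1)⁻¹ *
      ∏ t, z t ^ (γ + Finsupp.single s 1 : σ →₀ ℕ) t := by
    funext z; rw [integ_mono, eval_smul_mono]
  rw [e]
  unfold HasLineDerivAt
  refine h2.congr_deriv ?_
  rw [dinteg_mono, eval_smul_mono]
  by_cases h0 : γ i = 0
  · simp [h0, his.symm]
  · have : γ - Finsupp.single i 1 + Finsupp.single s 1 =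
        γ + Finsupp.single s 1 - Finsupp.single i 1 := by
      refine tsub_add_eq_add_tsub ?_
      simpa using Nat.one_le_iff_ne_zero.2 h0
    rw [this]
    simp [his.symm]
    ring

theorem eval_integ_eq_zero (s : σ) (u : WeightedSeries σ) {z : σ → ℝ}
    (hz : ‖z‖ ≤ evalRadius σ) (hs : z s = 0) : eval (integ s u) z = 0 :=
  eval_zero_of_apply_eq_zero hz (fun γ => by
    rw [integ_mono, eval_smul_mono, prod_pow_add_single, hs]; simp) u

/-- Group the monomials by total degree; each group is the diagonal of a continuous multilinear map.
-/
theorem exists_hasFPowerSeriesOnBall [DecidableEq σ] (u : WeightedSeries σ) :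
    ∃ q : FormalMultilinearSeries ℝ (σ → ℝ) ℝ,
      HasFPowerSeriesOnBall (eval u) q 0 (ENNReal.ofReal (evalRadius σ)) ∧
      ∀ n z, q n (fun _ => z) =
        ∑ γ ∈ Finset.univ.finsuppAntidiag n, coeff γ u * ∏ s, z s ^ γ s := by
  choose M hM1 hM using fun γ : σ →₀ ℕ => exists_multilinear_prod_pow γ rfl
  -- The transport along `h` only adjusts the arity; the value 0 in other degrees never enters,
  -- since the sums run over multi-indices of degree `n`.
  let N : ∀ n, (σ →₀ ℕ) → ContinuousMultilinearMap ℝ (fun _ : Fin n => σ → ℝ) ℝ :=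
    fun n γ => if h : ∑ s, γ s = n then h ▸ M γ else 0
  have hN1 : ∀ n γ, ‖N n γ‖ ≤ 1 := by
    intro n γ
    by_cases h : ∑ s, γ s = n
    · subst h; simpa [N] using hM1 γ
    · simp [N, h]
  have hN : ∀ n γ, ∑ s, γ s = n → ∀ z : σ → ℝ, N n γ (fun _ => z) = ∏ s, z s ^ γ s := by
    intro n γ h
    subst h; simpa [N] using hM γ
  let q : FormalMultilinearSeries ℝ (σ → ℝ) ℝ := fun n =>
    ∑ γ ∈ Finset.univ.finsuppAntidiag n, coeff γ u • N n γ
  have hq : ∀ n z, q n (fun _ => z) =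
      ∑ γ ∈ Finset.univ.finsuppAntidiag n, coeff γ u * ∏ s, z s ^ γ s := by
    intro n z
    simp only [q, sum_apply, smul_apply, smul_eq_mul]
    refine Finset.sum_congr rfl fun γ hγ => ?_
    rw [hN n γ (Finset.mem_finsuppAntidiag.1 hγ).1]
  refine ⟨q, ⟨?_, by simpa using evalRadius_pos σ, fun {z} hz => ?_⟩, hq⟩
  · refine q.le_radius_of_bound (r := (evalRadius σ).toNNReal) ‖u‖ fun n => ?_
    rw [Real.coe_toNNReal _ (evalRadius_pos σ).le, norm_def]
    refine le_trans ?_ (u.summable_coeff.sum_le_tsum (Finset.univ.finsuppAntidiag n)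
      fun _ _ => norm_nonneg _)
    refine (mul_le_mul_of_nonneg_right (norm_sum_le _ _) (by have := evalRadius_pos σ; positivity)).trans ?_
    rw [Finset.sum_mul]
    refine Finset.sum_le_sum fun γ hγ => ?_
    rw [norm_smul, norm_mul, mul_assoc, Real.norm_of_nonneg (multiWeight_pos _).le]
    refine mul_le_mul_of_nonneg_left ?_ (norm_nonneg _)
    refine (mul_le_of_le_one_left (by have := evalRadius_pos σ; positivity) (hN1 n γ)).trans ?_
    -- At the constant vector `r = evalRadius σ` the monomial bound says `r^|γ| ≤ multiWeight γ`, so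
    -- the terms of degree `n` are controlled by the norm of `u`.
    have := norm_prod_pow_le (z := fun _ : σ => evalRadius σ)
      ((pi_norm_le_iff_of_nonneg (evalRadius_pos σ).le).2 fun _ =>
        (Real.norm_of_nonneg (evalRadius_pos σ).le).le) γ
    rwa [Finset.prod_pow_eq_pow_sum, (Finset.mem_finsuppAntidiag.1 hγ).1,
      Real.norm_of_nonneg (by have := evalRadius_pos σ; positivity)] at this
  · rw [zero_add]
    have hz' : ‖z‖ ≤ evalRadius σ := by
      rw [Metric.eball_ofReal, mem_ball_zero_iff] at hz
      exact hz.le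
    have h := (hasSum_eval hz' u).tsum_fiberwise fun γ => ∑ s, γ s
    convert h using 2 with n
    rw [hq, ← Finset.tsum_subtype]
    have : ((Finset.univ.finsuppAntidiag n : Finset (σ →₀ ℕ)) : Set (σ →₀ ℕ)) =
      (fun γ : σ →₀ ℕ => ∑ s, γ s) ⁻¹' {n} := by ext γ; simp
    exact tsum_congr_set_coe (fun γ => coeff γ u * ∏ s, z s ^ γ s) this

theorem analyticAt_eval (u : WeightedSeries σ) {z : σ → ℝ} (hz : ‖z‖ < evalRadius σ) :
    AnalyticAt ℝ (eval u) z := by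
  classical
  obtain ⟨q, hq, -⟩ := exists_hasFPowerSeriesOnBall u
  refine hq.analyticAt_of_mem ?_
  rw [Metric.eball_ofReal]
  simpa using hz

/-- Each homogeneous part of the expansion vanishes as a function, hence as a polynomial over the
infinite field `ℝ`, and so do its coefficients. -/
theorem eq_zero_of_eval_eventuallyEq_zero {u : WeightedSeries σ} (h : eval u =ᶠ[nhds 0] 0) :
    u = 0 := by
  classical
  obtain ⟨q, hq, hq'⟩ := exists_hasFPowerSeriesOnBall u
  have h0 : HasFPowerSeriesAt (0 : (σ → ℝ) → ℝ) q 0 := hq.hasFPowerSeriesAt.congr h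
  refine coeff_ext fun γ => ?_
  rw [map_zero]
  let p : MvPolynomial σ ℝ := ∑ γ' ∈ Finset.univ.finsuppAntidiag (∑ s, γ s),
    MvPolynomial.monomial γ' (coeff γ' u)
  have hp : p = 0 := by
    refine MvPolynomial.funext fun z => ?_
    have := h0.apply_eq_zero (∑ s, γ s) z
    rw [hq'] at this
    rw [map_zero, ← this]
    simp [p, MvPolynomial.eval_monomial, Finsupp.prod_fintype]
  have hc : MvPolynomial.coeff γ p = 0 := by rw [hp]; simp
  simpa [p, MvPolynomial.coeff_sum, MvPolynomial.coeff_monomial] using hc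

end WeightedSeries

/-! ### Analytic functional calculus in a commutative Banach algebra -/

section functionalCalculus

open scoped Topology NNReal ENNReal
open Filter

variable {κ A : Type*} [Fintype κ] [DecidableEq κ] [NormedCommRing A] [NormedAlgebra ℝ A]

/-- The extension of a power series in real variables to variables in a commutative algebra. -/
noncomputable def FormalMultilinearSeries.extendScalars (A : Type*) [NormedCommRing A]
    [NormedAlgebra ℝ A] (p : FormalMultilinearSeries ℝ (κ → ℝ) ℝ) :
    FormalMultilinearSeries ℝ (κ → A) A := fun n =>
  ∑ i : Fin n → κ, p n (fun k => Pi.single (i k) 1) •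
    (ContinuousMultilinearMap.mkPiAlgebra ℝ (Fin n) A).compContinuousLinearMap
      fun k => ContinuousLinearMap.proj (i k)

theorem FormalMultilinearSeries.extendScalars_apply (p : FormalMultilinearSeries ℝ (κ → ℝ) ℝ)
    (n : ℕ) (U : Fin n → κ → A) :
    p.extendScalars A n U = ∑ i : Fin n → κ, p n (fun k => Pi.single (i k) 1) • ∏ k, U k (i k) := by
  simp [extendScalars, sum_apply]

/-- There are `card κ ^ n` tuples of basis vectors, each contributing at most `‖p n‖`. This
geometric loss merely shrinks the radius of convergence. -/
theorem FormalMultilinearSeries.norm_extendScalars_le [NormOneClass A]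
    (p : FormalMultilinearSeries ℝ (κ → ℝ) ℝ) (n : ℕ) :
    ‖p.extendScalars A n‖ ≤ ‖p n‖ * Fintype.card κ ^ n := by
  refine ContinuousMultilinearMap.opNorm_le_bound (by positivity) fun U => ?_
  rw [extendScalars_apply]
  refine (norm_sum_le _ _).trans ?_
  have : ∀ i ∈ (Finset.univ : Finset (Fin n → κ)),
      ‖p n (fun k => Pi.single (i k) 1) • ∏ k, U k (i k)‖ ≤ ‖p n‖ * ∏ k, ‖U k‖ := by
    intro i _
    rw [norm_smul]
    refine mul_le_mul ?_ ?_ (norm_nonneg _) (norm_nonneg _)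
    · refine ((p n).le_opNorm _).trans (mul_le_of_le_one_right (norm_nonneg _) ?_)
      exact Finset.prod_le_one (fun _ _ => norm_nonneg _) fun k _ => by rw [Pi.norm_single, norm_one]
    · refine (Finset.norm_prod_le _ _).trans ?_
      exact Finset.prod_le_prod (fun _ _ => norm_nonneg _) fun k _ => norm_le_pi_norm _ _
  refine (Finset.sum_le_sum this).trans_eq ?_
  simp
  ring

theorem FormalMultilinearSeries.radius_extendScalars_pos [NormOneClass A]
    {p : FormalMultilinearSeries ℝ (κ → ℝ) ℝ} (hp : 0 < p.radius) :
    0 < (p.extendScalars A).radius := by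
  obtain ⟨r, hr0, hr⟩ := ENNReal.lt_iff_exists_nnreal_btwn.1 hp
  obtain ⟨C, hC, h⟩ := p.norm_mul_pow_le_of_lt_radius hr
  have hr0' : 0 < r := by exact_mod_cast hr0
  refine lt_of_lt_of_le (b := ((r / (Fintype.card κ + 1) : ℝ≥0) : ℝ≥0∞)) ?_ ?_
  · exact_mod_cast (by positivity : 0 < r / (Fintype.card κ + 1))
  refine FormalMultilinearSeries.le_radius_of_bound _ C fun n => ?_
  refine le_trans ?_ (h n)
  refine (mul_le_mul_of_nonneg_right (norm_extendScalars_le p n) (by positivity)).trans ?_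
  rw [mul_assoc, ← mul_pow]
  refine mul_le_mul_of_nonneg_left (pow_le_pow_left₀ (by positivity) ?_ n) (norm_nonneg _)
  push_cast
  rw [mul_div_assoc', div_le_iff₀ (by positivity)]
  nlinarith [r.2]

/-- Expand the vector `χ ∘ U` in the standard basis by multilinearity; `χ` commutes with the
resulting sums and products. -/
theorem map_extendScalars_apply (χ : A →ₐ[ℝ] ℝ) (p : FormalMultilinearSeries ℝ (κ → ℝ) ℝ) (n : ℕ)
    (U : κ → A) :
    χ (p.extendScalars A n fun _ => U) = p n fun _ => fun k => χ (U k) := by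
  have h : ∀ y : κ → ℝ, y = ∑ k, y k • Pi.single (M := fun _ => ℝ) k 1 := fun y => by
    funext k; simp [Finset.sum_apply, Pi.single_apply]
  rw [FormalMultilinearSeries.extendScalars_apply]
  conv_rhs => rw [h fun k => χ (U k)]
  have h2 := (p n).toMultilinearMap.map_sum
    (g := fun (_ : Fin n) (k : κ) => χ (U k) • Pi.single (M := fun _ => ℝ) k (1 : ℝ))
  simp only [ContinuousMultilinearMap.coe_coe] at h2
  rw [h2, map_sum]
  refine Finset.sum_congr rfl fun i _ => ?_
  rw [(p n).map_smul_univ, map_smul, map_prod, smul_eq_mul, smul_eq_mul, mul_comm]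

/-- The analytic functional calculus in several variables, near the origin. -/
theorem exists_functionalCalculus (A : Type*) [NormedCommRing A] [NormedAlgebra ℝ A]
    [NormOneClass A] [CompleteSpace A] {f : (κ → ℝ) → ℝ} (hf : AnalyticAt ℝ f 0) :
    ∃ Φ : (κ → A) → A, AnalyticAt ℝ Φ 0 ∧ Φ 0 = algebraMap ℝ A (f 0) ∧
      ∀ᶠ U in 𝓝 0, ∀ χ : A →ₐ[ℝ] ℝ, (∀ u, ‖χ u‖ ≤ ‖u‖) → χ (Φ U) = f fun k => χ (U k) := by
  obtain ⟨p, r, hp⟩ := hf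
  have hP := (p.extendScalars A).hasFPowerSeriesOnBall
    (FormalMultilinearSeries.radius_extendScalars_pos (hp.r_pos.trans_le hp.r_le))
  refine ⟨_, hP.analyticAt, ?_, ?_⟩
  · rw [← hP.coeff_zero (fun _ => 0), FormalMultilinearSeries.extendScalars_apply,
      ← hp.coeff_zero (fun _ => 0)]
    simp [Algebra.algebraMap_eq_smul_one]
    congr 2
    exact Subsingleton.elim _ _
  · have hev : ∀ᶠ U : κ → A in 𝓝 0, U ∈ Metric.eball (0 : κ → A) r :=
      Metric.eball_mem_nhds _ hp.r_pos
    filter_upwards [hev, Metric.eball_mem_nhds _ hP.r_pos] with U h1 h2 χ hχ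
    have s1 := hP.hasSum h2
    rw [zero_add] at s1
    -- Contractivity makes `χ` continuous and keeps `χ ∘ U` in the ball of convergence whenever `U`
    -- is, so the neighbourhood of `U` can be chosen independently of `χ`.
    let χ' : A →L[ℝ] ℝ := χ.toLinearMap.mkContinuous 1 fun u => by simpa using hχ u
    have s2 := s1.mapL χ'
    have h3 : (fun k => χ (U k)) ∈ Metric.eball (0 : κ → ℝ) r := by
      rw [Metric.mem_eball, edist_zero_right] at h1 ⊢
      refine lt_of_le_of_lt ?_ h1
      rw [enorm_le_iff_norm_le]
      exact (pi_norm_le_iff_of_nonneg (norm_nonneg _)).2 fun k =>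
        (hχ _).trans (norm_le_pi_norm U k)
    have s3 := hp.hasSum h3
    rw [zero_add] at s3
    have e : ∀ n, χ' (p.extendScalars A n fun _ => U) = p n fun _ => fun k => χ (U k) :=
      fun n => map_extendScalars_apply χ p n U
    simp only [e] at s2
    exact s2.unique s3

end functionalCalculus

namespace WeightedSeries

variable {σ : Type*} [Fintype σ]

theorem norm_evalHom_le {z : σ → ℝ} (hz : ‖z‖ ≤ evalRadius σ) (u : WeightedSeries σ) :
    ‖evalHom hz u‖ ≤ ‖u‖ :=
  norm_lift_apply_le _ (norm_prod_pow_le hz) u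

/-- The coordinate `z_s` as a series. -/
noncomputable def var (s : σ) : WeightedSeries σ := mono (Finsupp.single s 1)

theorem eval_var (s : σ) (z : σ → ℝ) : eval (var s) z = z s := by
  have := prod_pow_add_single z 0 s
  rw [var, eval_mono]
  simpa using this

theorem eval_smul (r : ℝ) (u : WeightedSeries σ) (z : σ → ℝ) : eval (r • u) z = r * eval u z := by
  rw [eval, eval, ← tsum_mul_left]
  simp [mul_assoc]

theorem eval_sub {z : σ → ℝ} (hz : ‖z‖ ≤ evalRadius σ) (u v : WeightedSeries σ) :
    eval (u - v) z = eval u z - eval v z := by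
  simp only [← evalHom_apply hz, map_sub]

end WeightedSeries

/-! ### Identities known on nonnegative times or along lines -/

section orthant

open scoped Topology
open Filter

variable {T X : Type*} [Fintype T] [Fintype X]

/-- The positive-time part of a ball is a nonempty open set, and the ball is connected, so the
identity theorem applies. -/
theorem eventually_eq_zero_of_positive {g : (T ⊕ X → ℝ) → ℝ} (hg : AnalyticAt ℝ g 0)
    (h : ∀ᶠ z in 𝓝 (0 : T ⊕ X → ℝ), (∀ t, 0 < z (Sum.inl t)) → g z = 0) : g =ᶠ[𝓝 0] 0 := by
  obtain ⟨ρ, hρ, hb⟩ := Metric.eventually_nhds_iff_ball.1 (hg.eventually_analyticAt.and h)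
  have hg' : AnalyticOnNhd ℝ g (Metric.ball 0 ρ) := fun z hz => (hb z hz).1
  -- Any point of the ball with positive times would do.
  let z₀ : T ⊕ X → ℝ := fun _ => ρ / 2
  have hz₀ : z₀ ∈ Metric.ball (0 : T ⊕ X → ℝ) ρ := by
    rw [mem_ball_zero_iff]
    refine lt_of_le_of_lt ((pi_norm_le_iff_of_nonneg (by positivity : 0 ≤ ρ / 2)).2 fun s => ?_)
      (half_lt_self hρ)
    rw [Real.norm_of_nonneg (by positivity)]
  have h0 : g =ᶠ[𝓝 z₀] 0 := by
    have h1 : ∀ᶠ z in 𝓝 z₀, ∀ t, 0 < z (Sum.inl t) := by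
      rw [eventually_all]
      intro t
      exact (continuous_apply (Sum.inl t)).continuousAt.eventually_const_lt (by simp [z₀, hρ])
    filter_upwards [h1, Metric.isOpen_ball.mem_nhds hz₀] with z h1 h2 using (hb z h2).2 h1
  filter_upwards [Metric.ball_mem_nhds _ hρ] with z hz
  exact hg'.eqOn_zero_of_preconnected_of_eventuallyEq_zero (convex_ball _ _).isPreconnected hz₀ h0 hz

end orthant

section lineDeriv

open scoped Topology
open Filter

variable {σ : Type*} [DecidableEq σ]

theorem eq_of_hasLineDerivAt_zero {g : (σ → ℝ) → ℝ} {z : σ → ℝ} {s : σ} (hs : 0 ≤ z s)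
    (h : ∀ r ∈ Icc 0 (z s), HasLineDerivAt ℝ g 0 (Function.update z s r) (Pi.single s 1)) :
    g z = g (Function.update z s 0) := by
  have hd : ∀ r ∈ Icc 0 (z s), HasDerivAt (fun r => g (Function.update z s r)) 0 r := by
    intro r hr
    have h1 := h r hr
    unfold HasLineDerivAt at h1
    have h3 : HasDerivAt (fun τ : ℝ => g (Function.update z s r + τ • Pi.single s (1 : ℝ))) 0
      (r - r) := by simpa using h1
    have h4 := h3.comp_sub_const r r
    have e : ∀ τ : ℝ, Function.update z s r + (τ - r) • Pi.single (M := fun _ => ℝ) s (1 : ℝ) =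
        Function.update z s τ := by
      intro τ
      funext i
      by_cases hi : i = s
      · subst hi; simp
      · simp [hi]
    simpa only [e] using h4
  have := constant_of_has_deriv_right_zero (f := fun r => g (Function.update z s r)) (a := 0)
    (b := z s) (fun r hr => (hd r hr).continuousAt.continuousWithinAt)
    (fun r hr => (hd r ⟨hr.1, hr.2.le⟩).hasDerivWithinAt) (z s) ⟨hs, le_rfl⟩
  simpa using this

theorem HasLineDerivAt.comp_mul {g : (σ → ℝ) → ℝ} {c z : σ → ℝ} {s : σ} {g' : ℝ}
    (h : HasLineDerivAt ℝ g g' (fun i => c i * z i) (Pi.single s 1)) :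
    HasLineDerivAt ℝ (fun z => g fun i => c i * z i) (c s * g') z (Pi.single s 1) := by
  unfold HasLineDerivAt at h ⊢
  have h2 : HasDerivAt (fun r : ℝ => c s * r) (c s) 0 := by
    simpa using (hasDerivAt_id (0 : ℝ)).const_mul (c s)
  have h3 : HasDerivAt (fun r : ℝ => g ((fun i => c i * z i) + r • Pi.single s (1 : ℝ))) g'
    (c s * 0) := by simpa using h
  have h4 := h3.comp (0 : ℝ) h2
  rw [mul_comm]
  refine h4.congr_of_eventuallyEq (Eventually.of_forall fun r => ?_)
  change g _ = g _
  congr 1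
  funext i
  by_cases hi : i = s
  · subst hi; simp [mul_add]
  · simp [hi]

end lineDeriv

/-! ### The rescaled problem and the implicit function theorem -/

namespace WeightedSeries

open scoped Topology
open Filter

variable {T X J : Type*} [Fintype T] [Fintype X]

/-- The indices of the arguments `(z, u, ∂_X u)` of the right-hand sides. -/
abbrev ArgIndex (T X J : Type*) : Type _ := (T ⊕ X) ⊕ (J ⊕ J × X)

/-- The factors by which the variables are rescaled: `ε₁ ε₂` for times, `ε₁` for space. -/
def scaling (ε : ℝ × ℝ) : T ⊕ X → ℝ := Sum.elim (fun _ => ε.1 * ε.2) fun _ => ε.1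

/-- The rescaled arguments as series, if `f` are the rescaled time derivatives of the unknowns. -/
noncomputable def seriesArg (τ : J → T) (v : (ℝ × ℝ) × (J → WeightedSeries (T ⊕ X))) :
    ArgIndex T X J → WeightedSeries (T ⊕ X) :=
  Sum.elim (fun s => scaling v.1 s • var s) <|
    Sum.elim (fun j => (v.1.1 * v.1.2) • integ (Sum.inl (τ j)) (v.2 j)) fun q =>
      v.1.2 • dinteg (Sum.inr_ne_inl (a := τ q.1) (b := q.2)) (v.2 q.1)

theorem analyticAt_seriesArg [Fintype J] (τ : J → T) (v : (ℝ × ℝ) × (J → WeightedSeries (T ⊕ X))) :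
    AnalyticAt ℝ (seriesArg τ) v := by
  have h1 : AnalyticAt ℝ (fun v : (ℝ × ℝ) × (J → WeightedSeries (T ⊕ X)) => v.1.1) v :=
    ((ContinuousLinearMap.fst ℝ ℝ ℝ).comp (ContinuousLinearMap.fst ℝ (ℝ × ℝ) _)).analyticAt v
  have h2 : AnalyticAt ℝ (fun v : (ℝ × ℝ) × (J → WeightedSeries (T ⊕ X)) => v.1.2) v :=
    ((ContinuousLinearMap.snd ℝ ℝ ℝ).comp (ContinuousLinearMap.fst ℝ (ℝ × ℝ) _)).analyticAt v
  have h3 : ∀ (j : J) (L : WeightedSeries (T ⊕ X) →L[ℝ] WeightedSeries (T ⊕ X)),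
      AnalyticAt ℝ (fun v : (ℝ × ℝ) × (J → WeightedSeries (T ⊕ X)) => L (v.2 j)) v := fun j L =>
    ((L.comp (ContinuousLinearMap.proj (φ := fun _ : J => WeightedSeries (T ⊕ X)) j)).comp
      (ContinuousLinearMap.snd ℝ (ℝ × ℝ) (J → WeightedSeries (T ⊕ X)))).analyticAt v
  rw [analyticAt_pi_iff]
  rintro ((t | x) | (j | q))
  · exact (h1.mul h2).smul analyticAt_const
  · exact h1.smul analyticAt_const
  · exact (h1.mul h2).smul (h3 j _)
  · exact h2.smul (h3 q.1 _)

/-- Every argument carries a factor `ε₁` or `ε₂`. The second parameter is what makes the spatial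
derivatives small: they scale like the unknowns (`ε₁ε₂`) divided by space (`ε₁`). -/
theorem seriesArg_zero (τ : J → T) (f : J → WeightedSeries (T ⊕ X)) : seriesArg τ (0, f) = 0 := by
  funext k
  rcases k with (t | x) | (j | q) <;> simp [seriesArg, scaling]

/-- The rescaled arguments as functions. -/
noncomputable def evalArg (τ : J → T) (v : (ℝ × ℝ) × (J → WeightedSeries (T ⊕ X)))
    (z : T ⊕ X → ℝ) : ArgIndex T X J → ℝ :=
  Sum.elim (fun s => scaling v.1 s * z s) <|
    Sum.elim (fun j => (v.1.1 * v.1.2) * eval (integ (Sum.inl (τ j)) (v.2 j)) z) fun q =>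
      v.1.2 * eval (dinteg (Sum.inr_ne_inl (a := τ q.1) (b := q.2)) (v.2 q.1)) z

theorem eval_seriesArg (τ : J → T) (v : (ℝ × ℝ) × (J → WeightedSeries (T ⊕ X)))
    (z : T ⊕ X → ℝ) (k : ArgIndex T X J) : eval (seriesArg τ v k) z = evalArg τ v z k := by
  rcases k with s | (j | q) <;> simp [seriesArg, evalArg, eval_smul, eval_var]

variable [Fintype J] [DecidableEq T] [DecidableEq X] [DecidableEq J]

/-- The rescaled problem in the algebra of series has, for each small scaling, exactly one
solution near the constants. -/
theorem exists_seriesSolution (τ : J → T) {H : J → (ArgIndex T X J → ℝ) → ℝ}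
    (hH : ∀ j, AnalyticAt ℝ (H j) 0) :
    ∃ ψ : ℝ × ℝ → J → WeightedSeries (T ⊕ X),
      (∀ᶠ ε in 𝓝 0, ∀ z, ‖z‖ ≤ evalRadius (T ⊕ X) → ∀ j,
        eval (ψ ε j) z = H j (evalArg τ (ε, ψ ε) z)) ∧
      ∀ᶠ v in 𝓝 ((0, fun j => algebraMap ℝ _ (H j 0)) :
          (ℝ × ℝ) × (J → WeightedSeries (T ⊕ X))),
        (∀ j, ∀ᶠ z in 𝓝 0, (∀ t, 0 < z (Sum.inl t)) →
          eval (v.2 j) z = H j (evalArg τ v z)) → v.2 = ψ v.1 := by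
  choose Φ hΦ hΦ0 hΦe using fun j => exists_functionalCalculus (WeightedSeries (T ⊕ X)) (hH j)
  let f₀ : J → WeightedSeries (T ⊕ X) := fun j => algebraMap ℝ _ (H j 0)
  -- The zeros of `G` near `(0, f₀)` are the solutions of the rescaled problem.
  let G : (ℝ × ℝ) × (J → WeightedSeries (T ⊕ X)) → J → WeightedSeries (T ⊕ X) :=
    fun v j => v.2 j - Φ j (seriesArg τ v)
  have hG : AnalyticAt ℝ G (0, f₀) := by
    rw [analyticAt_pi_iff]
    intro j
    refine AnalyticAt.sub ((ContinuousLinearMap.proj (R := ℝ)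
      (φ := fun _ : J => WeightedSeries (T ⊕ X)) j).comp
      (ContinuousLinearMap.snd ℝ (ℝ × ℝ) (J → WeightedSeries (T ⊕ X))) |>.analyticAt _) ?_
    refine AnalyticAt.fun_comp (g := Φ j) ?_ (analyticAt_seriesArg τ _)
    rw [seriesArg_zero]
    exact hΦ j
  have hG0 : G (0, f₀) = 0 := by
    funext j
    simp [G, seriesArg_zero, hΦ0, f₀]
  have hGs := hG.hasStrictFDerivAt
  -- At `ε = 0` the arguments vanish and `G (0, f) = f - f₀`, so the partial derivative in `f` is
  -- the identity.
  have hinv : (fderiv ℝ G (0, f₀) ∘L ContinuousLinearMap.inr ℝ (ℝ × ℝ)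
      (J → WeightedSeries (T ⊕ X))).IsInvertible := by
    have h1 : HasFDerivAt (fun f => G (0, f)) (fderiv ℝ G (0, f₀) ∘L
        ContinuousLinearMap.inr ℝ (ℝ × ℝ) (J → WeightedSeries (T ⊕ X))) f₀ :=
      hG.differentiableAt.hasFDerivAt.comp f₀ (hasFDerivAt_prodMk_right 0 f₀)
    have h2 : (fun f => G (0, f)) = fun f => f - f₀ := by
      funext f j
      simp [G, seriesArg_zero, hΦ0, f₀]
    rw [h2] at h1
    rw [h1.unique ((hasFDerivAt_id f₀).sub_const f₀)]
    exact ⟨ContinuousLinearEquiv.refl ℝ _, rfl⟩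
  -- Evaluations are contractive algebra homomorphisms, so the functional calculus turns the
  -- equation between series into one between functions.
  have hcal : ∀ᶠ v in 𝓝 ((0 : ℝ × ℝ), f₀), ∀ z, ‖z‖ ≤ evalRadius (T ⊕ X) → ∀ j,
      eval (G v j) z = eval (v.2 j) z - H j (evalArg τ v z) := by
    have hc : Tendsto (seriesArg τ) (𝓝 ((0 : ℝ × ℝ), f₀)) (𝓝 0) := by
      have := (analyticAt_seriesArg τ ((0 : ℝ × ℝ), f₀)).continuousAt.tendsto
      rwa [seriesArg_zero] at this
    have := hc.eventually (eventually_all.2 hΦe)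
    filter_upwards [this] with v hv z hz j
    have h1 := hv j (evalHom hz) (norm_evalHom_le hz)
    simp only [evalHom_apply, eval_seriesArg] at h1
    rw [eval_sub hz, h1]
  refine ⟨hGs.implicitFunctionOfProdDomain hinv, ?_, ?_⟩
  · have h1 := hGs.eventually_apply_implicitFunctionOfProdDomain hinv
    have h2 := hGs.tendsto_implicitFunctionOfProdDomain hinv
    have h3 := (tendsto_id.prodMk_nhds h2).eventually hcal
    simp only [hG0] at h1
    filter_upwards [h1, h3] with ε h1 h3 z hz j
    have := h3 z hz j
    rw [id, h1] at this
    have h0 : eval ((0 : J → WeightedSeries (T ⊕ X)) j) z = 0 := by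
      rw [← evalHom_apply hz]; simp
    rw [h0] at this
    exact (sub_eq_zero.1 this.symm)
  · have h1 := hGs.eventually_apply_eq_iff_implicitFunctionOfProdDomain hinv
    filter_upwards [h1, hcal] with v h1 h2 h3
    refine (h1.1 ?_).symm
    rw [hG0]
    funext j
    -- A series is determined by its values at small positive times, where the assumed equation says
    -- that `G v j` vanishes.
    refine eq_zero_of_eval_eventuallyEq_zero ?_
    refine eventually_eq_zero_of_positive
      (analyticAt_eval _ (by simpa using evalRadius_pos (T ⊕ X))) ?_
    have hz : ∀ᶠ z in 𝓝 (0 : T ⊕ X → ℝ), ‖z‖ ≤ evalRadius (T ⊕ X) := by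
      filter_upwards [Metric.ball_mem_nhds (0 : T ⊕ X → ℝ) (evalRadius_pos (T ⊕ X))] with z hz
      exact (mem_ball_zero_iff.1 hz).le
    filter_upwards [h3 j, hz] with z h3 hz hp
    rw [h2 z hz j, h3 hp, sub_self]

end WeightedSeries

/-! ### A Cauchy–Kovalevskaya theorem with several times -/

namespace WeightedSeries

open scoped Topology
open Filter

variable {T X J : Type*} [Fintype T] [Fintype X] [DecidableEq T] [DecidableEq X]

/-- The arguments `(z, u(z), ∂_X u(z))` of the right-hand sides. -/
noncomputable def pdeArg (u : J → (T ⊕ X → ℝ) → ℝ) (z : T ⊕ X → ℝ) : ArgIndex T X J → ℝ :=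
  Sum.elim z <| Sum.elim (fun j => u j z) fun q =>
    lineDeriv ℝ (u q.1) z (Pi.single (Sum.inr q.2) 1)

omit [DecidableEq T] [DecidableEq X] in
theorem norm_scaling_mul_le {ε : ℝ × ℝ} (h0 : 0 < ε.1) (h0' : 0 < ε.2) (h1 : ε.1 ≤ 1) (h2 : ε.2 ≤ 1)
    (z : T ⊕ X → ℝ) : ‖fun s => scaling ε s * z s‖ ≤ ‖z‖ := by
  refine (pi_norm_le_iff_of_nonneg (norm_nonneg _)).2 fun s => ?_
  rw [norm_mul]
  refine (mul_le_of_le_one_left (norm_nonneg _) ?_).trans (norm_le_pi_norm z s)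
  rcases s with t | x
  · change ‖ε.1 * ε.2‖ ≤ 1
    rw [Real.norm_of_nonneg (by positivity)]
    exact mul_le_one₀ h1 h0'.le h2
  · change ‖ε.1‖ ≤ 1
    rwa [Real.norm_of_nonneg h0.le]

variable [Fintype J] [DecidableEq J]

theorem eventually_small_scaling {p : ℝ × ℝ → Prop} (h : ∀ᶠ ε in 𝓝 0, p ε) :
    ∃ ε : ℝ × ℝ, 0 < ε.1 ∧ 0 < ε.2 ∧ ε.1 ≤ 1 ∧ ε.2 ≤ 1 ∧ p ε := by
  have hc : Tendsto (fun r : ℝ => (r, r)) (𝓝[>] 0) (𝓝 (0 : ℝ × ℝ)) := by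
    have : ContinuousAt (fun r : ℝ => (r, r)) 0 := by fun_prop
    exact this.tendsto.mono_left nhdsWithin_le_nhds
  have h1 : ∀ᶠ r : ℝ in 𝓝[>] 0, r ≤ 1 := by
    filter_upwards [Ioc_mem_nhdsGT (zero_lt_one' ℝ)] with r hr using hr.2
  obtain ⟨r, ⟨hr, hr0⟩, hr1⟩ := ((hc.eventually h).and self_mem_nhdsWithin).and h1 |>.exists
  exact ⟨(r, r), hr0, hr0, hr1, hr1, hr⟩

/-- A Cauchy–Kovalevskaya theorem with several times, each unknown being prescribed on the
vanishing of its own time: existence. -/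
theorem exists_pdeSolution (τ : J → T) {H : J → (ArgIndex T X J → ℝ) → ℝ}
    (hH : ∀ j, AnalyticAt ℝ (H j) 0) :
    ∃ u : J → (T ⊕ X → ℝ) → ℝ, (∀ j, AnalyticAt ℝ (u j) 0) ∧
      ∀ᶠ z in 𝓝 0, ∀ j, (z (Sum.inl (τ j)) = 0 → u j z = 0) ∧
        HasLineDerivAt ℝ (u j) (H j (pdeArg u z)) z (Pi.single (Sum.inl (τ j)) 1) := by
  obtain ⟨ψ, hψ, -⟩ := exists_seriesSolution τ hH
  obtain ⟨ε, h1, h2, -, -, hε⟩ := eventually_small_scaling hψ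
  let c : T ⊕ X → ℝ := fun s => (scaling ε s)⁻¹
  have hc : ∀ s : T ⊕ X, 0 < scaling ε s := by
    rintro (t | x)
    · exact mul_pos h1 h2
    · exact h1
  -- Undo the rescaling: integrate the time derivative from the vanishing of its own time, then
  -- restore the scale `ε₁ε₂`.
  let u : J → (T ⊕ X → ℝ) → ℝ := fun j z =>
    (ε.1 * ε.2) * eval (integ (Sum.inl (τ j)) (ψ ε j)) fun s => c s * z s
  have hcont : Continuous fun (z : T ⊕ X → ℝ) s => c s * z s := by fun_prop
  have hnear : ∀ᶠ z in 𝓝 (0 : T ⊕ X → ℝ), ‖fun s => c s * z s‖ < evalRadius (T ⊕ X) := by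
    refine hcont.norm.continuousAt.eventually_lt_const ?_
    simpa [← Pi.zero_def] using evalRadius_pos (T ⊕ X)
  refine ⟨u, fun j => ?_, ?_⟩
  · refine analyticAt_const.mul (AnalyticAt.fun_comp (g := eval _) ?_ ?_)
    · exact analyticAt_eval _ hnear.self_of_nhds
    · rw [analyticAt_pi_iff]
      exact fun s => analyticAt_const.mul
        ((ContinuousLinearMap.proj (R := ℝ) (φ := fun _ : T ⊕ X => ℝ) s).analyticAt _)
  · filter_upwards [hnear] with z hz j
    have hx : ∀ (j : J) (x : X), HasLineDerivAt ℝ (u j)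
        (ε.2 * eval (dinteg (Sum.inr_ne_inl (a := τ j) (b := x)) (ψ ε j)) fun s => c s * z s) z
        (Pi.single (Sum.inr x) 1) := by
      intro j x
      have h3 := (hasLineDerivAt_dinteg (Sum.inr_ne_inl (a := τ j) (b := x)) (ψ ε j) hz).comp_mul
      refine (HasDerivAt.const_mul (ε.1 * ε.2) h3).congr_deriv ?_
      have : c (Sum.inr x) = ε.1⁻¹ := rfl
      rw [this]
      field_simp
    have ht : HasLineDerivAt ℝ (u j) (eval (ψ ε j) fun s => c s * z s) z
        (Pi.single (Sum.inl (τ j)) 1) := by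
      have h3 := (hasLineDerivAt_integ (Sum.inl (τ j)) (ψ ε j) hz).comp_mul
      refine (HasDerivAt.const_mul (ε.1 * ε.2) h3).congr_deriv ?_
      have : c (Sum.inl (τ j)) = (ε.1 * ε.2)⁻¹ := rfl
      rw [this]
      field_simp
    refine ⟨fun h0 => ?_, ?_⟩
    · simp only [u]
      rw [eval_integ_eq_zero _ _ hz.le (by simp [h0]), mul_zero]
    · rw [hε _ hz.le j] at ht
      convert ht using 2
      funext k
      rcases k with s | (j | ⟨j, x⟩)
      · change z s = scaling ε s * ((scaling ε s)⁻¹ * z s)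
        rw [mul_inv_cancel_left₀ (hc s).ne']
      · rfl
      · exact (hx j x).lineDeriv

/-- The problem solved by `exists_pdeSolution`, on nonnegative times only. -/
def IsForwardSolution (τ : J → T) (H : J → (ArgIndex T X J → ℝ) → ℝ)
    (u : J → (T ⊕ X → ℝ) → ℝ) : Prop :=
  ∀ᶠ z in 𝓝 (0 : T ⊕ X → ℝ), (∀ t, 0 ≤ z (Sum.inl t)) →
    ∀ j, (z (Sum.inl (τ j)) = 0 → u j z = 0) ∧
      lineDeriv ℝ (u j) z (Pi.single (Sum.inl (τ j)) 1) = H j (pdeArg u z)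

omit [DecidableEq T] [DecidableEq X] in
theorem _root_.AnalyticAt.lineDeriv {u : (T ⊕ X → ℝ) → ℝ} {z : T ⊕ X → ℝ} (hu : AnalyticAt ℝ u z)
    (v : T ⊕ X → ℝ) : AnalyticAt ℝ (fun z => lineDeriv ℝ u z v) z := by
  have h1 : AnalyticAt ℝ (fun z => fderiv ℝ u z v) z :=
    ((ContinuousLinearMap.apply ℝ ℝ v).analyticAt _).fun_comp hu.fderiv
  refine h1.congr ?_
  filter_upwards [hu.eventually_analyticAt] with z hz
  exact (hz.differentiableAt.lineDeriv_eq_fderiv).symm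

-- Each unknown vanishes on the slice where all times are zero, hence so do its spatial derivatives
-- at the origin.
omit [Fintype T] [Fintype X] [Fintype J] [DecidableEq J] in
theorem IsForwardSolution.pdeArg_zero {τ : J → T} {H : J → (ArgIndex T X J → ℝ) → ℝ}
    {u : J → (T ⊕ X → ℝ) → ℝ} (h : IsForwardSolution τ H u) : pdeArg u 0 = 0 := by
  funext k
  rcases k with s | (j | ⟨j, x⟩)
  · rfl
  · exact (Eventually.self_of_nhds h (fun _ => le_rfl) j).1 rfl
  · have hc : ContinuousAt (fun r : ℝ => (0 : T ⊕ X → ℝ) + r • Pi.single (Sum.inr x) (1 : ℝ)) 0 := by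
      fun_prop
    have h0 : (fun r : ℝ => u j ((0 : T ⊕ X → ℝ) + r • Pi.single (Sum.inr x) (1 : ℝ))) =ᶠ[𝓝 0]
        fun _ => 0 := by
      have h2 := hc.tendsto
      rw [zero_smul, add_zero] at h2
      filter_upwards [h2.eventually h] with r hr
      exact (hr (fun t => by simp) j).1 (by simp)
    have h1 : HasLineDerivAt ℝ (u j) 0 0 (Pi.single (Sum.inr x) 1) :=
      (hasDerivAt_const (0 : ℝ) (0 : ℝ)).congr_of_eventuallyEq h0
    exact h1.lineDeriv

omit [DecidableEq J] in
/-- Forward solutions come from the solutions `ψ` of the rescaled problem in the algebra of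
series. -/
theorem IsForwardSolution.eventually_eq_series {τ : J → T} {H : J → (ArgIndex T X J → ℝ) → ℝ}
    {u : J → (T ⊕ X → ℝ) → ℝ} (hu : ∀ j, AnalyticAt ℝ (u j) 0) (h : IsForwardSolution τ H u)
    {ψ : ℝ × ℝ → J → WeightedSeries (T ⊕ X)}
    (hψ : ∀ᶠ v in 𝓝 ((0, fun j => algebraMap ℝ _ (H j 0)) :
          (ℝ × ℝ) × (J → WeightedSeries (T ⊕ X))),
        (∀ j, ∀ᶠ z in 𝓝 0, (∀ t, 0 < z (Sum.inl t)) →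
          eval (v.2 j) z = H j (evalArg τ v z)) → v.2 = ψ v.1) :
    ∀ᶠ ε : ℝ × ℝ in 𝓝 0, 0 < ε.1 → 0 < ε.2 → ε.1 ≤ 1 → ε.2 ≤ 1 →
      ∀ᶠ z in 𝓝 0, (∀ t, 0 < z (Sum.inl t)) → ∀ j, u j (fun s => scaling ε s * z s) =
        ε.1 * ε.2 * eval (integ (Sum.inl (τ j)) (ψ ε j)) z := by
  let D : J → (T ⊕ X → ℝ) → ℝ := fun j z => lineDeriv ℝ (u j) z (Pi.single (Sum.inl (τ j)) 1)
  have hD : ∀ j, AnalyticAt ℝ (D j) 0 := fun j => (hu j).lineDeriv _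
  have hD0 : ∀ j, D j 0 = H j 0 := fun j => by
    rw [← h.pdeArg_zero]
    exact (Eventually.self_of_nhds h (fun _ => le_rfl) j).2
  choose Φ hΦ hΦ0 hΦe using fun j => exists_functionalCalculus (WeightedSeries (T ⊕ X)) (hD j)
  let x : ℝ × ℝ → T ⊕ X → WeightedSeries (T ⊕ X) := fun ε s => scaling ε s • var s
  have hx : Tendsto x (𝓝 0) (𝓝 0) := by
    have hc : ContinuousAt x 0 := by
      refine (continuous_pi fun s => ?_).continuousAt
      rcases s with t | y <;> simp only [scaling, x, Sum.elim_inl, Sum.elim_inr] <;> fun_prop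
    have h0 : x 0 = 0 := by
      funext s
      rcases s with t | y <;> simp [x, scaling]
    have := hc.tendsto
    rwa [h0] at this
  -- The functional calculus applied to the scaled coordinates expands the rescaled time derivative
  -- `D j` as a weighted series. As `ε → 0` it tends to the constant `D j 0 = H j 0`, hence enters
  -- the region of uniqueness.
  let f : ℝ × ℝ → J → WeightedSeries (T ⊕ X) := fun ε j => Φ j (x ε)
  have hf : Tendsto (fun ε => (ε, f ε)) (𝓝 0) (𝓝 (0, fun j => algebraMap ℝ _ (H j 0))) := by
    refine tendsto_id.prodMk_nhds (tendsto_pi_nhds.2 fun j => ?_)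
    have := (hΦ j).continuousAt.tendsto.comp hx
    rwa [hΦ0, hD0] at this
  obtain ⟨ρ, hρ, hball⟩ := Metric.eventually_nhds_iff_ball.1
    ((eventually_all.2 fun j => (hu j).eventually_analyticAt).and h)
  filter_upwards [hf.eventually hψ, hx.eventually (eventually_all.2 hΦe)] with ε h1 h2 p1 p2 q1 q2
  have hfe : ∀ z, ‖z‖ ≤ evalRadius (T ⊕ X) → ∀ j,
      eval (f ε j) z = D j fun s => scaling ε s * z s := by
    intro z hz j
    have := h2 j (evalHom hz) (norm_evalHom_le hz)
    simpa only [evalHom_apply, x, eval_smul, eval_var] using this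
  let U : Set (T ⊕ X → ℝ) := {z | ‖z‖ < min ρ (evalRadius (T ⊕ X))}
  have hUo : IsOpen U := isOpen_lt continuous_norm continuous_const
  have hU0 : U ∈ 𝓝 0 := hUo.mem_nhds (by simpa [U] using ⟨hρ, evalRadius_pos _⟩)
  have hUs : ∀ z ∈ U, (fun s => scaling ε s * z s) ∈ Metric.ball (0 : T ⊕ X → ℝ) ρ := by
    intro z hz
    rw [mem_ball_zero_iff]
    exact (norm_scaling_mul_le p1 p2 q1 q2 z).trans_lt (hz.trans_le (min_le_left _ _))
  have hUe : ∀ z ∈ U, ‖z‖ < evalRadius (T ⊕ X) := fun z hz => hz.trans_le (min_le_right _ _)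
  have hsc : ∀ z : T ⊕ X → ℝ, (∀ t, 0 ≤ z (Sum.inl t)) →
      ∀ t, 0 ≤ (fun s => scaling ε s * z s) (Sum.inl t) := fun z hz t =>
    mul_nonneg (mul_nonneg p1.le p2.le) (hz t)
  have hline : ∀ (j : J) (z) (_ : z ∈ U) (s : T ⊕ X), HasLineDerivAt ℝ
      (fun z => u j fun s => scaling ε s * z s) (scaling ε s *
        lineDeriv ℝ (u j) (fun s => scaling ε s * z s) (Pi.single s 1)) z (Pi.single s 1) :=
    fun j z hz s => HasLineDerivAt.comp_mul
      (((hball _ (hUs z hz)).1 j).differentiableAt.lineDifferentiableAt.hasLineDerivAt)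
  -- Both sides vanish when the own time is zero and have the same derivative in that time; the
  -- segment joining the two points stays in `U` and in nonnegative times.
  have hI : ∀ z ∈ U, (∀ t, 0 ≤ z (Sum.inl t)) → ∀ j, u j (fun s => scaling ε s * z s) =
        ε.1 * ε.2 * eval (integ (Sum.inl (τ j)) (f ε j)) z := by
    intro z hz hp j
    have hup : ∀ r ∈ Icc 0 (z (Sum.inl (τ j))), Function.update z (Sum.inl (τ j)) r ∈ U ∧
        ∀ t, 0 ≤ Function.update z (Sum.inl (τ j)) r (Sum.inl t) := by
      intro r hr
      constructor
      · refine lt_of_le_of_lt ((pi_norm_le_iff_of_nonneg (norm_nonneg z)).2 fun s => ?_) hz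
        by_cases hs : s = Sum.inl (τ j)
        · subst hs
          rw [Function.update_self, Real.norm_of_nonneg hr.1]
          exact hr.2.trans ((le_abs_self _).trans (norm_le_pi_norm z _))
        · rw [Function.update_of_ne hs]
          exact norm_le_pi_norm z s
      · intro t
        by_cases hs : t = τ j
        · subst hs; simpa using hr.1
        · rw [Function.update_of_ne (by simpa using hs)]
          exact hp t
    have key := eq_of_hasLineDerivAt_zero (g := fun z => u j (fun s => scaling ε s * z s) -
      ε.1 * ε.2 * eval (integ (Sum.inl (τ j)) (f ε j)) z) (hp (τ j)) fun r hr => by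
        have a1 := hline j _ (hup r hr).1 (Sum.inl (τ j))
        have a2 := hasLineDerivAt_integ (Sum.inl (τ j)) (f ε j) (hUe _ (hup r hr).1)
        rw [hfe _ (hUe _ (hup r hr).1).le] at a2
        refine (HasDerivAt.sub a1 (HasDerivAt.const_mul (ε.1 * ε.2) a2)).congr_deriv ?_
        exact sub_self _
    obtain ⟨b1, b2⟩ := hup 0 ⟨le_rfl, hp _⟩
    rw [((hball _ (hUs _ b1)).2 (hsc _ b2) j).1 (by simp),
      eval_integ_eq_zero _ _ (hUe _ b1).le (by simp), mul_zero, sub_zero] at key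
    exact sub_eq_zero.1 key
  -- Differentiating `hI` in space needs it on an open set, so from here on the times are strictly
  -- positive.
  have hUpos : IsOpen {z : T ⊕ X → ℝ | z ∈ U ∧ ∀ t, 0 < z (Sum.inl t)} := by
    have : IsOpen {z : T ⊕ X → ℝ | ∀ t, 0 < z (Sum.inl t)} := by
      simp only [ofPred_forall]
      exact isOpen_iInter_of_finite fun t => isOpen_lt continuous_const (continuous_apply _)
    exact hUo.inter this
  have hfψ : f ε = ψ ε := by
    refine h1 fun j => ?_
    filter_upwards [hU0] with z hz hp
    rw [hfe z (hUe z hz).le j]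
    refine ((hball _ (hUs z hz)).2 (hsc z fun t => (hp t).le) j).2.trans ?_
    congr 1
    funext k
    rcases k with s | (k | ⟨k, y⟩)
    · rfl
    · exact hI z hz (fun t => (hp t).le) k
    · have a1 := hline k z hz (Sum.inr y)
      have a2 := HasDerivAt.const_mul (ε.1 * ε.2)
        (hasLineDerivAt_dinteg (Sum.inr_ne_inl (a := τ k) (b := y)) (f ε k) (hUe z hz))
      have a3 : HasLineDerivAt ℝ (fun z => u k fun s => scaling ε s * z s) (ε.1 * ε.2 *
          eval (dinteg (Sum.inr_ne_inl (a := τ k) (b := y)) (f ε k)) z) z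
          (Pi.single (Sum.inr y) 1) := by
        refine HasLineDerivAt.congr_of_eventuallyEq (f := fun z => ε.1 * ε.2 *
          eval (integ (Sum.inl (τ k)) (f ε k)) z) a2 ?_
        filter_upwards [hUpos.mem_nhds ⟨hz, hp⟩] with z hz
        exact hI z hz.1 (fun t => (hz.2 t).le) k
      have a4 := HasDerivAt.unique a1 a3
      change ε.1 * _ = _ at a4
      rw [mul_assoc] at a4
      exact mul_left_cancel₀ p1.ne' a4
  rw [← hfψ]
  filter_upwards [hU0] with z hz hp j
  exact hI z hz (fun t => (hp t).le) j

/-- A Cauchy–Kovalevskaya theorem with several times, each unknown being prescribed on the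
vanishing of its own time: uniqueness. -/
theorem IsForwardSolution.eventuallyEq {τ : J → T} {H : J → (ArgIndex T X J → ℝ) → ℝ}
    (hH : ∀ j, AnalyticAt ℝ (H j) 0)
    {u u' : J → (T ⊕ X → ℝ) → ℝ} (hu : ∀ j, AnalyticAt ℝ (u j) 0) (h : IsForwardSolution τ H u)
    (hu' : ∀ j, AnalyticAt ℝ (u' j) 0) (h' : IsForwardSolution τ H u') (j : J) :
    u j =ᶠ[𝓝 0] u' j := by
  obtain ⟨ψ, -, hψ⟩ := exists_seriesSolution τ hH
  -- One common scaling at which both solutions are expressed by the same series `ψ ε`.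
  obtain ⟨ε, h1, h2, h3, h4, hε, hε'⟩ := eventually_small_scaling
    ((h.eventually_eq_series hu hψ).and (h'.eventually_eq_series hu' hψ))
  have hc : ∀ s : T ⊕ X, 0 < scaling ε s := by
    rintro (t | x)
    · exact mul_pos h1 h2
    · exact h1
  suffices (fun z => u j z - u' j z) =ᶠ[𝓝 0] 0 by
    filter_upwards [this] with z hz using sub_eq_zero.1 hz
  refine eventually_eq_zero_of_positive ((hu j).sub (hu' j)) ?_
  have ht : Tendsto (fun (z : T ⊕ X → ℝ) s => (scaling ε s)⁻¹ * z s) (𝓝 0) (𝓝 0) := by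
    have : Continuous fun (z : T ⊕ X → ℝ) s => (scaling ε s)⁻¹ * z s := by fun_prop
    have := this.tendsto 0
    simpa [← Pi.zero_def] using this
  filter_upwards [ht.eventually ((hε h1 h2 h3 h4).and (hε' h1 h2 h3 h4))] with z hz hp
  have hp' : ∀ t : T, 0 < (fun s => (scaling ε s)⁻¹ * z s) (Sum.inl t) := fun t =>
    mul_pos (inv_pos.2 (hc _)) (hp t)
  have e1 := hz.1 hp' j
  have e2 := hz.2 hp' j
  simp only [mul_inv_cancel_left₀ (hc _).ne'] at e1 e2
  rw [e1, e2, sub_self]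

end WeightedSeries

/-! ### The characteristic problem in one chart -/

section slices

open scoped Topology
open Filter

variable {d k : ℕ}

theorem hasFDerivAt_slice {E G : Type*} [NormedAddCommGroup E] [NormedSpace ℝ E]
    [NormedAddCommGroup G] [NormedSpace ℝ G] {g : E × Ang d → G} {p : E × Ang d}
    (hg : DifferentiableAt ℝ g p) :
    HasFDerivAt (fun x => g (p.1, x)) (fderiv ℝ g p ∘L ContinuousLinearMap.inr ℝ E (Ang d)) p.2 :=
  HasFDerivAt.comp p.2 (f := fun x => (p.1, x)) hg.hasFDerivAt (hasFDerivAt_prodMk_right p.1 p.2)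

theorem analyticAt_fderiv_slice {E G : Type*} [NormedAddCommGroup E] [NormedSpace ℝ E]
    [NormedAddCommGroup G] [NormedSpace ℝ G] [CompleteSpace G] {g : E × Ang d → G}
    {p : E × Ang d} (hg : AnalyticAt ℝ g p) :
    AnalyticAt ℝ (fun p : E × Ang d => fderiv ℝ (fun x => g (p.1, x)) p.2) p := by
  have h1 : AnalyticAt ℝ (fun p => fderiv ℝ g p ∘L ContinuousLinearMap.inr ℝ E (Ang d)) p :=
    ((ContinuousLinearMap.compL ℝ (Ang d) (E × Ang d) G).flip
      (ContinuousLinearMap.inr ℝ E (Ang d)) |>.analyticAt _).fun_comp hg.fderiv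
  refine h1.congr ?_
  filter_upwards [hg.eventually_analyticAt] with p hp
  exact (hasFDerivAt_slice hp.differentiableAt).fderiv.symm

/-- The linear map with given matrix of partial derivatives. -/
noncomputable def ofPartials (y : Fin k × Fin d → ℝ) : Ang d →L[ℝ] (Fin k → ℝ) :=
  ∑ q, y q • (EuclideanSpace.proj q.2 : Ang d →L[ℝ] ℝ).smulRight (Pi.single q.1 1)

theorem ofPartials_single (y : Fin k × Fin d → ℝ) (i : Fin d) (a : Fin k) :
    ofPartials y (EuclideanSpace.single i 1) a = y (a, i) := by
  rw [ofPartials, sum_apply, Finset.sum_apply, Finset.sum_eq_single (a, i)]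
  · simp
  · rintro ⟨b, j⟩ - hb
    by_cases hj : j = i
    · subst hj
      have : a ≠ b := fun h => hb (by rw [h])
      simp [this]
    · simp [hj]
  · simp

/-- It recovers the full angular derivative from that of the data and the partial derivatives of the
deviations, the form in which derivatives enter `pdeArg`. -/
theorem fderiv_eq_add_ofPartials {g g₀ : Ang d → Fin k → ℝ} {x : Ang d}
    (hg : DifferentiableAt ℝ g x) (hg₀ : DifferentiableAt ℝ g₀ x) :
    fderiv ℝ g x = fderiv ℝ g₀ x + ofPartials fun q =>
      lineDeriv ℝ (fun x => g x q.1 - g₀ x q.1) x (EuclideanSpace.single q.2 1) := by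
  refine ContinuousLinearMap.coe_injective ((EuclideanSpace.basisFun (Fin d) ℝ).toBasis.ext
    fun i => ?_)
  funext a
  have h1 : HasFDerivAt (fun x => g x a - g₀ x a)
      ((ContinuousLinearMap.proj a).comp (fderiv ℝ g x) -
        (ContinuousLinearMap.proj a).comp (fderiv ℝ g₀ x)) x :=
    (hasFDerivAt_pi'.1 hg.hasFDerivAt a).sub (hasFDerivAt_pi'.1 hg₀.hasFDerivAt a)
  have h2 := (h1.hasLineDerivAt (EuclideanSpace.single i 1)).lineDeriv
  simp only [OrthonormalBasis.coe_toBasis, EuclideanSpace.basisFun_apply,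
    ContinuousLinearMap.coe_coe, add_apply, Pi.add_apply]
  rw [ofPartials_single, h2]
  simp

end slices

namespace CharSystem

open scoped Topology
open Filter WeightedSeries

variable {d m n : ℕ}

/-- The argument of `F` for functions of `(λ, ν, x)`. -/
noncomputable def localArgF (v : ℝ × ℝ × Ang d → Fin m → ℝ) (w : ℝ × ℝ × Ang d → Fin n → ℝ)
    (q : ℝ × ℝ × Ang d) :
    (Fin m → ℝ) × (Fin n → ℝ) × (Ang d →L[ℝ] (Fin m → ℝ)) × (Ang d →L[ℝ] (Fin n → ℝ)) :=
  (v q, w q, fderiv ℝ (fun x => v (q.1, q.2.1, x)) q.2.2,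
    fderiv ℝ (fun x => w (q.1, q.2.1, x)) q.2.2)

/-- The argument of `G` for functions of `(λ, ν, x)`. -/
noncomputable def localArgG (v : ℝ × ℝ × Ang d → Fin m → ℝ) (w : ℝ × ℝ × Ang d → Fin n → ℝ)
    (q : ℝ × ℝ × Ang d) :
    (Fin m → ℝ) × (Fin n → ℝ) × (Ang d →L[ℝ] (Fin m → ℝ)) :=
  (v q, w q, fderiv ℝ (fun x => v (q.1, q.2.1, x)) q.2.2)

/-- The equations and initial conditions at the point `q` for functions of `(λ, ν, x)`. -/
structure SolvesAt (Φ : CharSystem d m n) (v₀ : ℝ × Ang d → Fin m → ℝ)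
    (w₀ : ℝ × Ang d → Fin n → ℝ) (v : ℝ × ℝ × Ang d → Fin m → ℝ)
    (w : ℝ × ℝ × Ang d → Fin n → ℝ) (q : ℝ × ℝ × Ang d) : Prop where
  eq_V : HasDerivAt (fun t => v (t, q.2)) (Φ.F (localArgF v w q)) q.1
  eq_W : HasDerivAt (fun t => w (q.1, t, q.2.2)) (Φ.G (localArgG v w q)) q.2.1
  init_V : q.1 = 0 → v q = v₀ q.2
  init_W : q.2.1 = 0 → w q = w₀ (q.1, q.2.2)

/-- The time belonging to each component. -/
def ownTime : Fin m ⊕ Fin n → Fin 2 := Sum.elim (fun _ => 0) fun _ => 1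

/-- The point `(λ, ν, x)` with given coordinates relative to `(0, 0, x₀)`. -/
noncomputable def toPoint (x₀ : Ang d) (z : Fin 2 ⊕ Fin d → ℝ) : ℝ × ℝ × Ang d :=
  (z (Sum.inl 0), z (Sum.inl 1), x₀ + WithLp.toLp 2 fun i => z (Sum.inr i))

/-- The coordinates of a point relative to `(0, 0, x₀)`. -/
def ofPoint (x₀ : Ang d) (q : ℝ × ℝ × Ang d) : Fin 2 ⊕ Fin d → ℝ :=
  Sum.elim ![q.1, q.2.1] fun i => q.2.2 i - x₀ i

theorem toPoint_ofPoint (x₀ : Ang d) (q : ℝ × ℝ × Ang d) : toPoint x₀ (ofPoint x₀ q) = q := by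
  refine Prod.ext rfl (Prod.ext rfl ?_)
  ext i
  simp [toPoint, ofPoint]

theorem ofPoint_toPoint (x₀ : Ang d) (z : Fin 2 ⊕ Fin d → ℝ) : ofPoint x₀ (toPoint x₀ z) = z := by
  funext s
  rcases s with t | i
  · fin_cases t <;> rfl
  · simp [toPoint, ofPoint]

theorem toPoint_zero (x₀ : Ang d) : toPoint x₀ 0 = (0, 0, x₀) := by
  refine Prod.ext rfl (Prod.ext rfl ?_)
  ext i
  simp [toPoint]

theorem ofPoint_base (x₀ : Ang d) : ofPoint x₀ (0, 0, x₀) = 0 := by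
  rw [← toPoint_zero, ofPoint_toPoint]

theorem analyticAt_toPoint (x₀ : Ang d) (z : Fin 2 ⊕ Fin d → ℝ) : AnalyticAt ℝ (toPoint x₀) z := by
  have h : ∀ s, AnalyticAt ℝ (fun z : Fin 2 ⊕ Fin d → ℝ => z s) z := fun s =>
    (ContinuousLinearMap.proj (R := ℝ) (φ := fun _ : Fin 2 ⊕ Fin d => ℝ) s).analyticAt _
  refine (h _).prod ((h _).prod (analyticAt_const.add ?_))
  exact ((PiLp.continuousLinearEquiv 2 ℝ (fun _ : Fin d => ℝ)).symm.toContinuousLinearMap.analyticAt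
    _).fun_comp (analyticAt_pi_iff.2 fun i => h (Sum.inr i))

theorem analyticAt_ofPoint (x₀ : Ang d) (q : ℝ × ℝ × Ang d) : AnalyticAt ℝ (ofPoint x₀) q := by
  rw [analyticAt_pi_iff]
  rintro (t | i)
  · fin_cases t
    · exact analyticAt_fst
    · exact ((ContinuousLinearMap.fst ℝ ℝ (Ang d)).comp
        (ContinuousLinearMap.snd ℝ ℝ (ℝ × Ang d))).analyticAt q
  · exact (((EuclideanSpace.proj i : Ang d →L[ℝ] ℝ).comp ((ContinuousLinearMap.snd ℝ ℝ (Ang d)).comp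
        (ContinuousLinearMap.snd ℝ ℝ (ℝ × Ang d)))).analyticAt q).sub analyticAt_const

theorem tendsto_toPoint (x₀ : Ang d) : Tendsto (toPoint x₀) (𝓝 0) (𝓝 (0, 0, x₀)) := by
  have := (analyticAt_toPoint x₀ 0).continuousAt.tendsto
  rwa [toPoint_zero] at this

theorem tendsto_ofPoint (x₀ : Ang d) : Tendsto (ofPoint x₀) (𝓝 (0, 0, x₀)) (𝓝 0) := by
  have := (analyticAt_ofPoint x₀ (0, 0, x₀)).continuousAt.tendsto
  rwa [ofPoint_base] at this

/-- The deviations of the unknowns from the data. -/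
noncomputable def deviation (x₀ : Ang d) (v₀ : ℝ × Ang d → Fin m → ℝ) (w₀ : ℝ × Ang d → Fin n → ℝ)
    (v : ℝ × ℝ × Ang d → Fin m → ℝ) (w : ℝ × ℝ × Ang d → Fin n → ℝ) :
    Fin m ⊕ Fin n → (Fin 2 ⊕ Fin d → ℝ) → ℝ :=
  Sum.elim
    (fun a z => v (toPoint x₀ z) a - v₀ (toPoint x₀ z).2 a)
    (fun b z => w (toPoint x₀ z) b - w₀ ((toPoint x₀ z).1, (toPoint x₀ z).2.2) b)

/-- The components `V` of the argument, in terms of deviations from the data. -/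
noncomputable def inputV (x₀ : Ang d) (v₀ : ℝ × Ang d → Fin m → ℝ)
    (y : ArgIndex (Fin 2) (Fin d) (Fin m ⊕ Fin n) → ℝ) : Fin m → ℝ :=
  v₀ (toPoint x₀ fun s => y (Sum.inl s)).2 + fun a => y (Sum.inr (Sum.inl (Sum.inl a)))

/-- The components `W` of the argument, in terms of deviations from the data. -/
noncomputable def inputW (x₀ : Ang d) (w₀ : ℝ × Ang d → Fin n → ℝ)
    (y : ArgIndex (Fin 2) (Fin d) (Fin m ⊕ Fin n) → ℝ) : Fin n → ℝ :=
  w₀ ((toPoint x₀ fun s => y (Sum.inl s)).1, (toPoint x₀ fun s => y (Sum.inl s)).2.2) +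
    fun b => y (Sum.inr (Sum.inl (Sum.inr b)))

/-- The partial derivatives of `V`, in terms of deviations from the data. -/
noncomputable def inputP (x₀ : Ang d) (v₀ : ℝ × Ang d → Fin m → ℝ)
    (y : ArgIndex (Fin 2) (Fin d) (Fin m ⊕ Fin n) → ℝ) : Ang d →L[ℝ] (Fin m → ℝ) :=
  fderiv ℝ (fun x => v₀ ((toPoint x₀ fun s => y (Sum.inl s)).2.1, x))
      (toPoint x₀ fun s => y (Sum.inl s)).2.2 +
    ofPartials fun q => y (Sum.inr (Sum.inr (Sum.inl q.1, q.2)))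

/-- The partial derivatives of `W`, in terms of deviations from the data. -/
noncomputable def inputQ (x₀ : Ang d) (w₀ : ℝ × Ang d → Fin n → ℝ)
    (y : ArgIndex (Fin 2) (Fin d) (Fin m ⊕ Fin n) → ℝ) : Ang d →L[ℝ] (Fin n → ℝ) :=
  fderiv ℝ (fun x => w₀ ((toPoint x₀ fun s => y (Sum.inl s)).1, x))
      (toPoint x₀ fun s => y (Sum.inl s)).2.2 +
    ofPartials fun q => y (Sum.inr (Sum.inr (Sum.inr q.1, q.2)))

/-- The right-hand sides in terms of deviations from the data. -/
noncomputable def deviationRHS (Φ : CharSystem d m n) (x₀ : Ang d) (v₀ : ℝ × Ang d → Fin m → ℝ)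
    (w₀ : ℝ × Ang d → Fin n → ℝ) :
    Fin m ⊕ Fin n → (ArgIndex (Fin 2) (Fin d) (Fin m ⊕ Fin n) → ℝ) → ℝ :=
  Sum.elim
    (fun a y => Φ.F (inputV x₀ v₀ y, inputW x₀ w₀ y, inputP x₀ v₀ y, inputQ x₀ w₀ y) a)
    (fun b y => Φ.G (inputV x₀ v₀ y, inputW x₀ w₀ y, inputP x₀ v₀ y) b)

section inputs

variable (Φ : CharSystem d m n) {x₀ : Ang d} {v₀ : ℝ × Ang d → Fin m → ℝ}
  {w₀ : ℝ × Ang d → Fin n → ℝ}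

theorem analyticAt_deviationRHS (hv₀ : AnalyticAt ℝ v₀ (0, x₀)) (hw₀ : AnalyticAt ℝ w₀ (0, x₀))
    (hF : (v₀ (0, x₀), w₀ (0, x₀), fderiv ℝ (fun x => v₀ (0, x)) x₀,
      fderiv ℝ (fun x => w₀ (0, x)) x₀) ∈ Φ.domF)
    (hG : (v₀ (0, x₀), w₀ (0, x₀), fderiv ℝ (fun x => v₀ (0, x)) x₀) ∈ Φ.domG)
    (j : Fin m ⊕ Fin n) : AnalyticAt ℝ (deviationRHS Φ x₀ v₀ w₀ j) 0 := by
  let Y := ArgIndex (Fin 2) (Fin d) (Fin m ⊕ Fin n) → ℝ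
  have hp : ∀ k, AnalyticAt ℝ (fun y : Y => y k) 0 := fun k =>
    (ContinuousLinearMap.proj (R := ℝ) (φ := fun _ : ArgIndex _ _ _ => ℝ) k).analyticAt _
  have hq : AnalyticAt ℝ (fun y : Y => toPoint x₀ fun s => y (Sum.inl s)) 0 :=
    (analyticAt_toPoint x₀ _).fun_comp (analyticAt_pi_iff.2 fun s => hp (Sum.inl s))
  have e0 : (toPoint x₀ fun s => (0 : Y) (Sum.inl s)) = (0, 0, x₀) := toPoint_zero x₀
  have hq1 : AnalyticAt ℝ (fun y : Y => (toPoint x₀ fun s => y (Sum.inl s)).2) 0 :=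
    analyticAt_snd.fun_comp hq
  have hq2 : AnalyticAt ℝ (fun y : Y => ((toPoint x₀ fun s => y (Sum.inl s)).1,
      (toPoint x₀ fun s => y (Sum.inl s)).2.2)) 0 :=
    (analyticAt_fst.fun_comp hq).prod (analyticAt_snd.fun_comp hq1)
  have hpart : ∀ (k : ℕ) (c : Fin k × Fin d → ArgIndex (Fin 2) (Fin d) (Fin m ⊕ Fin n)),
      AnalyticAt ℝ (fun y : Y => ofPartials fun q => y (c q)) 0 := fun k c =>
    Finset.univ.analyticAt_fun_sum fun q _ => (hp (c q)).smul analyticAt_const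
  have a1 : AnalyticAt ℝ (inputV (n := n) x₀ v₀) 0 := by
    refine AnalyticAt.add (AnalyticAt.fun_comp (g := v₀) ?_ hq1)
      (analyticAt_pi_iff.2 fun a => hp _)
    rw [e0]; exact hv₀
  have a2 : AnalyticAt ℝ (inputW (m := m) x₀ w₀) 0 := by
    refine AnalyticAt.add (AnalyticAt.fun_comp (g := w₀) ?_ hq2)
      (analyticAt_pi_iff.2 fun a => hp _)
    rw [e0]; exact hw₀
  have a3 : AnalyticAt ℝ (inputP (n := n) x₀ v₀) 0 := by
    refine AnalyticAt.add (AnalyticAt.fun_comp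
      (g := fun p : ℝ × Ang d => fderiv ℝ (fun x => v₀ (p.1, x)) p.2) ?_ hq1) (hpart _ _)
    rw [e0]; exact analyticAt_fderiv_slice hv₀
  have a4 : AnalyticAt ℝ (inputQ (m := m) x₀ w₀) 0 := by
    refine AnalyticAt.add (AnalyticAt.fun_comp
      (g := fun p : ℝ × Ang d => fderiv ℝ (fun x => w₀ (p.1, x)) p.2) ?_ hq2) (hpart _ _)
    rw [e0]; exact analyticAt_fderiv_slice hw₀
  have hpart0 : ∀ k : ℕ, ofPartials (fun _ : Fin k × Fin d => (0 : ℝ)) = 0 := fun k => by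
    simp [ofPartials]
  have b1 : inputV (n := n) x₀ v₀ 0 = v₀ (0, x₀) := by
    rw [inputV, e0]; funext a; simp
  have b2 : inputW (m := m) x₀ w₀ 0 = w₀ (0, x₀) := by
    rw [inputW, e0]; funext a; simp
  have b3 : inputP (n := n) x₀ v₀ 0 = fderiv ℝ (fun x => v₀ (0, x)) x₀ := by
    rw [inputP, e0]; simp [hpart0]
  have b4 : inputQ (m := m) x₀ w₀ 0 = fderiv ℝ (fun x => w₀ (0, x)) x₀ := by
    rw [inputQ, e0]; simp [hpart0]
  rcases j with a | b
  · refine ((ContinuousLinearMap.proj (R := ℝ) (φ := fun _ : Fin m => ℝ) a).analyticAt _).fun_comp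
      (AnalyticAt.fun_comp (g := Φ.F) ?_ (a1.prod (a2.prod (a3.prod a4))))
    rw [b1, b2, b3, b4]
    exact Φ.analytic_F _ hF
  · refine ((ContinuousLinearMap.proj (R := ℝ) (φ := fun _ : Fin n => ℝ) b).analyticAt _).fun_comp
      (AnalyticAt.fun_comp (g := Φ.G) ?_ (a1.prod (a2.prod a3)))
    rw [b1, b2, b3]
    exact Φ.analytic_G _ hG

variable {v : ℝ × ℝ × Ang d → Fin m → ℝ} {w : ℝ × ℝ × Ang d → Fin n → ℝ}

theorem toPoint_add_single_inr (z : Fin 2 ⊕ Fin d → ℝ) (r : ℝ) (i : Fin d) :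
    toPoint x₀ (z + r • Pi.single (Sum.inr i) 1) =
      ((toPoint x₀ z).1, (toPoint x₀ z).2.1, (toPoint x₀ z).2.2 + r • EuclideanSpace.single i 1) := by
  refine Prod.ext (by simp [toPoint]) (Prod.ext (by simp [toPoint]) ?_)
  ext k
  by_cases h : k = i
  · subst h; simp [toPoint, add_assoc]
  · simp [toPoint, h]

theorem toPoint_add_single_zero (z : Fin 2 ⊕ Fin d → ℝ) (r : ℝ) :
    toPoint x₀ (z + r • Pi.single (Sum.inl 0) 1) = ((toPoint x₀ z).1 + r, (toPoint x₀ z).2) := by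
  refine Prod.ext (by simp [toPoint]) (Prod.ext (by simp [toPoint]) ?_)
  ext k
  simp [toPoint]

theorem toPoint_add_single_one (z : Fin 2 ⊕ Fin d → ℝ) (r : ℝ) :
    toPoint x₀ (z + r • Pi.single (Sum.inl 1) 1) =
      ((toPoint x₀ z).1, (toPoint x₀ z).2.1 + r, (toPoint x₀ z).2.2) := by
  refine Prod.ext (by simp [toPoint]) (Prod.ext (by simp [toPoint]) ?_)
  ext k
  simp [toPoint]

/-- Adding the data and their derivatives back to the deviations gives the original arguments of the
system. -/
theorem inputs_pdeArg {z : Fin 2 ⊕ Fin d → ℝ} (hv : AnalyticAt ℝ v (toPoint x₀ z))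
    (hw : AnalyticAt ℝ w (toPoint x₀ z)) (hv₀ : AnalyticAt ℝ v₀ (toPoint x₀ z).2)
    (hw₀ : AnalyticAt ℝ w₀ ((toPoint x₀ z).1, (toPoint x₀ z).2.2)) :
    (inputV x₀ v₀ (pdeArg (deviation x₀ v₀ w₀ v w) z),
      inputW x₀ w₀ (pdeArg (deviation x₀ v₀ w₀ v w) z),
      inputP x₀ v₀ (pdeArg (deviation x₀ v₀ w₀ v w) z),
      inputQ x₀ w₀ (pdeArg (deviation x₀ v₀ w₀ v w) z)) = localArgF v w (toPoint x₀ z) := by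
  have hslice : ∀ {k : ℕ} {g : ℝ × ℝ × Ang d → Fin k → ℝ}, AnalyticAt ℝ g (toPoint x₀ z) →
      DifferentiableAt ℝ (fun x => g ((toPoint x₀ z).1, (toPoint x₀ z).2.1, x))
        (toPoint x₀ z).2.2 := fun {k g} hg =>
    hg.differentiableAt.comp (toPoint x₀ z).2.2
      (f := fun x => ((toPoint x₀ z).1, (toPoint x₀ z).2.1, x)) (by fun_prop)
  have hz : (toPoint x₀ fun s => pdeArg (deviation x₀ v₀ w₀ v w) z (Sum.inl s)) =
    toPoint x₀ z := rfl
  refine Prod.ext ?_ (Prod.ext ?_ (Prod.ext ?_ ?_))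
  · funext a
    change v₀ _ a + (v (toPoint x₀ z) a - v₀ _ a) = v (toPoint x₀ z) a
    rw [hz]; ring
  · funext b
    change w₀ _ b + (w (toPoint x₀ z) b - w₀ _ b) = w (toPoint x₀ z) b
    rw [hz]; ring
  · refine Eq.trans ?_ (fderiv_eq_add_ofPartials (hslice hv)
      (hasFDerivAt_slice hv₀.differentiableAt).differentiableAt).symm
    change inputP _ _ _ = _
    rw [inputP, hz]
    congr 2
    funext ⟨a, i⟩
    -- Both are derivatives in the line parameter, and `toPoint` carries the coordinate line to the
    -- corresponding line in the chart.
    change deriv _ 0 = deriv _ 0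
    congr 1
    funext r
    change v _ a - v₀ _ a = v _ a - v₀ _ a
    rw [toPoint_add_single_inr]
  · refine Eq.trans ?_ (fderiv_eq_add_ofPartials (hslice hw)
      (hasFDerivAt_slice hw₀.differentiableAt).differentiableAt).symm
    change inputQ _ _ _ = _
    rw [inputQ, hz]
    congr 2
    funext ⟨a, i⟩
    change deriv _ 0 = deriv _ 0
    congr 1
    funext r
    change w _ a - w₀ _ a = w _ a - w₀ _ a
    rw [toPoint_add_single_inr]

theorem hasDerivAt_add_zero_iff {f : ℝ → ℝ} {f' c t : ℝ} :
    HasDerivAt (fun r => f (t + r) - c) f' 0 ↔ HasDerivAt f f' t := by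
  rw [hasDerivAt_sub_const_iff]
  constructor
  · intro h
    have h' : HasDerivAt (fun r => f (t + r)) f' (t - t) := by rwa [sub_self]
    simpa using h'.comp_sub_const t t
  · intro h
    exact HasDerivAt.comp_const_add t 0 (by rwa [add_zero])

/-- The data `v₀` do not depend on `λ`, so subtracting them does not affect the derivative in that
time. -/
theorem hasLineDerivAt_deviation_inl_iff (z : Fin 2 ⊕ Fin d → ℝ) (a : Fin m) (D : ℝ) :
    HasLineDerivAt ℝ (deviation x₀ v₀ w₀ v w (Sum.inl a)) D z
        (Pi.single (Sum.inl (ownTime (Sum.inl a : Fin m ⊕ Fin n))) 1) ↔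
      HasDerivAt (fun t => v (t, (toPoint x₀ z).2) a) D (toPoint x₀ z).1 := by
  rw [← hasDerivAt_add_zero_iff (c := v₀ (toPoint x₀ z).2 a), HasLineDerivAt]
  have : ∀ r : ℝ, deviation x₀ v₀ w₀ v w (Sum.inl a)
      (z + r • Pi.single (Sum.inl (ownTime (Sum.inl a : Fin m ⊕ Fin n))) 1) =
      v ((toPoint x₀ z).1 + r, (toPoint x₀ z).2) a - v₀ (toPoint x₀ z).2 a := fun r => by
    change v _ a - v₀ _ a = _
    rw [show ownTime (Sum.inl a : Fin m ⊕ Fin n) = 0 from rfl, toPoint_add_single_zero]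
  simp only [this]

theorem hasLineDerivAt_deviation_inr_iff (z : Fin 2 ⊕ Fin d → ℝ) (b : Fin n) (D : ℝ) :
    HasLineDerivAt ℝ (deviation x₀ v₀ w₀ v w (Sum.inr b)) D z
        (Pi.single (Sum.inl (ownTime (Sum.inr b : Fin m ⊕ Fin n))) 1) ↔
      HasDerivAt (fun t => w ((toPoint x₀ z).1, t, (toPoint x₀ z).2.2) b) D (toPoint x₀ z).2.1 := by
  rw [← hasDerivAt_add_zero_iff (c := w₀ ((toPoint x₀ z).1, (toPoint x₀ z).2.2) b), HasLineDerivAt]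
  have : ∀ r : ℝ, deviation x₀ v₀ w₀ v w (Sum.inr b)
      (z + r • Pi.single (Sum.inl (ownTime (Sum.inr b : Fin m ⊕ Fin n))) 1) =
      w ((toPoint x₀ z).1, (toPoint x₀ z).2.1 + r, (toPoint x₀ z).2.2) b -
        w₀ ((toPoint x₀ z).1, (toPoint x₀ z).2.2) b := fun r => by
    change w _ b - w₀ _ b = _
    rw [show ownTime (Sum.inr b : Fin m ⊕ Fin n) = 1 from rfl, toPoint_add_single_one]
  simp only [this]

/-- The bridge to the abstract problem: the characteristic problem with data becomes a system with
zero data, each component in its own time. -/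
theorem solvesAt_iff {z : Fin 2 ⊕ Fin d → ℝ} (hv : AnalyticAt ℝ v (toPoint x₀ z))
    (hw : AnalyticAt ℝ w (toPoint x₀ z)) (hv₀ : AnalyticAt ℝ v₀ (toPoint x₀ z).2)
    (hw₀ : AnalyticAt ℝ w₀ ((toPoint x₀ z).1, (toPoint x₀ z).2.2)) :
    Φ.SolvesAt v₀ w₀ v w (toPoint x₀ z) ↔
      ∀ j, (z (Sum.inl (ownTime j)) = 0 → deviation x₀ v₀ w₀ v w j z = 0) ∧
        HasLineDerivAt ℝ (deviation x₀ v₀ w₀ v w j)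
          (deviationRHS Φ x₀ v₀ w₀ j (pdeArg (deviation x₀ v₀ w₀ v w) z)) z
          (Pi.single (Sum.inl (ownTime j)) 1) := by
  have h := inputs_pdeArg hv hw hv₀ hw₀
  have hF : ∀ a, deviationRHS Φ x₀ v₀ w₀ (Sum.inl a) (pdeArg (deviation x₀ v₀ w₀ v w) z) =
      Φ.F (localArgF v w (toPoint x₀ z)) a := fun a => by rw [← h]; rfl
  have hG : ∀ b, deviationRHS Φ x₀ v₀ w₀ (Sum.inr b) (pdeArg (deviation x₀ v₀ w₀ v w) z) =
      Φ.G (localArgG v w (toPoint x₀ z)) b := fun b => by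
    have : localArgG v w (toPoint x₀ z) = ((localArgF v w (toPoint x₀ z)).1,
      (localArgF v w (toPoint x₀ z)).2.1, (localArgF v w (toPoint x₀ z)).2.2.1) := rfl
    rw [this, ← h]; rfl
  rw [Sum.forall]
  simp only [hF, hG, hasLineDerivAt_deviation_inl_iff, hasLineDerivAt_deviation_inr_iff]
  constructor
  · intro s
    refine ⟨fun a => ⟨fun h0 => ?_, hasDerivAt_pi.1 s.eq_V a⟩,
      fun b => ⟨fun h0 => ?_, hasDerivAt_pi.1 s.eq_W b⟩⟩
    · exact sub_eq_zero.2 (congrFun (s.init_V h0) a)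
    · exact sub_eq_zero.2 (congrFun (s.init_W h0) b)
  · rintro ⟨s1, s2⟩
    exact ⟨hasDerivAt_pi.2 fun a => (s1 a).2, hasDerivAt_pi.2 fun b => (s2 b).2,
      fun h0 => funext fun a => sub_eq_zero.1 ((s1 a).1 h0),
      fun h0 => funext fun b => sub_eq_zero.1 ((s2 b).1 h0)⟩

theorem eventually_analyticAt_data (hv₀ : AnalyticAt ℝ v₀ (0, x₀)) (hw₀ : AnalyticAt ℝ w₀ (0, x₀)) :
    ∀ᶠ q : ℝ × ℝ × Ang d in 𝓝 (0, 0, x₀), AnalyticAt ℝ v₀ q.2 ∧ AnalyticAt ℝ w₀ (q.1, q.2.2) := by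
  have h1 : ContinuousAt (fun q : ℝ × ℝ × Ang d => q.2) (0, 0, x₀) := by fun_prop
  have h2 : ContinuousAt (fun q : ℝ × ℝ × Ang d => (q.1, q.2.2)) (0, 0, x₀) := by fun_prop
  exact (h1.eventually hv₀.eventually_analyticAt).and (h2.eventually hw₀.eventually_analyticAt)

/-- Local existence for the characteristic problem in coordinates. -/
theorem exists_local_solution (hv₀ : AnalyticAt ℝ v₀ (0, x₀)) (hw₀ : AnalyticAt ℝ w₀ (0, x₀))
    (hF : (v₀ (0, x₀), w₀ (0, x₀), fderiv ℝ (fun x => v₀ (0, x)) x₀,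
      fderiv ℝ (fun x => w₀ (0, x)) x₀) ∈ Φ.domF)
    (hG : (v₀ (0, x₀), w₀ (0, x₀), fderiv ℝ (fun x => v₀ (0, x)) x₀) ∈ Φ.domG) :
    ∃ (v : ℝ × ℝ × Ang d → Fin m → ℝ) (w : ℝ × ℝ × Ang d → Fin n → ℝ),
      AnalyticAt ℝ v (0, 0, x₀) ∧ AnalyticAt ℝ w (0, 0, x₀) ∧
      ∀ᶠ q in 𝓝 (0, 0, x₀), Φ.SolvesAt v₀ w₀ v w q := by
  obtain ⟨u, hu, h⟩ := exists_pdeSolution ownTime (Φ.analyticAt_deviationRHS hv₀ hw₀ hF hG)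
  let v : ℝ × ℝ × Ang d → Fin m → ℝ := fun q => v₀ q.2 + fun a => u (Sum.inl a) (ofPoint x₀ q)
  let w : ℝ × ℝ × Ang d → Fin n → ℝ := fun q =>
    w₀ (q.1, q.2.2) + fun b => u (Sum.inr b) (ofPoint x₀ q)
  have hu' : ∀ j, AnalyticAt ℝ (fun q => u j (ofPoint x₀ q)) (0, 0, x₀) := fun j => by
    refine AnalyticAt.fun_comp (g := u j) ?_ (analyticAt_ofPoint x₀ _)
    rw [ofPoint_base]
    exact hu j
  have hv : AnalyticAt ℝ v (0, 0, x₀) :=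
    (AnalyticAt.fun_comp (g := v₀) (f := fun q : ℝ × ℝ × Ang d => q.2) hv₀ analyticAt_snd).add
      (analyticAt_pi_iff.2 fun a => hu' (Sum.inl a))
  have hw : AnalyticAt ℝ w (0, 0, x₀) :=
    (AnalyticAt.fun_comp (g := w₀) (f := fun q : ℝ × ℝ × Ang d => (q.1, q.2.2)) hw₀
      (analyticAt_fst.prod (analyticAt_snd.fun_comp analyticAt_snd))).add
      (analyticAt_pi_iff.2 fun b => hu' (Sum.inr b))
  have hdev : deviation x₀ v₀ w₀ v w = u := by
    funext j z
    rcases j with a | b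
    · change v₀ _ a + u _ _ - v₀ _ a = _
      rw [ofPoint_toPoint]; ring
    · change w₀ _ b + u _ _ - w₀ _ b = _
      rw [ofPoint_toPoint]; ring
  refine ⟨v, w, hv, hw, ?_⟩
  filter_upwards [hv.eventually_analyticAt, hw.eventually_analyticAt,
    eventually_analyticAt_data hv₀ hw₀, (tendsto_ofPoint x₀).eventually h] with q h1 h2 h3 h4
  have e := toPoint_ofPoint x₀ q
  have := Φ.solvesAt_iff (v := v) (w := w) (v₀ := v₀) (w₀ := w₀) (x₀ := x₀) (z := ofPoint x₀ q)
    (by rwa [e]) (by rwa [e]) (by rw [e]; exact h3.1) (by rw [e]; exact h3.2)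
  rw [e, hdev] at this
  exact this.2 h4

/-- Local uniqueness for the characteristic problem in coordinates. -/
theorem local_solution_unique (hv₀ : AnalyticAt ℝ v₀ (0, x₀)) (hw₀ : AnalyticAt ℝ w₀ (0, x₀))
    (hF : (v₀ (0, x₀), w₀ (0, x₀), fderiv ℝ (fun x => v₀ (0, x)) x₀,
      fderiv ℝ (fun x => w₀ (0, x)) x₀) ∈ Φ.domF)
    (hG : (v₀ (0, x₀), w₀ (0, x₀), fderiv ℝ (fun x => v₀ (0, x)) x₀) ∈ Φ.domG)
    {v' : ℝ × ℝ × Ang d → Fin m → ℝ} {w' : ℝ × ℝ × Ang d → Fin n → ℝ}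
    (hv : AnalyticAt ℝ v (0, 0, x₀)) (hw : AnalyticAt ℝ w (0, 0, x₀))
    (h : ∀ᶠ q in 𝓝 (0, 0, x₀), 0 ≤ q.1 → 0 ≤ q.2.1 → Φ.SolvesAt v₀ w₀ v w q)
    (hv' : AnalyticAt ℝ v' (0, 0, x₀)) (hw' : AnalyticAt ℝ w' (0, 0, x₀))
    (h' : ∀ᶠ q in 𝓝 (0, 0, x₀), 0 ≤ q.1 → 0 ≤ q.2.1 → Φ.SolvesAt v₀ w₀ v' w' q) :
    v =ᶠ[𝓝 (0, 0, x₀)] v' ∧ w =ᶠ[𝓝 (0, 0, x₀)] w' := by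
  -- The deviations of either solution are forward solutions of one and the same abstract problem.
  have key : ∀ {v : ℝ × ℝ × Ang d → Fin m → ℝ} {w : ℝ × ℝ × Ang d → Fin n → ℝ},
      AnalyticAt ℝ v (0, 0, x₀) → AnalyticAt ℝ w (0, 0, x₀) →
      (∀ᶠ q in 𝓝 (0, 0, x₀), 0 ≤ q.1 → 0 ≤ q.2.1 → Φ.SolvesAt v₀ w₀ v w q) →
      (∀ j, AnalyticAt ℝ (deviation x₀ v₀ w₀ v w j) 0) ∧
      IsForwardSolution ownTime (deviationRHS Φ x₀ v₀ w₀) (deviation x₀ v₀ w₀ v w) := by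
    intro v w hv hw h
    constructor
    · have hq := analyticAt_toPoint x₀ 0
      have c1 : AnalyticAt ℝ (fun z => v (toPoint x₀ z)) 0 :=
        AnalyticAt.fun_comp (g := v) (by rwa [toPoint_zero]) hq
      have c2 : AnalyticAt ℝ (fun z => w (toPoint x₀ z)) 0 :=
        AnalyticAt.fun_comp (g := w) (by rwa [toPoint_zero]) hq
      have c3 : AnalyticAt ℝ (fun z => v₀ (toPoint x₀ z).2) 0 :=
        AnalyticAt.fun_comp (g := v₀) (by rwa [toPoint_zero]) (analyticAt_snd.fun_comp hq)
      have c4 : AnalyticAt ℝ (fun z => w₀ ((toPoint x₀ z).1, (toPoint x₀ z).2.2)) 0 :=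
        AnalyticAt.fun_comp (g := w₀) (by rwa [toPoint_zero])
          ((analyticAt_fst.fun_comp hq).prod (analyticAt_snd.fun_comp (analyticAt_snd.fun_comp hq)))
      rintro (a | b)
      · exact (analyticAt_pi_iff.1 c1 a).sub (analyticAt_pi_iff.1 c3 a)
      · exact (analyticAt_pi_iff.1 c2 b).sub (analyticAt_pi_iff.1 c4 b)
    · have := (hv.eventually_analyticAt.and hw.eventually_analyticAt).and
        ((eventually_analyticAt_data hv₀ hw₀).and h)
      filter_upwards [(tendsto_toPoint x₀).eventually this] with z hz hp j
      have := ((Φ.solvesAt_iff hz.1.1 hz.1.2 hz.2.1.1 hz.2.1.2).1 (hz.2.2 (hp 0) (hp 1))) j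
      exact ⟨this.1, this.2.lineDeriv⟩
  obtain ⟨k1, k2⟩ := key hv hw h
  obtain ⟨k3, k4⟩ := key hv' hw' h'
  have hall := eventually_all.2 fun j => k2.eventuallyEq
    (Φ.analyticAt_deviationRHS hv₀ hw₀ hF hG) k1 k3 k4 j
  have hall' := (tendsto_ofPoint x₀).eventually hall
  constructor
  · filter_upwards [hall'] with q hq
    funext a
    have := hq (Sum.inl a)
    change v _ a - v₀ _ a = v' _ a - v₀ _ a at this
    rw [toPoint_ofPoint] at this
    linarith
  · filter_upwards [hall'] with q hq
    funext b
    have := hq (Sum.inr b)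
    change w _ b - w₀ _ b = w' _ b - w₀ _ b at this
    rw [toPoint_ofPoint] at this
    linarith

end inputs

end CharSystem

/-! ### Change of chart and covariance -/

section

open scoped Topology
open Filter

theorem analyticAt_chart_transition {d : ℕ} {S : Type*} [TopologicalSpace S]
    [ChartedSpace (Ang d) S] [IsManifold 𝓘(ℝ, Ang d) ω S] (i j : atlas (Ang d) S) {p : S}
    (hi : p ∈ i.1.source) (hj : p ∈ j.1.source) :
    AnalyticAt ℝ (fun x => i.1 (j.1.symm x)) (j.1 p) := by
  have h := (contDiffGroupoid ω 𝓘(ℝ, Ang d)).compatible j.2 i.2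
  rw [contDiffGroupoid, mem_groupoid_of_pregroupoid] at h
  have h1 : ContDiffOn ℝ ω (j.1.symm ≫ₕ i.1) (j.1.symm ≫ₕ i.1).source := by
    simpa [contDiffPregroupoid] using h.1
  have h2 : j.1 p ∈ (j.1.symm ≫ₕ i.1).source := by
    simp [j.1.map_source hj, j.1.left_inv hj, hi]
  exact (h1.contDiffAt ((j.1.symm ≫ₕ i.1).open_source.mem_nhds h2)).analyticAt

theorem eventually_chart_symm_mem {d : ℕ} {S : Type*} [TopologicalSpace S]
    [ChartedSpace (Ang d) S] (j : atlas (Ang d) S) {p : S} (hj : p ∈ j.1.source) {U : Set S}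
    (hU : U ∈ 𝓝 p) : ∀ᶠ x in 𝓝 (j.1 p), x ∈ j.1.target ∧ j.1.symm x ∈ U := by
  have h1 : ContinuousAt j.1.symm (j.1 p) := j.1.continuousAt_symm (j.1.map_source hj)
  have h2 : U ∈ 𝓝 (j.1.symm (j.1 p)) := by rwa [j.1.left_inv hj]
  exact (j.1.open_target.eventually_mem (j.1.map_source hj)).and (h1.eventually h2)

namespace ComponentBundle

variable {d k : ℕ} {S : Type*} [TopologicalSpace S] [ChartedSpace (Ang d) S]
  {Z : ComponentBundle d k S}

theorem IsAnalytic.mem_baseSet (hZ : Z.IsAnalytic) {i : atlas (Ang d) S} {p : S}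
    (hi : p ∈ i.1.source) : p ∈ Z.baseSet i := by
  rwa [hZ.baseSet_eq]

theorem inChart_apply {i : atlas (Ang d) S} {p : S} (hi : p ∈ i.1.source) (s : ∀ p : S, Z.Fiber p) :
    Z.inChart i s (i.1 p) = Z.coordChange (Z.indexAt p) i p (s p) := by
  unfold inChart
  rw [i.1.left_inv hi]

theorem inChart_congr {i : atlas (Ang d) S} {s s' : ∀ p : S, Z.Fiber p} {x : Ang d}
    (h : s (i.1.symm x) = s' (i.1.symm x)) : Z.inChart i s x = Z.inChart i s' x := by
  unfold inChart
  rw [h]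

theorem IsAnalytic.eq_of_inChart_eq (hZ : Z.IsAnalytic) {i : atlas (Ang d) S} {p : S}
    (hi : p ∈ i.1.source) {s s' : ∀ p : S, Z.Fiber p}
    (h : Z.inChart i s (i.1 p) = Z.inChart i s' (i.1 p)) : s p = s' p := by
  have hb : p ∈ Z.baseSet (Z.indexAt p) ∩ Z.baseSet i ∩ Z.baseSet (Z.indexAt p) :=
    ⟨⟨Z.mem_baseSet_at p, hZ.mem_baseSet hi⟩, Z.mem_baseSet_at p⟩
  rw [inChart_apply hi, inChart_apply hi] at h
  have h2 := congrArg (Z.coordChange i (Z.indexAt p) p) h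
  have e : ∀ v : Fin k → ℝ,
      Z.coordChange i (Z.indexAt p) p (Z.coordChange (Z.indexAt p) i p v) = v := fun v =>
    (Z.coordChange_comp _ _ _ p hb v).trans (Z.coordChange_self _ p hb.2 v)
  exact (e (s p)).symm.trans (h2.trans (e (s' p)))

theorem IsAnalytic.coordChange_inChart (hZ : Z.IsAnalytic) {i j : atlas (Ang d) S} {p : S}
    (hi : p ∈ i.1.source) (hj : p ∈ j.1.source) (s : ∀ p : S, Z.Fiber p) :
    Z.coordChange i j p (Z.inChart i s (i.1 p)) = Z.inChart j s (j.1 p) := by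
  rw [inChart_apply hi, inChart_apply hj]
  exact Z.coordChange_comp _ _ _ p
    ⟨⟨Z.mem_baseSet_at p, hZ.mem_baseSet hi⟩, hZ.mem_baseSet hj⟩ _

theorem IsAnalytic.eventually_inChart_eq (hZ : Z.IsAnalytic) {i j : atlas (Ang d) S} {p : S}
    (hi : p ∈ i.1.source) (hj : p ∈ j.1.source) :
    ∀ᶠ x in 𝓝 (j.1 p), ∀ s : ∀ p : S, Z.Fiber p, Z.inChart j s x =
      Z.coordChange i j (j.1.symm x) (Z.inChart i s (i.1 (j.1.symm x))) := by
  filter_upwards [eventually_chart_symm_mem j hj (inter_mem (i.1.open_source.mem_nhds hi)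
    (j.1.open_source.mem_nhds hj))] with x hx s
  rw [hZ.coordChange_inChart hx.2.1 hx.2.2, j.1.right_inv hx.1]

variable [IsManifold 𝓘(ℝ, Ang d) ω S]

/-- The hypothesis gives analyticity in the coordinates of `i`; composing with the chart transition
gives it in those of `j`. -/
theorem IsAnalytic.analyticAt_coordChange (hZ : Z.IsAnalytic) {i j : atlas (Ang d) S} {p : S}
    (hi : p ∈ i.1.source) (hj : p ∈ j.1.source) :
    AnalyticAt ℝ (fun x => Z.coordChange i j (j.1.symm x)) (j.1 p) := by
  have h1 := hZ.coordChange_analytic i j (i.1 p) ⟨p, ⟨hi, hj⟩, rfl⟩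
  have h2 : AnalyticAt ℝ (fun x => Z.coordChange i j (i.1.symm (i.1 (j.1.symm x)))) (j.1 p) := by
    refine AnalyticAt.fun_comp (g := fun x => Z.coordChange i j (i.1.symm x))
      (f := fun x => i.1 (j.1.symm x)) ?_ (analyticAt_chart_transition i j hi hj)
    rwa [j.1.left_inv hj]
  refine h2.congr ?_
  filter_upwards [eventually_chart_symm_mem j hj (i.1.open_source.mem_nhds hi)] with x hx
  rw [i.1.left_inv hx.2]

theorem IsAnalytic.analyticAt_inChart₂ (hZ : Z.IsAnalytic) {i j : atlas (Ang d) S} {p : S}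
    (hi : p ∈ i.1.source) (hj : p ∈ j.1.source) {s : ℝ → ℝ → ∀ p : S, Z.Fiber p} {l u : ℝ}
    (h : AnalyticAt ℝ (fun q : ℝ × ℝ × Ang d => Z.inChart i (s q.1 q.2.1) q.2.2) (l, u, i.1 p)) :
    AnalyticAt ℝ (fun q : ℝ × ℝ × Ang d => Z.inChart j (s q.1 q.2.1) q.2.2) (l, u, j.1 p) := by
  have hx : AnalyticAt ℝ (fun q : ℝ × ℝ × Ang d => q.2.2) (l, u, j.1 p) :=
    analyticAt_snd.fun_comp analyticAt_snd
  have h1 : AnalyticAt ℝ (fun q : ℝ × ℝ × Ang d => Z.coordChange i j (j.1.symm q.2.2))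
      (l, u, j.1 p) :=
    AnalyticAt.fun_comp (g := fun x => Z.coordChange i j (j.1.symm x))
      (hZ.analyticAt_coordChange hi hj) hx
  have h2 : AnalyticAt ℝ (fun q : ℝ × ℝ × Ang d => i.1 (j.1.symm q.2.2)) (l, u, j.1 p) :=
    AnalyticAt.fun_comp (g := fun x => i.1 (j.1.symm x)) (analyticAt_chart_transition i j hi hj) hx
  have h3 : AnalyticAt ℝ (fun q : ℝ × ℝ × Ang d =>
      Z.inChart i (s q.1 q.2.1) (i.1 (j.1.symm q.2.2))) (l, u, j.1 p) := by
    refine AnalyticAt.fun_comp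
      (g := fun q : ℝ × ℝ × Ang d => Z.inChart i (s q.1 q.2.1) q.2.2)
      (f := fun q : ℝ × ℝ × Ang d => (q.1, q.2.1, i.1 (j.1.symm q.2.2))) ?_
      (analyticAt_fst.prod ((analyticAt_fst.fun_comp analyticAt_snd).prod h2))
    rwa [j.1.left_inv hj]
  have hb : ∀ r, AnalyticAt ℝ (fun r : ((Fin k → ℝ) →L[ℝ] (Fin k → ℝ)) × (Fin k → ℝ) => r.1 r.2) r :=
    fun r => (ContinuousLinearMap.id ℝ ((Fin k → ℝ) →L[ℝ] (Fin k → ℝ))).analyticAt_bilinear r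
  have h4 := AnalyticAt.fun_comp (hb _) (h1.prod h3)
  refine h4.congr ?_
  have hc : ContinuousAt (fun q : ℝ × ℝ × Ang d => q.2.2) (l, u, j.1 p) := by fun_prop
  filter_upwards [hc.eventually (hZ.eventually_inChart_eq hi hj)] with q hq
  exact (hq _).symm

/-- The derivative of the transformed components depends only on the value and first derivative of
the old ones, so the section may be replaced by the affine function used in `derivChange`. -/
theorem IsAnalytic.angDeriv_eq_derivChange (hZ : Z.IsAnalytic) {i j : atlas (Ang d) S} {p : S}
    (hi : p ∈ i.1.source) (hj : p ∈ j.1.source) {s : ∀ p : S, Z.Fiber p}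
    (h : DifferentiableAt ℝ (Z.inChart i s) (i.1 p)) :
    Z.angDeriv j s (j.1 p) =
      Z.derivChange i j p (Z.inChart i s (i.1 p)) (Z.angDeriv i s (i.1 p)) := by
  have hc := (hZ.analyticAt_coordChange hi hj).differentiableAt.hasFDerivAt
  have ht := (analyticAt_chart_transition i j hi hj).differentiableAt.hasFDerivAt
  have e : i.1 (j.1.symm (j.1 p)) = i.1 p := by rw [j.1.left_inv hj]
  have hA : HasFDerivAt (fun x => Z.inChart i s (i.1 (j.1.symm x)))
      (Z.angDeriv i s (i.1 p) ∘L fderiv ℝ (fun x => i.1 (j.1.symm x)) (j.1 p)) (j.1 p) := by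
    refine HasFDerivAt.comp (j.1 p) (g := Z.inChart i s) (f := fun x => i.1 (j.1.symm x)) ?_ ht
    rw [e]
    exact h.hasFDerivAt
  have hB : HasFDerivAt (fun x => Z.inChart i s (i.1 p) +
        Z.angDeriv i s (i.1 p) (i.1 (j.1.symm x) - i.1 p))
      (Z.angDeriv i s (i.1 p) ∘L fderiv ℝ (fun x => i.1 (j.1.symm x)) (j.1 p)) (j.1 p) :=
    ((Z.angDeriv i s (i.1 p)).hasFDerivAt.comp (j.1 p) (ht.sub_const (i.1 p))).const_add _
  have h1 := hc.clm_apply hA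
  have h2 := hc.clm_apply hB
  rw [e, sub_self, map_zero, add_zero] at h2
  rw [e] at h1
  have h3 : Z.angDeriv j s (j.1 p) = fderiv ℝ (fun x => Z.coordChange i j (j.1.symm x)
      (Z.inChart i s (i.1 (j.1.symm x)))) (j.1 p) := by
    refine Filter.EventuallyEq.fderiv_eq ?_
    filter_upwards [hZ.eventually_inChart_eq hi hj] with x hx
    exact hx s
  rw [h3, h1.fderiv]
  exact h2.fderiv.symm

omit [IsManifold 𝓘(ℝ, Ang d) ω S] in
theorem IsAnalytic.hasDerivAt_inChart (hZ : Z.IsAnalytic) {i j : atlas (Ang d) S} {p : S}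
    (hi : p ∈ i.1.source) (hj : p ∈ j.1.source) {s : ℝ → ∀ p : S, Z.Fiber p} {t : ℝ}
    {D : Fin k → ℝ} (h : HasDerivAt (fun t => Z.inChart i (s t) (i.1 p)) D t) :
    HasDerivAt (fun t => Z.inChart j (s t) (j.1 p)) (Z.coordChange i j p D) t := by
  have := (Z.coordChange i j p).hasFDerivAt.comp_hasDerivAt t h
  simpa only [Function.comp_def, hZ.coordChange_inChart hi hj] using this

/-- The section over the domain of the chart `i` with given components. -/
noncomputable def ofChart (Z : ComponentBundle d k S) (i : atlas (Ang d) S)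
    (g : Ang d → Fin k → ℝ) (p : S) : Z.Fiber p :=
  Z.coordChange i (Z.indexAt p) p (g (i.1 p))

omit [IsManifold 𝓘(ℝ, Ang d) ω S] in
theorem IsAnalytic.inChart_ofChart (hZ : Z.IsAnalytic) (i : atlas (Ang d) S)
    (g : Ang d → Fin k → ℝ) {x : Ang d} (hx : x ∈ i.1.target) :
    Z.inChart i (Z.ofChart i g) x = g x := by
  have hs := hZ.mem_baseSet (i.1.map_target hx)
  unfold inChart ofChart
  rw [Z.coordChange_comp _ _ _ _ ⟨⟨hs, Z.mem_baseSet_at _⟩, hs⟩, Z.coordChange_self _ _ hs,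
    i.1.right_inv hx]

end ComponentBundle

namespace CharSystem

variable {d m n : ℕ} {S : Type*} [TopologicalSpace S] [ChartedSpace (Ang d) S]

/-- Analyticity and the equations at the parameters `l, u` and the point `p`, in the chart `i`. -/
structure SolvesIn (Φ : CharSystem d m n) (ZV : ComponentBundle d m S) (ZW : ComponentBundle d n S)
    (V : ℝ → ℝ → ∀ p : S, ZV.Fiber p) (W : ℝ → ℝ → ∀ p : S, ZW.Fiber p) (l u : ℝ) (p : S)
    (i : atlas (Ang d) S) : Prop where
  analytic_V : AnalyticAt ℝ (fun q : ℝ × ℝ × Ang d => ZV.inChart i (V q.1 q.2.1) q.2.2) (l, u, i.1 p)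
  analytic_W : AnalyticAt ℝ (fun q : ℝ × ℝ × Ang d => ZW.inChart i (W q.1 q.2.1) q.2.2) (l, u, i.1 p)
  mem_domF : argF ZV ZW i (V l u) (W l u) (i.1 p) ∈ Φ.domF
  mem_domG : argG ZV ZW i (V l u) (W l u) (i.1 p) ∈ Φ.domG
  eq_V : HasDerivAt (fun t : ℝ => ZV.inChart i (V t u) (i.1 p))
      (Φ.F (argF ZV ZW i (V l u) (W l u) (i.1 p))) l
  eq_W : HasDerivAt (fun t : ℝ => ZW.inChart i (W l t) (i.1 p))
      (Φ.G (argG ZV ZW i (V l u) (W l u) (i.1 p))) u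

variable {Φ : CharSystem d m n} {ZV : ComponentBundle d m S} {ZW : ComponentBundle d n S}
  {V₀ : ℝ → ∀ p : S, ZV.Fiber p} {W₀ : ℝ → ∀ p : S, ZW.Fiber p}
  {V V' : ℝ → ℝ → ∀ p : S, ZV.Fiber p} {W W' : ℝ → ℝ → ∀ p : S, ZW.Fiber p}

theorem isSolution_iff {a b : ℝ} {N : Set S} :
    Φ.IsSolution ZV ZW V₀ W₀ a b N V W ↔
      (∀ l ∈ Icc 0 a, ∀ u ∈ Icc 0 b, ∀ p ∈ N, ∀ i : atlas (Ang d) S, p ∈ i.1.source →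
        Φ.SolvesIn ZV ZW V W l u p i) ∧
      (∀ u ∈ Icc 0 b, ∀ p ∈ N, V 0 u p = V₀ u p) ∧ ∀ l ∈ Icc 0 a, ∀ p ∈ N, W l 0 p = W₀ l p := by
  constructor
  · intro h
    exact ⟨fun l hl u hu p hp i hi => ⟨h.analytic_V i _ ⟨hl, hu, p, ⟨hp, hi⟩, rfl⟩,
      h.analytic_W i _ ⟨hl, hu, p, ⟨hp, hi⟩, rfl⟩, h.mem_domF l hl u hu i p ⟨hp, hi⟩,
      h.mem_domG l hl u hu i p ⟨hp, hi⟩, h.eq_V l hl u hu i p ⟨hp, hi⟩,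
      h.eq_W l hl u hu i p ⟨hp, hi⟩⟩, h.init_V, h.init_W⟩
  · rintro ⟨h, hV, hW⟩
    refine ⟨?_, ?_, fun l hl u hu i p hp => (h l hl u hu p hp.1 i hp.2).mem_domF,
      fun l hl u hu i p hp => (h l hl u hu p hp.1 i hp.2).mem_domG,
      fun l hl u hu i p hp => (h l hl u hu p hp.1 i hp.2).eq_V,
      fun l hl u hu i p hp => (h l hl u hu p hp.1 i hp.2).eq_W, hV, hW⟩
    · rintro i ⟨l, u, x⟩ ⟨hl, hu, p, hp, rfl⟩
      exact (h l hl u hu p hp.1 i hp.2).analytic_V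
    · rintro i ⟨l, u, x⟩ ⟨hl, hu, p, hp, rfl⟩
      exact (h l hl u hu p hp.1 i hp.2).analytic_W

theorem differentiableAt_of_analyticAt₂ {k : ℕ} {g : ℝ × ℝ × Ang d → Fin k → ℝ} {l u : ℝ} {x : Ang d}
    (h : AnalyticAt ℝ g (l, u, x)) : DifferentiableAt ℝ (fun x => g (l, u, x)) x :=
  h.differentiableAt.comp x (f := fun x => (l, u, x)) (by fun_prop)

/-- By covariance, the equations in one chart imply the equations in all charts. -/
theorem SolvesIn.change_chart [IsManifold 𝓘(ℝ, Ang d) ω S] (hZV : ZV.IsAnalytic)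
    (hZW : ZW.IsAnalytic) (hΦ : Φ.IsCovariant ZV ZW) {l u : ℝ} {p : S} {i j : atlas (Ang d) S}
    (hi : p ∈ i.1.source) (hj : p ∈ j.1.source) (h : Φ.SolvesIn ZV ZW V W l u p i) :
    Φ.SolvesIn ZV ZW V W l u p j := by
  have hV := hZV.angDeriv_eq_derivChange hi hj (s := V l u) (differentiableAt_of_analyticAt₂ h.analytic_V)
  have hW := hZW.angDeriv_eq_derivChange hi hj (s := W l u) (differentiableAt_of_analyticAt₂ h.analytic_W)
  have eF : argF ZV ZW j (V l u) (W l u) (j.1 p) =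
      (ZV.coordChange i j p (ZV.inChart i (V l u) (i.1 p)),
        ZW.coordChange i j p (ZW.inChart i (W l u) (i.1 p)),
        ZV.derivChange i j p (ZV.inChart i (V l u) (i.1 p)) (ZV.angDeriv i (V l u) (i.1 p)),
        ZW.derivChange i j p (ZW.inChart i (W l u) (i.1 p)) (ZW.angDeriv i (W l u) (i.1 p))) := by
    rw [argF, hV, hW, hZV.coordChange_inChart hi hj, hZW.coordChange_inChart hi hj]
  have eG : argG ZV ZW j (V l u) (W l u) (j.1 p) =
      (ZV.coordChange i j p (ZV.inChart i (V l u) (i.1 p)),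
        ZW.coordChange i j p (ZW.inChart i (W l u) (i.1 p)),
        ZV.derivChange i j p (ZV.inChart i (V l u) (i.1 p)) (ZV.angDeriv i (V l u) (i.1 p))) := by
    rw [argG, hV, hZV.coordChange_inChart hi hj, hZW.coordChange_inChart hi hj]
  have cF := hΦ.covariant_F i j p ⟨hi, hj⟩ _ _ _ _ h.mem_domF
  have cG := hΦ.covariant_G i j p ⟨hi, hj⟩ _ _ _ h.mem_domG
  refine ⟨hZV.analyticAt_inChart₂ hi hj h.analytic_V, hZW.analyticAt_inChart₂ hi hj h.analytic_W,
    ?_, ?_, ?_, ?_⟩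
  · rw [eF]; exact cF.1
  · rw [eG]; exact cG.1
  · have := hZV.hasDerivAt_inChart hi hj h.eq_V
    rw [eF]
    exact this.congr_deriv cF.2.symm
  · have := hZW.hasDerivAt_inChart hi hj h.eq_W
    rw [eG]
    exact this.congr_deriv cG.2.symm

/-- All the conditions depend only on the germs of the components; this lets the glued section
inherit the equations from each local solution. -/
theorem SolvesIn.congr {l u : ℝ} {p : S} {i : atlas (Ang d) S}
    (hV : (fun q : ℝ × ℝ × Ang d => ZV.inChart i (V q.1 q.2.1) q.2.2) =ᶠ[𝓝 (l, u, i.1 p)]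
      fun q => ZV.inChart i (V' q.1 q.2.1) q.2.2)
    (hW : (fun q : ℝ × ℝ × Ang d => ZW.inChart i (W q.1 q.2.1) q.2.2) =ᶠ[𝓝 (l, u, i.1 p)]
      fun q => ZW.inChart i (W' q.1 q.2.1) q.2.2)
    (h : Φ.SolvesIn ZV ZW V W l u p i) : Φ.SolvesIn ZV ZW V' W' l u p i := by
  have hx : Tendsto (fun x : Ang d => (l, u, x)) (𝓝 (i.1 p)) (𝓝 (l, u, i.1 p)) :=
    Continuous.tendsto (by fun_prop) _
  have hl : Tendsto (fun t : ℝ => (t, u, i.1 p)) (𝓝 l) (𝓝 (l, u, i.1 p)) :=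
    Continuous.tendsto (by fun_prop) _
  have hu : Tendsto (fun t : ℝ => (l, t, i.1 p)) (𝓝 u) (𝓝 (l, u, i.1 p)) :=
    Continuous.tendsto (by fun_prop) _
  have v1 := hV.self_of_nhds
  have w1 := hW.self_of_nhds
  have v2 : ZV.angDeriv i (V l u) (i.1 p) = ZV.angDeriv i (V' l u) (i.1 p) :=
    Filter.EventuallyEq.fderiv_eq (hx.eventually hV)
  have w2 : ZW.angDeriv i (W l u) (i.1 p) = ZW.angDeriv i (W' l u) (i.1 p) :=
    Filter.EventuallyEq.fderiv_eq (hx.eventually hW)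
  simp only at v1 w1
  have eF : argF ZV ZW i (V' l u) (W' l u) (i.1 p) = argF ZV ZW i (V l u) (W l u) (i.1 p) := by
    simp only [argF, v1, w1, v2, w2]
  have eG : argG ZV ZW i (V' l u) (W' l u) (i.1 p) = argG ZV ZW i (V l u) (W l u) (i.1 p) := by
    simp only [argG, v1, w1, v2]
  refine ⟨h.analytic_V.congr hV, h.analytic_W.congr hW, eF ▸ h.mem_domF, eG ▸ h.mem_domG, ?_, ?_⟩
  · rw [eF]
    exact h.eq_V.congr_of_eventuallyEq (hl.eventually (hV.mono fun _ h => h.symm))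
  · rw [eG]
    exact h.eq_W.congr_of_eventuallyEq (hu.eventually (hW.mono fun _ h => h.symm))

end CharSystem

/-! ### Uniqueness over `S` and local existence of sections -/

/-- The identity theorem along the convex, hence connected, set `A ×ˢ B ×ˢ {x}`. Analyticity in full
neighbourhoods of its points allows it to be thin and to contain its boundary, so the differential
equations are needed only near the corner. -/
theorem eqOn_of_eventuallyEq_at_corner {d k : ℕ} {g g' : ℝ × ℝ × Ang d → Fin k → ℝ} {x : Ang d}
    {A B : Set ℝ} (hA : Convex ℝ A) (hB : Convex ℝ B) (hA0 : 0 ∈ A) (hB0 : 0 ∈ B)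
    (hg : ∀ l ∈ A, ∀ u ∈ B, AnalyticAt ℝ g (l, u, x))
    (hg' : ∀ l ∈ A, ∀ u ∈ B, AnalyticAt ℝ g' (l, u, x)) (h : g =ᶠ[𝓝 (0, 0, x)] g')
    {l u : ℝ} (hl : l ∈ A) (hu : u ∈ B) : g (l, u, x) = g' (l, u, x) := by
  have hset : ∀ q : ℝ × ℝ × Ang d, q ∈ A ×ˢ B ×ˢ {x} → ∃ l ∈ A, ∃ u ∈ B, q = (l, u, x) := by
    rintro ⟨l, u, y⟩ ⟨hl, hu, rfl⟩
    exact ⟨l, hl, u, hu, rfl⟩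
  have h1 : AnalyticOnNhd ℝ g (A ×ˢ B ×ˢ {x}) := fun q hq => by
    obtain ⟨l, hl, u, hu, rfl⟩ := hset q hq
    exact hg l hl u hu
  have h2 : AnalyticOnNhd ℝ g' (A ×ˢ B ×ˢ {x}) := fun q hq => by
    obtain ⟨l, hl, u, hu, rfl⟩ := hset q hq
    exact hg' l hl u hu
  have hc : IsPreconnected (A ×ˢ B ×ˢ {x}) :=
    (hA.prod (hB.prod (convex_singleton x))).isPreconnected
  exact h1.eqOn_of_preconnected_of_eventuallyEq h2 hc (show (0, 0, x) ∈ _ from ⟨hA0, hB0, rfl⟩) h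
    ⟨hl, hu, rfl⟩

namespace CharSystem

variable {d m n : ℕ} {S : Type*} [TopologicalSpace S] [ChartedSpace (Ang d) S]
  {Φ : CharSystem d m n} {ZV : ComponentBundle d m S} {ZW : ComponentBundle d n S}
  {V₀ : ℝ → ∀ p : S, ZV.Fiber p} {W₀ : ℝ → ∀ p : S, ZW.Fiber p}
  {V V' : ℝ → ℝ → ∀ p : S, ZV.Fiber p} {W W' : ℝ → ℝ → ∀ p : S, ZW.Fiber p}

theorem IsSolution.mono {a b a' b' : ℝ} {N N' : Set S}
    (h : Φ.IsSolution ZV ZW V₀ W₀ a b N V W) (ha : a' ≤ a) (hb : b' ≤ b) (hN : N' ⊆ N) :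
    Φ.IsSolution ZV ZW V₀ W₀ a' b' N' V W := by
  rw [isSolution_iff] at h ⊢
  obtain ⟨h1, h2, h3⟩ := h
  have ha' : Icc 0 a' ⊆ Icc 0 a := Icc_subset_Icc_right ha
  have hb' : Icc 0 b' ⊆ Icc 0 b := Icc_subset_Icc_right hb
  exact ⟨fun l hl u hu p hp => h1 l (ha' hl) u (hb' hu) p (hN hp),
    fun u hu p hp => h2 u (hb' hu) p (hN hp), fun l hl p hp => h3 l (ha' hl) p (hN hp)⟩

/-- In every chart, a solution solves the problem in coordinates near the corner. -/
theorem IsSolution.eventually_solvesAt {a b : ℝ} {N : Set S}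
    (h : Φ.IsSolution ZV ZW V₀ W₀ a b N V W) (ha : 0 < a) (hb : 0 < b) (hN : IsOpen N) {p : S}
    (hp : p ∈ N) {i : atlas (Ang d) S} (hi : p ∈ i.1.source) :
    ∀ᶠ q : ℝ × ℝ × Ang d in 𝓝 (0, 0, i.1 p), 0 ≤ q.1 → 0 ≤ q.2.1 →
      Φ.SolvesAt (fun r => ZV.inChart i (V₀ r.1) r.2) (fun r => ZW.inChart i (W₀ r.1) r.2)
        (fun q => ZV.inChart i (V q.1 q.2.1) q.2.2) (fun q => ZW.inChart i (W q.1 q.2.1) q.2.2) q := by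
  obtain ⟨h1, h2, h3⟩ := isSolution_iff.1 h
  have c1 : ContinuousAt (fun q : ℝ × ℝ × Ang d => q.1) (0, 0, i.1 p) := by fun_prop
  have c2 : ContinuousAt (fun q : ℝ × ℝ × Ang d => q.2.1) (0, 0, i.1 p) := by fun_prop
  have c3 : ContinuousAt (fun q : ℝ × ℝ × Ang d => q.2.2) (0, 0, i.1 p) := by fun_prop
  filter_upwards [c1.eventually_lt_const ha, c2.eventually_lt_const hb,
    c3.eventually (eventually_chart_symm_mem i hi (inter_mem (hN.mem_nhds hp)
      (i.1.open_source.mem_nhds hi)))] with q q1 q2 q3 p1 p2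
  obtain ⟨l, u, x⟩ := q
  obtain ⟨hx, hxN, hxi⟩ := q3
  have e : i.1 (i.1.symm x) = x := i.1.right_inv hx
  have hs := h1 l ⟨p1, q1.le⟩ u ⟨p2, q2.le⟩ _ hxN i hxi
  have sV := hs.eq_V
  have sW := hs.eq_W
  rw [e] at sV sW
  refine ⟨sV, sW, fun h0 => ?_, fun h0 => ?_⟩
  · change l = 0 at h0
    subst h0
    exact ComponentBundle.inChart_congr (h2 u ⟨p2, q2.le⟩ _ hxN)
  · change u = 0 at h0
    subst h0
    exact ComponentBundle.inChart_congr (h3 l ⟨p1, q1.le⟩ _ hxN)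

/-- Two solutions agree at all parameters up to which both are analytic. -/
theorem IsSolution.eq_of_isSolution (hZV : ZV.IsAnalytic) (hZW : ZW.IsAnalytic) {lam₁ nu₁ : ℝ}
    (hlam₁ : 0 < lam₁) (hnu₁ : 0 < nu₁)
    (hV₀ : ZV.AnalyticFamily₁ nu₁ univ V₀) (hW₀ : ZW.AnalyticFamily₁ lam₁ univ W₀)
    (hdomF : ∀ i : atlas (Ang d) S, ∀ p ∈ i.1.source, argF ZV ZW i (V₀ 0) (W₀ 0) (i.1 p) ∈ Φ.domF)
    (hdomG : ∀ i : atlas (Ang d) S, ∀ p ∈ i.1.source, argG ZV ZW i (V₀ 0) (W₀ 0) (i.1 p) ∈ Φ.domG)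
    {a b : ℝ} (ha : 0 < a) (hb : 0 < b) {N : Set S} (hN : IsOpen N)
    (h : Φ.IsSolution ZV ZW V₀ W₀ a b N V W) (h' : Φ.IsSolution ZV ZW V₀ W₀ a b N V' W')
    {p : S} (hp : p ∈ N) {i : atlas (Ang d) S} (hi : p ∈ i.1.source)
    {A B : Set ℝ} (hA : Convex ℝ A) (hB : Convex ℝ B) (hA0 : 0 ∈ A) (hB0 : 0 ∈ B)
    (hs : ∀ l ∈ A, ∀ u ∈ B, Φ.SolvesIn ZV ZW V W l u p i)
    (hs' : ∀ l ∈ A, ∀ u ∈ B, Φ.SolvesIn ZV ZW V' W' l u p i) {l u : ℝ} (hl : l ∈ A) (hu : u ∈ B) :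
    V' l u p = V l u p ∧ W' l u p = W l u p := by
  -- The rectangle `[0, a] × [0, b]` and `N` serve only to supply the equations near the corner. The
  -- agreement then spreads over `A × B`, which may include negative parameters.
  obtain ⟨e1, e2⟩ := Φ.local_solution_unique (hV₀ i (0, i.1 p) ⟨⟨le_rfl, hnu₁.le⟩, p, ⟨trivial, hi⟩, rfl⟩)
    (hW₀ i (0, i.1 p) ⟨⟨le_rfl, hlam₁.le⟩, p, ⟨trivial, hi⟩, rfl⟩) (hdomF i p hi) (hdomG i p hi)
    (hs' 0 hA0 0 hB0).analytic_V (hs' 0 hA0 0 hB0).analytic_W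
    (h'.eventually_solvesAt ha hb hN hp hi) (hs 0 hA0 0 hB0).analytic_V (hs 0 hA0 0 hB0).analytic_W
    (h.eventually_solvesAt ha hb hN hp hi)
  constructor
  · exact hZV.eq_of_inChart_eq hi (eqOn_of_eventuallyEq_at_corner hA hB hA0 hB0
      (fun l hl u hu => (hs' l hl u hu).analytic_V) (fun l hl u hu => (hs l hl u hu).analytic_V)
      e1 hl hu)
  · exact hZW.eq_of_inChart_eq hi (eqOn_of_eventuallyEq_at_corner hA hB hA0 hB0
      (fun l hl u hu => (hs' l hl u hu).analytic_W) (fun l hl u hu => (hs l hl u hu).analytic_W)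
      e2 hl hu)

theorem continuousAt_localArgF {v : ℝ × ℝ × Ang d → Fin m → ℝ} {w : ℝ × ℝ × Ang d → Fin n → ℝ}
    {q : ℝ × ℝ × Ang d} (hv : AnalyticAt ℝ v q) (hw : AnalyticAt ℝ w q) :
    ContinuousAt (localArgF v w) q := by
  have key : ∀ {k : ℕ} {g : ℝ × ℝ × Ang d → Fin k → ℝ}, AnalyticAt ℝ g q →
      ContinuousAt (fun q : ℝ × ℝ × Ang d => fderiv ℝ (fun x => g (q.1, q.2.1, x)) q.2.2) q := by
    intro k g hg
    have h1 : AnalyticAt ℝ (fun r : (ℝ × ℝ) × Ang d => g (r.1.1, r.1.2, r.2))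
        ((q.1, q.2.1), q.2.2) :=
      AnalyticAt.fun_comp (g := g) (f := fun r : (ℝ × ℝ) × Ang d => (r.1.1, r.1.2, r.2)) hg
        ((analyticAt_fst.fun_comp analyticAt_fst).prod
          ((analyticAt_snd.fun_comp analyticAt_fst).prod analyticAt_snd))
    exact ContinuousAt.comp (f := fun q : ℝ × ℝ × Ang d => ((q.1, q.2.1), q.2.2))
      (g := fun p : (ℝ × ℝ) × Ang d => fderiv ℝ (fun x => g (p.1.1, p.1.2, x)) p.2)
      (analyticAt_fderiv_slice h1).continuousAt (by fun_prop)
  exact hv.continuousAt.prodMk (hw.continuousAt.prodMk ((key hv).prodMk (key hw)))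

/-- Local existence of sections near a point. -/
theorem exists_solution_near_point [IsManifold 𝓘(ℝ, Ang d) ω S] (hZV : ZV.IsAnalytic)
    (hZW : ZW.IsAnalytic) (hΦ : Φ.IsCovariant ZV ZW) {lam₁ nu₁ : ℝ}
    (hlam₁ : 0 < lam₁) (hnu₁ : 0 < nu₁)
    (hV₀ : ZV.AnalyticFamily₁ nu₁ univ V₀) (hW₀ : ZW.AnalyticFamily₁ lam₁ univ W₀)
    (hdomF : ∀ i : atlas (Ang d) S, ∀ p ∈ i.1.source, argF ZV ZW i (V₀ 0) (W₀ 0) (i.1 p) ∈ Φ.domF)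
    (hdomG : ∀ i : atlas (Ang d) S, ∀ p ∈ i.1.source, argG ZV ZW i (V₀ 0) (W₀ 0) (i.1 p) ∈ Φ.domG)
    (p₀ : S) :
    ∃ ε : ℝ, 0 < ε ∧ ∃ U : Set S, IsOpen U ∧ p₀ ∈ U ∧
      ∃ (V : ℝ → ℝ → ∀ p : S, ZV.Fiber p) (W : ℝ → ℝ → ∀ p : S, ZW.Fiber p),
        (∀ l ∈ Ioo (-ε) ε, ∀ u ∈ Ioo (-ε) ε, ∀ p ∈ U, ∀ i : atlas (Ang d) S, p ∈ i.1.source →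
          Φ.SolvesIn ZV ZW V W l u p i) ∧
        (∀ u ∈ Ioo (-ε) ε, ∀ p ∈ U, V 0 u p = V₀ u p) ∧
        ∀ l ∈ Ioo (-ε) ε, ∀ p ∈ U, W l 0 p = W₀ l p := by
  let i : atlas (Ang d) S := ⟨chartAt (Ang d) p₀, chart_mem_atlas _ _⟩
  have hi : p₀ ∈ i.1.source := mem_chart_source _ _
  obtain ⟨v, w, hv, hw, hvw⟩ := Φ.exists_local_solution
    (hV₀ i (0, i.1 p₀) ⟨⟨le_rfl, hnu₁.le⟩, p₀, ⟨trivial, hi⟩, rfl⟩)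
    (hW₀ i (0, i.1 p₀) ⟨⟨le_rfl, hlam₁.le⟩, p₀, ⟨trivial, hi⟩, rfl⟩) (hdomF i p₀ hi) (hdomG i p₀ hi)
  have hx : Tendsto (fun x : Ang d => ((0 : ℝ), (0 : ℝ), x)) (𝓝 (i.1 p₀)) (𝓝 (0, 0, i.1 p₀)) :=
    Continuous.tendsto (by fun_prop) _
  -- Agreement with the data holds near `i.1 p₀`, so the angular derivatives agree too. Hence the
  -- arguments at the corner lie in the domains of `F` and `G`, and by openness they do so nearby.
  have evV : (fun x => v (0, 0, x)) =ᶠ[𝓝 (i.1 p₀)] ZV.inChart i (V₀ 0) :=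
    (hx.eventually hvw).mono fun x h => h.init_V rfl
  have evW : (fun x => w (0, 0, x)) =ᶠ[𝓝 (i.1 p₀)] ZW.inChart i (W₀ 0) :=
    (hx.eventually hvw).mono fun x h => h.init_W rfl
  have eF : localArgF v w (0, 0, i.1 p₀) = argF ZV ZW i (V₀ 0) (W₀ 0) (i.1 p₀) := by
    simp only [localArgF, argF, ComponentBundle.angDeriv, evV.self_of_nhds, evW.self_of_nhds,
      evV.fderiv_eq, evW.fderiv_eq]
  have eG : localArgG v w (0, 0, i.1 p₀) = argG ZV ZW i (V₀ 0) (W₀ 0) (i.1 p₀) := by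
    simp only [localArgG, argG, ComponentBundle.angDeriv, evV.self_of_nhds, evW.self_of_nhds,
      evV.fderiv_eq]
  have cF := continuousAt_localArgF hv hw
  have cG : ContinuousAt (localArgG v w) (0, 0, i.1 p₀) :=
    cF.fst.prodMk (cF.snd.fst.prodMk cF.snd.snd.fst)
  have oF := cF.eventually_mem (Φ.isOpen_domF.mem_nhds (by rw [eF]; exact hdomF i p₀ hi))
  have oG := cG.eventually_mem (Φ.isOpen_domG.mem_nhds (by rw [eG]; exact hdomG i p₀ hi))
  obtain ⟨ε, hε, hball⟩ := Metric.eventually_nhds_iff_ball.1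
    ((hvw.and (oF.and oG)).and (hv.eventually_analyticAt.and hw.eventually_analyticAt))
  have hmem : ∀ l ∈ Ioo (-ε) ε, ∀ u ∈ Ioo (-ε) ε, ∀ x ∈ Metric.ball (i.1 p₀) ε,
      ((l, u, x) : ℝ × ℝ × Ang d) ∈ Metric.ball (0, 0, i.1 p₀) ε := by
    intro l hl u hu x hx
    rw [← ball_prod_same, ← ball_prod_same, Real.ball_eq_Ioo, zero_sub, zero_add]
    exact ⟨hl, hu, hx⟩
  have h0 : (0 : ℝ) ∈ Ioo (-ε) ε := by constructor <;> linarith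
  let V : ℝ → ℝ → ∀ p : S, ZV.Fiber p := fun l u => ZV.ofChart i fun x => v (l, u, x)
  let W : ℝ → ℝ → ∀ p : S, ZW.Fiber p := fun l u => ZW.ofChart i fun x => w (l, u, x)
  have eV : ∀ q : ℝ × ℝ × Ang d, q.2.2 ∈ i.1.target → ZV.inChart i (V q.1 q.2.1) q.2.2 = v q :=
    fun q hq => hZV.inChart_ofChart i (fun x => v (q.1, q.2.1, x)) hq
  have eW : ∀ q : ℝ × ℝ × Ang d, q.2.2 ∈ i.1.target → ZW.inChart i (W q.1 q.2.1) q.2.2 = w q :=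
    fun q hq => hZW.inChart_ofChart i (fun x => w (q.1, q.2.1, x)) hq
  refine ⟨ε, hε, i.1.source ∩ i.1 ⁻¹' Metric.ball (i.1 p₀) ε,
    i.1.isOpen_inter_preimage Metric.isOpen_ball, ⟨hi, Metric.mem_ball_self hε⟩, V, W, ?_, ?_, ?_⟩
  · rintro l hl u hu p ⟨hpi, hpb⟩ j hj
    -- It suffices to verify the equations in the chart in which the solution was built.
    refine SolvesIn.change_chart hZV hZW hΦ hpi hj ?_
    obtain ⟨⟨s1, s2, s3⟩, s4, s5⟩ := hball _ (hmem l hl u hu _ hpb)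
    have ht := i.1.map_source hpi
    have hnear : ∀ᶠ q : ℝ × ℝ × Ang d in 𝓝 (l, u, i.1 p), q.2.2 ∈ i.1.target :=
      (show ContinuousAt (fun q : ℝ × ℝ × Ang d => q.2.2) (l, u, i.1 p) by fun_prop).eventually
        (i.1.open_target.eventually_mem ht)
    have hnear' : ∀ᶠ x in 𝓝 (i.1 p), x ∈ i.1.target := i.1.open_target.eventually_mem ht
    have dV : ZV.angDeriv i (V l u) (i.1 p) = fderiv ℝ (fun x => v (l, u, x)) (i.1 p) :=
      Filter.EventuallyEq.fderiv_eq (hnear'.mono fun x hx => eV (l, u, x) hx)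
    have dW : ZW.angDeriv i (W l u) (i.1 p) = fderiv ℝ (fun x => w (l, u, x)) (i.1 p) :=
      Filter.EventuallyEq.fderiv_eq (hnear'.mono fun x hx => eW (l, u, x) hx)
    have aF : argF ZV ZW i (V l u) (W l u) (i.1 p) = localArgF v w (l, u, i.1 p) := by
      rw [argF, localArgF, dV, dW, eV (l, u, i.1 p) ht, eW (l, u, i.1 p) ht]
    have aG : argG ZV ZW i (V l u) (W l u) (i.1 p) = localArgG v w (l, u, i.1 p) := by
      rw [argG, localArgG, dV, eV (l, u, i.1 p) ht, eW (l, u, i.1 p) ht]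
    refine ⟨s4.congr (hnear.mono fun q hq => (eV q hq).symm),
      s5.congr (hnear.mono fun q hq => (eW q hq).symm), by rwa [aF], by rwa [aG], ?_, ?_⟩
    · rw [aF]
      have : (fun t => ZV.inChart i (V t u) (i.1 p)) = fun t => v (t, u, i.1 p) :=
        funext fun t => eV (t, u, i.1 p) ht
      rw [this]
      exact s1.eq_V
    · rw [aG]
      have : (fun t => ZW.inChart i (W l t) (i.1 p)) = fun t => w (l, t, i.1 p) :=
        funext fun t => eW (l, t, i.1 p) ht
      rw [this]
      exact s1.eq_W
  · rintro u hu p ⟨hpi, hpb⟩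
    refine hZV.eq_of_inChart_eq hpi ?_
    rw [eV (0, u, i.1 p) (i.1.map_source hpi)]
    exact (hball _ (hmem 0 h0 u hu _ hpb)).1.1.init_V rfl
  · rintro l hl p ⟨hpi, hpb⟩
    refine hZW.eq_of_inChart_eq hpi ?_
    rw [eW (l, 0, i.1 p) (i.1.map_source hpi)]
    exact (hball _ (hmem l hl 0 h0 _ hpb)).1.1.init_W rfl

end CharSystem

end

/-! ### Gluing over a compact set -/

theorem Finset.exists_pos_forall_le {ι : Type*} (t : Finset ι) {f : ι → ℝ} (h : ∀ i, 0 < f i) :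
    ∃ e > 0, ∀ i ∈ t, e ≤ f i := by
  classical
  induction t using Finset.induction_on with
  | empty => exact ⟨1, one_pos, by simp⟩
  | insert i t _ ih =>
    obtain ⟨e, he, h2⟩ := ih
    refine ⟨min e (f i), lt_min he (h i), fun j hj => ?_⟩
    rcases Finset.mem_insert.1 hj with rfl | hj
    · exact min_le_right _ _
    · exact (min_le_left _ _).trans (h2 j hj)

theorem theorem4p1 {d m n : ℕ} {S : Type*} [TopologicalSpace S] [ChartedSpace (Ang d) S]
    [IsManifold 𝓘(ℝ, Ang d) ω S]
    (ZV : ComponentBundle d m S) (ZW : ComponentBundle d n S)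
    (hZV : ZV.IsAnalytic) (hZW : ZW.IsAnalytic)
    (Φ : CharSystem d m n) (hΦ : Φ.IsCovariant ZV ZW)
    (K : Set S) (hK : IsCompact K)
    (lam₁ nu₁ : ℝ) (hlam₁ : 0 < lam₁) (hnu₁ : 0 < nu₁)
    (V₀ : ℝ → ∀ p : S, ZV.Fiber p) (W₀ : ℝ → ∀ p : S, ZW.Fiber p)
    (hV₀ : ZV.AnalyticFamily₁ nu₁ univ V₀) (hW₀ : ZW.AnalyticFamily₁ lam₁ univ W₀)
    (hdomF : ∀ i : atlas (Ang d) S, ∀ p ∈ i.1.source,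
      CharSystem.argF ZV ZW i (V₀ 0) (W₀ 0) (i.1 p) ∈ Φ.domF)
    (hdomG : ∀ i : atlas (Ang d) S, ∀ p ∈ i.1.source,
      CharSystem.argG ZV ZW i (V₀ 0) (W₀ 0) (i.1 p) ∈ Φ.domG) :
    ∃ a b : ℝ, 0 < a ∧ a ≤ lam₁ ∧ 0 < b ∧ b ≤ nu₁ ∧
      ∃ N : Set S, IsOpen N ∧ K ⊆ N ∧
        ∃ (V : ℝ → ℝ → ∀ p : S, ZV.Fiber p) (W : ℝ → ℝ → ∀ p : S, ZW.Fiber p),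
          Φ.IsSolution ZV ZW V₀ W₀ a b N V W ∧
          ∀ (a' b' : ℝ) (N' : Set S), 0 < a' → a' ≤ a → 0 < b' → b' ≤ b →
            IsOpen N' → N' ⊆ N →
            ∀ (V' : ℝ → ℝ → ∀ p : S, ZV.Fiber p) (W' : ℝ → ℝ → ∀ p : S, ZW.Fiber p),
              Φ.IsSolution ZV ZW V₀ W₀ a' b' N' V' W' →
              ∀ l ∈ Icc 0 a', ∀ u ∈ Icc 0 b', ∀ p ∈ N',
                V' l u p = V l u p ∧ W' l u p = W l u p := by
  classical
  choose ε hε U hUo hUp Vl Wl hsol hVl hWl using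
    CharSystem.exists_solution_near_point hZV hZW hΦ hlam₁ hnu₁ hV₀ hW₀ hdomF hdomG
  obtain ⟨t, -, ht⟩ := hK.elim_nhds_subcover U fun p _ => (hUo p).mem_nhds (hUp p)
  obtain ⟨e, he, het⟩ := t.exists_pos_forall_le hε
  have hIoo : ∀ k ∈ t, Ioo (-e) e ⊆ Ioo (-ε k) (ε k) := fun k hk =>
    Ioo_subset_Ioo (neg_le_neg (het k hk)) (het k hk)
  -- Halving `e` leaves a full parameter neighbourhood around every point of the closed rectangle.
  have hIcc : Icc 0 (e / 2) ⊆ Ioo (-e) e := fun r hr => ⟨by linarith [hr.1], by linarith [hr.2]⟩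
  have he0 : (0 : ℝ) ∈ Ioo (-e) e := by constructor <;> linarith
  have hN : IsOpen (⋃ k ∈ t, U k) := isOpen_biUnion fun k _ => hUo k
  have hloc : ∀ k ∈ t, Φ.IsSolution ZV ZW V₀ W₀ (e / 2) (e / 2) (U k) (Vl k) (Wl k) := fun k hk =>
    CharSystem.isSolution_iff.2 ⟨fun l hl u hu => hsol k l (hIoo k hk (hIcc hl)) u (hIoo k hk (hIcc hu)),
      fun u hu => hVl k u (hIoo k hk (hIcc hu)), fun l hl => hWl k l (hIoo k hk (hIcc hl))⟩
  -- An arbitrary choice of local solution at each point. Its irregularity is harmless because of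
  -- `hVW`, and the default value off the cover is irrelevant.
  let κ : S → S := fun p => if h : ∃ k ∈ t, p ∈ U k then h.choose else p
  have hκ : ∀ k ∈ t, ∀ p ∈ U k, κ p ∈ t ∧ p ∈ U (κ p) := fun k hk p hp => by
    have h : ∃ k ∈ t, p ∈ U k := ⟨k, hk, hp⟩
    simp only [κ, dif_pos h]
    exact h.choose_spec
  let V : ℝ → ℝ → ∀ p : S, ZV.Fiber p := fun l u p => Vl (κ p) l u p
  let W : ℝ → ℝ → ∀ p : S, ZW.Fiber p := fun l u p => Wl (κ p) l u p
  -- Agreement is proved on the open intervals, negative parameters included, since transferring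
  -- analyticity and two-sided derivatives at the boundary of the rectangle requires equality of
  -- germs.
  have hVW : ∀ k ∈ t, ∀ p ∈ U k, ∀ l ∈ Ioo (-e) e, ∀ u ∈ Ioo (-e) e,
      Vl k l u p = V l u p ∧ Wl k l u p = W l u p := by
    intro k hk p hp l hl u hu
    obtain ⟨hk', hp'⟩ := hκ k hk p hp
    exact CharSystem.IsSolution.eq_of_isSolution hZV hZW hlam₁ hnu₁ hV₀ hW₀ hdomF hdomG (half_pos he)
      (half_pos he) ((hUo k).inter (hUo (κ p)))
      ((hloc _ hk').mono le_rfl le_rfl inter_subset_right)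
      ((hloc k hk).mono le_rfl le_rfl inter_subset_left) ⟨hp, hp'⟩
      (i := ⟨chartAt (Ang d) p, chart_mem_atlas _ _⟩) (mem_chart_source _ _)
      (convex_Ioo (-e) e) (convex_Ioo (-e) e) he0 he0
      (fun l hl u hu => hsol _ l (hIoo _ hk' hl) u (hIoo _ hk' hu) p hp' _ (mem_chart_source _ _))
      (fun l hl u hu => hsol _ l (hIoo _ hk hl) u (hIoo _ hk hu) p hp _ (mem_chart_source _ _))
      hl hu
  have hmain : Φ.IsSolution ZV ZW V₀ W₀ (e / 2) (e / 2) (⋃ k ∈ t, U k) V W := by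
    refine CharSystem.isSolution_iff.2 ⟨fun l hl u hu p hp i hi => ?_, fun u hu p hp => ?_, fun l hl p hp => ?_⟩
    all_goals
      obtain ⟨k, hk, hpk⟩ := mem_iUnion₂.1 hp
    · have c1 : ContinuousAt (fun q : ℝ × ℝ × Ang d => q.1) (l, u, i.1 p) := by fun_prop
      have c2 : ContinuousAt (fun q : ℝ × ℝ × Ang d => q.2.1) (l, u, i.1 p) := by fun_prop
      have c3 : ContinuousAt (fun q : ℝ × ℝ × Ang d => q.2.2) (l, u, i.1 p) := by fun_prop
      have hev := (c1.eventually (isOpen_Ioo.eventually_mem (hIcc hl))).and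
        ((c2.eventually (isOpen_Ioo.eventually_mem (hIcc hu))).and
        (c3.eventually (eventually_chart_symm_mem i hi ((hUo k).mem_nhds hpk))))
      refine CharSystem.SolvesIn.congr (hev.mono fun q hq => ?_) (hev.mono fun q hq => ?_)
        (hsol k l (hIoo k hk (hIcc hl)) u (hIoo k hk (hIcc hu)) p hpk i hi)
      · exact ComponentBundle.inChart_congr (hVW k hk _ hq.2.2.2 _ hq.1 _ hq.2.1).1
      · exact ComponentBundle.inChart_congr (hVW k hk _ hq.2.2.2 _ hq.1 _ hq.2.1).2
    · rw [← (hVW k hk p hpk 0 he0 u (hIcc hu)).1]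
      exact hVl k u (hIoo k hk (hIcc hu)) p hpk
    · rw [← (hVW k hk p hpk l (hIcc hl) 0 he0).2]
      exact hWl k l (hIoo k hk (hIcc hl)) p hpk
  refine ⟨min lam₁ (e / 2), min nu₁ (e / 2), lt_min hlam₁ (half_pos he), min_le_left _ _,
    lt_min hnu₁ (half_pos he), min_le_left _ _, _, hN, ht, V, W,
    hmain.mono (min_le_right _ _) (min_le_right _ _) subset_rfl, ?_⟩
  intro a' b' N' ha' ha hb' hb hN' hNN V' W' h' l hl u hu p hp
  have h := hmain.mono (ha.trans (min_le_right _ _)) (hb.trans (min_le_right _ _)) hNN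
  exact CharSystem.IsSolution.eq_of_isSolution hZV hZW hlam₁ hnu₁ hV₀ hW₀ hdomF hdomG ha' hb' hN' h h' hp
    (i := ⟨chartAt (Ang d) p, chart_mem_atlas _ _⟩) (mem_chart_source _ _)
    (convex_Icc 0 a') (convex_Icc 0 b') ⟨le_rfl, ha'.le⟩ ⟨le_rfl, hb'.le⟩
    (fun l hl u hu => (CharSystem.isSolution_iff.1 h).1 l hl u hu p hp _ (mem_chart_source _ _))
    (fun l hl u hu => (CharSystem.isSolution_iff.1 h').1 l hl u hu p hp _ (mem_chart_source _ _)) hl hu
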